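/- Let $\mathcal N$ be a continuous nest of projections on a separable complex Hilbert space $\mathcal H$ (a complete chain of projections containing $0$ and $I$ with $N=\sup\{L\in\mathcal N: L<N\}$ for all $N\in\mathcal N$), and let $\operatorname{Alg}\mathcal N$ be the algebra of bounded operators leaving the range of every $N\in\mathcal N$ invariant. Write $\|\cdot\|_e$ for the essential norm, that is, the distance to the compact operators. For $X\in\operatorname{Alg}\mathcal N$ and $N\in\mathcal N$ put \[ e_N^+(X)=\lim_{M\downarrow N}\ \sup_{N<L<M}\|(M-L)X(M-L)\|_e,\qquad i_N^+(X)=\lim_{M\downarrow N}\|(M-N)X(M-N)\| \] if $N<I$, and $e_I^+(X)=i_I^+(X)=0$; put \[ e_N^-(X)=\lim_{M\uparrow N}\ \sup_{M<L<N}\|(L-M)X(L-M)\|_e,\qquad i_N^-(X)=\lim_{M\uparrow N}\|(N-M)X(N-M)\| \] if $N>0$, and $e_0^-(X)=i_0^-(X)=0$; and put \[ j_N(X)=\lim_{M\downarrow N,\ L\uparrow N}\|(M-L)X(M-L)\|\ \text{ if } 0<N<I,\qquad j_0(X)=i_0^+(X),\qquad j_I(X)=i_I^-(X). \] A \emph{diagonal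 seminorm function} is a map $(X,N)\mapsto\|X\|_N$ such that, for each $N\in\mathcal N$, the seminorm $\|\cdot\|_N$ is either $j_N$ or the pointwise maximum $a\vee b$ of some $a\in\{0,e_N^+,i_N^+\}$ and some $b\in\{0,e_N^-,i_N^-\}$. It is called a \emph{greatest} diagonal seminorm function if there are $Y\in\operatorname{Alg}\mathcal N$ and $c>0$ such that it is the largest, in the pointwise order, of all diagonal seminorm functions with $\|Y\|_N<c$ for all $N\in\mathcal N$. Let $\|\cdot\|_N$ be a greatest diagonal seminorm function, and let $X\in\operatorname{Alg}\mathcal N$ and $a\in\mathbb R$ satisfy $\|X\|_N<a$ for all $N\in\mathcal N$. Then there is a $T\in\operatorname{Alg}\mathcal N$ with $\|T\|_N=0$ for all $N\in\mathcal N$ and $\|X-T\|\le a$; if moreover $\sup_{N\in\mathcal N}\|X\|_N<a$, then this $T$ satisfies $\|X-T\|<a$. -/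

import Mathlib

open Filter Topology

/-- A continuous nest on a Hilbert space `H`: a complete chain of closed subspaces containing `0`
and `H`, each member `N` of which is the supremum `N₋` of the members strictly below it (this is
the standard definition of continuity and says that the nest has no atoms). A member of the nest
is identified with the orthogonal projection onto it, see `ContinuousNest.proj`. -/
structure ContinuousNest (H : Type*) [NormedAddCommGroup H] [InnerProductSpace ℂ H]
    [CompleteSpace H] where
  carrier : Set (ClosedSubmodule ℂ H)
  isChain : IsChain (· ≤ ·) carrier
  bot_mem : ⊥ ∈ carrier
  top_mem : ⊤ ∈ carrier
  sSup_mem : ∀ S ⊆ carrier, sSup S ∈ carrier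
  sInf_mem : ∀ S ⊆ carrier, sInf S ∈ carrier
  sSup_lt : ∀ N ∈ carrier, sSup {L | L ∈ carrier ∧ L < N} = N

/-- The essential norm: the distance to the compact operators. -/
noncomputable def essNorm {H : Type*} [NormedAddCommGroup H] [InnerProductSpace ℂ H]
    (T : H →L[ℂ] H) : ℝ :=
  Metric.infDist T {K : H →L[ℂ] H | IsCompactOperator K}

namespace ContinuousNest

variable {H : Type*} [NormedAddCommGroup H] [InnerProductSpace ℂ H] [CompleteSpace H]
  (𝒩 : ContinuousNest H)

/-- The nest algebra: all bounded operators that leave every member of the nest invariant. -/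
def alg : Subalgebra ℂ (H →L[ℂ] H) where
  carrier := {T | ∀ N ∈ 𝒩.carrier, ∀ x ∈ N, T x ∈ N}
  mul_mem' := fun {_ _} hS hT N hN x hx => hS N hN _ (hT N hN x hx)
  add_mem' := fun {_ _} hS hT N hN x hx => add_mem (hS N hN x hx) (hT N hN x hx)
  algebraMap_mem' := fun c N _ x hx => by
    simpa [Algebra.algebraMap_eq_smul_one] using N.toSubmodule.smul_mem c hx

variable {𝒩}

/-- The orthogonal projection onto a member of the nest. -/
noncomputable def proj (N : 𝒩.carrier) : H →L[ℂ] H := N.1.toSubmodule.starProjection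

/-- The compression `(M - L) X (M - L)`. -/
noncomputable def compress (L M : 𝒩.carrier) (X : H →L[ℂ] H) : H →L[ℂ] H :=
  (proj M - proj L) * X * (proj M - proj L)

/- The limits in the following five definitions are limits of monotone families of nonnegative
numbers and are written as infima; see the lemmas `tendsto_ePlus` to `tendsto_j` below. -/

open Classical in
/-- `e⁺_N(X) = lim_{M ↓ N} sup_{N < L < M} ‖(M - L) X (M - L)‖_e`, and `0` if `N = I`. -/
noncomputable def ePlus (N : 𝒩.carrier) (X : 𝒩.alg) : ℝ :=
  if N.1 = ⊤ then 0
  else ⨅ M : Set.Ioi N, ⨆ L : Set.Ioo N M.1, essNorm (compress L.1 M.1 X.1)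

open Classical in
/-- `e⁻_N(X) = lim_{M ↑ N} sup_{N > L > M} ‖(L - M) X (L - M)‖_e`, and `0` if `N = 0`. -/
noncomputable def eMinus (N : 𝒩.carrier) (X : 𝒩.alg) : ℝ :=
  if N.1 = ⊥ then 0
  else ⨅ M : Set.Iio N, ⨆ L : Set.Ioo M.1 N, essNorm (compress M.1 L.1 X.1)

open Classical in
/-- `i⁺_N(X) = lim_{M ↓ N} ‖(M - N) X (M - N)‖`, and `0` if `N = I`. -/
noncomputable def iPlus (N : 𝒩.carrier) (X : 𝒩.alg) : ℝ :=
  if N.1 = ⊤ then 0 else ⨅ M : Set.Ioi N, ‖compress N M.1 X.1‖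

open Classical in
/-- `i⁻_N(X) = lim_{M ↑ N} ‖(N - M) X (N - M)‖`, and `0` if `N = 0`. -/
noncomputable def iMinus (N : 𝒩.carrier) (X : 𝒩.alg) : ℝ :=
  if N.1 = ⊥ then 0 else ⨅ M : Set.Iio N, ‖compress M.1 N X.1‖

open Classical in
/-- `j_N(X) = lim_{M ↓ N, L ↑ N} ‖(M - L) X (M - L)‖` for `0 < N < I`, while `j_0 = i⁺_0` and
`j_I = i⁻_I`. -/
noncomputable def j (N : 𝒩.carrier) (X : 𝒩.alg) : ℝ :=
  if N.1 = ⊥ then iPlus N X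
  else if N.1 = ⊤ then iMinus N X
  else ⨅ p : Set.Ioi N × Set.Iio N, ‖compress p.2.1 p.1.1 X.1‖

/-- A diagonal seminorm function assigns to each `N` in the nest either `j_N` or a join `a ∨ b`
with `a` one of `0, e⁺_N, i⁺_N` and `b` one of `0, e⁻_N, i⁻_N` (ten possibilities: the lattice
that is generated by the elementary seminorms at `N`). -/
def IsDiagonalSeminormFunction (ν : 𝒩.carrier → 𝒩.alg → ℝ) : Prop :=
  ∀ N, ν N = j N ∨
    ∃ a ∈ ({0, ePlus N, iPlus N} : Set (𝒩.alg → ℝ)),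
    ∃ b ∈ ({0, eMinus N, iMinus N} : Set (𝒩.alg → ℝ)), ν N = a ⊔ b

/-- A greatest diagonal seminorm function: for some `Y` in the nest algebra and some `c > 0` it is
the largest, in the pointwise order, of the diagonal seminorm functions whose values at `Y` are
all less than `c`. -/
def IsGreatestDiagonalSeminormFunction (ν : 𝒩.carrier → 𝒩.alg → ℝ) : Prop :=
  ∃ Y : 𝒩.alg, ∃ c : ℝ, 0 < c ∧
    IsGreatest {μ | IsDiagonalSeminormFunction μ ∧ ∀ N, μ N Y < c} ν

/-! Helper facts: the infima above are the limits. -/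

theorem proj_mul_proj {A B : 𝒩.carrier} (h : A ≤ B) :
    proj B * proj A = proj A ∧ proj A * proj B = proj A := by
  have h1 : proj B * proj A = proj A :=
    ContinuousLinearMap.ext fun x => Submodule.starProjection_eq_self_iff.2
      (h (Submodule.starProjection_apply_mem _ x))
  have hA : IsStarProjection (proj A) := isStarProjection_starProjection
  have hB : IsStarProjection (proj B) := isStarProjection_starProjection
  refine ⟨h1, ?_⟩
  have := congrArg star h1
  rwa [star_mul, hB.isSelfAdjoint.star_eq, hA.isSelfAdjoint.star_eq] at this

theorem norm_proj_sub_le {L M : 𝒩.carrier} (h : L ≤ M) : ‖proj M - proj L‖ ≤ 1 := by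
  obtain ⟨h1, h2⟩ := proj_mul_proj h
  have hM : IsStarProjection (proj M) := isStarProjection_starProjection
  have hL : IsStarProjection (proj L) := isStarProjection_starProjection
  refine IsStarProjection.norm_le _ ⟨?_, hM.isSelfAdjoint.sub hL.isSelfAdjoint⟩
  have e1 := hM.isIdempotentElem.eq
  have e2 := hL.isIdempotentElem.eq
  simp only [IsIdempotentElem, mul_sub, sub_mul, h1, h2, e1, e2, sub_self, sub_zero]

theorem compress_eq {L' L M M' : 𝒩.carrier} (h1 : L' ≤ L) (h2 : L ≤ M) (h3 : M ≤ M')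
    (X : H →L[ℂ] H) :
    compress L M X = (proj M - proj L) * compress L' M' X * (proj M - proj L) := by
  have a1 := proj_mul_proj h3
  have a2 := proj_mul_proj (h1.trans h2)
  have a3 := proj_mul_proj h1
  have a4 := proj_mul_proj (h2.trans h3)
  have l : (proj M - proj L) * (proj M' - proj L') = proj M - proj L := by
    rw [sub_mul, mul_sub, mul_sub, a1.2, a2.1, a4.2, a3.1]; abel
  have r : (proj M' - proj L') * (proj M - proj L) = proj M - proj L := by
    rw [sub_mul, mul_sub, mul_sub, a1.1, a2.2, a4.1, a3.2]; abel
  calc compress L M X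
      = ((proj M - proj L) * (proj M' - proj L')) * X *
          ((proj M' - proj L') * (proj M - proj L)) := by rw [l, r]; rfl
    _ = _ := by simp only [compress, mul_assoc]

theorem norm_compress_le {L' L M M' : 𝒩.carrier} (h1 : L' ≤ L) (h2 : L ≤ M) (h3 : M ≤ M')
    (X : H →L[ℂ] H) : ‖compress L M X‖ ≤ ‖compress L' M' X‖ := by
  rw [compress_eq h1 h2 h3]
  refine (norm_mul_le _ _).trans ((mul_le_of_le_one_right (norm_nonneg _)
    (norm_proj_sub_le h2)).trans ((norm_mul_le _ _).trans ?_))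
  exact mul_le_of_le_one_left (norm_nonneg _) (norm_proj_sub_le h2)

theorem essNorm_compress_le {L' L M M' : 𝒩.carrier} (h1 : L' ≤ L) (h2 : L ≤ M) (h3 : M ≤ M')
    (X : H →L[ℂ] H) : essNorm (compress L M X) ≤ essNorm (compress L' M' X) := by
  rw [compress_eq h1 h2 h3]
  have hne : {K : H →L[ℂ] H | IsCompactOperator K}.Nonempty := ⟨0, isCompactOperator_zero⟩
  refine (Metric.le_infDist hne).2 fun K hK => ?_
  set E := proj M - proj L
  have hc : IsCompactOperator (E * K * E : H →L[ℂ] H) := by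
    have : IsCompactOperator (K * E : H →L[ℂ] H) := IsCompactOperator.comp_clm hK E
    rw [mul_assoc]
    exact this.clm_comp E
  refine (Metric.infDist_le_dist_of_mem (s := {K : H →L[ℂ] H | IsCompactOperator K}) hc).trans ?_
  have h : E * compress L' M' X * E - E * K * E = E * (compress L' M' X - K) * E := by
    rw [mul_sub E _ K, sub_mul (E * _) (E * K) E]
  rw [dist_eq_norm, dist_eq_norm, h]
  refine (norm_mul_le _ _).trans ((mul_le_of_le_one_right (norm_nonneg _)
    (norm_proj_sub_le h2)).trans ((norm_mul_le _ _).trans ?_))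
  exact mul_le_of_le_one_left (norm_nonneg _) (norm_proj_sub_le h2)

theorem nonempty_Ioo {M N : 𝒩.carrier} (h : M < N) : (Set.Ioo M N).Nonempty := by
  by_contra hne
  have hle : sSup {L | L ∈ 𝒩.carrier ∧ L < N.1} ≤ M.1 := by
    refine sSup_le fun L hL => ?_
    rcases 𝒩.isChain.total hL.1 M.2 with h' | h'
    · exact h'
    · by_contra hLM
      exact hne ⟨⟨L, hL.1⟩, lt_of_le_not_ge h' hLM, hL.2⟩
  rw [𝒩.sSup_lt N.1 N.2] at hle
  exact absurd h (not_lt_of_ge hle)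

theorem tendsto_iPlus {N : 𝒩.carrier} (hN : N.1 ≠ ⊤) (X : 𝒩.alg) :
    Tendsto (fun M : Set.Ioi N => ‖compress N M.1 X.1‖) atBot (𝓝 (iPlus N X)) := by
  rw [iPlus, if_neg hN]
  refine tendsto_atBot_ciInf (fun M M' h => ?_) ⟨0, ?_⟩
  · exact norm_compress_le le_rfl (le_of_lt M.2) h _
  · rintro _ ⟨M, rfl⟩
    exact norm_nonneg _

theorem tendsto_iMinus {N : 𝒩.carrier} (hN : N.1 ≠ ⊥) (X : 𝒩.alg) :
    Tendsto (fun M : Set.Iio N => ‖compress M.1 N X.1‖) atTop (𝓝 (iMinus N X)) := by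
  rw [iMinus, if_neg hN]
  refine tendsto_atTop_ciInf (fun M M' h => ?_) ⟨0, ?_⟩
  · exact norm_compress_le h (le_of_lt M'.2) le_rfl _
  · rintro _ ⟨M, rfl⟩
    exact norm_nonneg _

theorem tendsto_ePlus {N : 𝒩.carrier} (hN : N.1 ≠ ⊤) (X : 𝒩.alg) :
    Tendsto (fun M : Set.Ioi N => ⨆ L : Set.Ioo N M.1, essNorm (compress L.1 M.1 X.1)) atBot
      (𝓝 (ePlus N X)) := by
  rw [ePlus, if_neg hN]
  refine tendsto_atBot_ciInf (fun M M' h => ?_) ⟨0, ?_⟩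
  · have := (nonempty_Ioo M.2).to_subtype
    refine ciSup_le fun L => ?_
    refine (essNorm_compress_le le_rfl (le_of_lt L.2.2) h _).trans
      (le_ciSup (f := fun L : Set.Ioo N M'.1 => essNorm (compress L.1 M'.1 X.1)) ?_
        ⟨L.1, L.2.1, lt_of_lt_of_le L.2.2 h⟩)
    refine ⟨essNorm (compress N M'.1 X.1), ?_⟩
    rintro _ ⟨K, rfl⟩
    exact essNorm_compress_le (le_of_lt K.2.1) (le_of_lt K.2.2) le_rfl _
  · rintro _ ⟨M, rfl⟩
    exact Real.iSup_nonneg fun L => Metric.infDist_nonneg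

theorem tendsto_eMinus {N : 𝒩.carrier} (hN : N.1 ≠ ⊥) (X : 𝒩.alg) :
    Tendsto (fun M : Set.Iio N => ⨆ L : Set.Ioo M.1 N, essNorm (compress M.1 L.1 X.1)) atTop
      (𝓝 (eMinus N X)) := by
  rw [eMinus, if_neg hN]
  refine tendsto_atTop_ciInf (fun M M' h => ?_) ⟨0, ?_⟩
  · have := (nonempty_Ioo M'.2).to_subtype
    refine ciSup_le fun L => ?_
    refine (essNorm_compress_le h (le_of_lt L.2.1) le_rfl _).trans
      (le_ciSup (f := fun L : Set.Ioo M.1 N => essNorm (compress M.1 L.1 X.1)) ?_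
        ⟨L.1, lt_of_le_of_lt h L.2.1, L.2.2⟩)
    refine ⟨essNorm (compress M.1 N X.1), ?_⟩
    rintro _ ⟨K, rfl⟩
    exact essNorm_compress_le le_rfl (le_of_lt K.2.1) (le_of_lt K.2.2) _
  · rintro _ ⟨M, rfl⟩
    exact Real.iSup_nonneg fun L => Metric.infDist_nonneg

theorem tendsto_j {N : 𝒩.carrier} (h0 : N.1 ≠ ⊥) (h1 : N.1 ≠ ⊤) (X : 𝒩.alg) :
    Tendsto (fun p : Set.Ioi N × Set.Iio N => ‖compress p.2.1 p.1.1 X.1‖) (atBot ×ˢ atTop)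
      (𝓝 (j N X)) := by
  rw [j, if_neg h0, if_neg h1]
  have : Nonempty (Set.Ioi N) := ⟨⟨⟨⊤, 𝒩.top_mem⟩, lt_of_le_of_ne (b := ⟨⊤, 𝒩.top_mem⟩)
    (show N.1 ≤ ⊤ from le_top) fun h => h1 (congrArg Subtype.val h)⟩⟩
  have : Nonempty (Set.Iio N) := ⟨⟨⟨⊥, 𝒩.bot_mem⟩, lt_of_le_of_ne (a := ⟨⊥, 𝒩.bot_mem⟩)
    (show ⊥ ≤ N.1 from bot_le) fun h => h0 (congrArg Subtype.val h).symm⟩⟩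
  refine tendsto_order.2 ⟨fun a ha => Eventually.of_forall fun p => ha.trans_le ?_, fun a ha => ?_⟩
  · refine ciInf_le ⟨0, ?_⟩ p
    rintro _ ⟨M, rfl⟩
    exact norm_nonneg _
  · obtain ⟨q, hq⟩ := exists_lt_of_ciInf_lt ha
    filter_upwards [prod_mem_prod (Iic_mem_atBot q.1) (Ici_mem_atTop q.2)] with p hp
    refine lt_of_le_of_lt ?_ hq
    have hp2 : p.2.1 < N := p.2.2
    have hp1 : N < p.1.1 := p.1.2
    exact norm_compress_le hp.2 (hp2.trans hp1).le hp.1 _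

end ContinuousNest

/-!
The nest is parametrised by an interval, so that the diagonal seminorms become conditions on a
strongly continuous increasing family of projections `E t` near a point `t` of the line
(`nonempty_parametrization`; separability enters only here, through a positive trace class operator
`G` without kernel, the parameter of `N` being the trace of its compression to `N`). That a
seminorm function is greatest for `Y` and `c` means that at each member of the nest it dominates
every diagonal seminorm that is less than `c` at `Y` (`le_of_isGreatest`); all of these are
therefore less than `a` at `X`. The task is to find an operator `Z` of the nest algebra, of norm at
most `a`, such that all of these seminorms vanish at `X - Z`; then `T = X - Z`
(`exists_diagonal_perturbation`).

The parameters at which `j(Y) < c` form an open set `U`, over which `j(X) < a`. If one of the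
one-sided seminorms is less than `c` at `Y`, then `j(Y) < c` on a one-sided neighbourhood, because
`j` vanishes at compact operators. So such seminorms occur in `U`, where they are dominated by `j`,
or at an endpoint of a component of `U`, and it is enough to build `Z` over each component
separately: the sum over the components is orthogonal and does not increase the norm
(`exists_block_sum`, `exists_norm_le_agreeing`).

Over a component, `Z` is put together from local copies of `X`, which are operators of norm at most
`a` that agree with `X` near the diagonal.

* Where `j(X) < a`, a compression of `X` to a short interval is a local copy. Two local copies
  `Z₁`, `Z₂` on overlapping intervals are glued to `c Z₁ c + d Z₂ d`, where `c` and `d` are the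
  cosine and the sine of a ramp in the spectral parameter (`exists_partition`). Since
  `c² + d² = 1`, the norm does not increase; since `c` and `d` act near each point of the diagonal
  as scalars, the result agrees with `X` there (`IsLocalCopy.glue`). This covers all compact
  subintervals, and a limit of coherent sequences reaches the endpoints
  (`exists_isLocalCopy_left_free`).
* At a left endpoint with `i⁺(X) < a`, a compression of `X` is again a local copy.
* At a left endpoint with `e⁺(X) < a`, the compressions of `X` to `(u n, t)`, with `u n` decreasing
  to the endpoint, are perturbed by compact operators to have norm less than `a`. The operators are
  built row by row: a new row `C` is multiplied from the left by an upper triangular contraction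
  `v` that is a compact perturbation of the identity and close to `0` in the strong topology. Then
  `v C` differs from `C` by a compact operator, and the norm of the enlarged operator is less than
  `a` if `v` is close enough to `0`, because the essential norm of the compression of `X` and the
  norm of the old rows are both less than `a` (`exists_norm_add_mul_lt`). For `v` one takes a
  resolvent `(1 + n V)⁻¹` of the Volterra operator `V`, the triangular truncation of `G`, which is
  accretive because `V + V⋆` is a compression of `G`
  (`exists_volterra`, `exists_contractions_tendsto_zero`).
* Right endpoints are left endpoints for the adjoint and the complementary projections
  (`SpectralFamily.dual`).

If the seminorms of `X` are bounded by some `b < a`, the construction applies to a number between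
`b` and `a` in place of `a`.
-/

open scoped InnerProductSpace

/-! ### Compact operators and the essential norm -/

section Operators

variable {H : Type*} [NormedAddCommGroup H] [InnerProductSpace ℂ H]

theorem IsCompactOperator.mul_left {K : H →L[ℂ] H} (hK : IsCompactOperator K) (A : H →L[ℂ] H) :
    IsCompactOperator (A * K : H →L[ℂ] H) :=
  hK.clm_comp A

theorem IsCompactOperator.mul_right {K : H →L[ℂ] H} (hK : IsCompactOperator K) (A : H →L[ℂ] H) :
    IsCompactOperator (K * A : H →L[ℂ] H) :=
  hK.comp_clm A

theorem isCompactOperator_iff_totallyBounded [CompleteSpace H] (K : H →L[ℂ] H) :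
    IsCompactOperator K ↔ TotallyBounded (K '' Metric.closedBall 0 1) := by
  change IsCompactOperator (K : H →ₗ[ℂ] H) ↔ _
  rw [isCompactOperator_iff_isCompact_closure_image_closedBall (K : H →ₗ[ℂ] H) zero_lt_one]
  constructor
  · intro h
    exact h.totallyBounded.subset subset_closure
  · intro h
    exact h.closure.isCompact_of_isClosed isClosed_closure

/-- Contractions that tend to `0` strongly tend to `0` in norm on the range of a compact
operator. -/
theorem IsCompactOperator.tendsto_norm_mul {ι : Type*} {l : Filter ι} [CompleteSpace H]
    {K : H →L[ℂ] H} (hK : IsCompactOperator K) {P : ι → H →L[ℂ] H} (hP : ∀ i, ‖P i‖ ≤ 1)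
    (h0 : ∀ x, Tendsto (fun i => P i x) l (𝓝 0)) :
    Tendsto (fun i => ‖P i * K‖) l (𝓝 0) := by
  rw [Metric.tendsto_nhds]
  intro ε hε
  obtain ⟨S, hS, hcov⟩ := Metric.totallyBounded_iff.1
    ((isCompactOperator_iff_totallyBounded K).1 hK) (ε / 3) (by positivity)
  have hev : ∀ᶠ i in l, ∀ y ∈ S, ‖P i y‖ < ε / 3 := by
    rw [eventually_all_finite hS]
    intro y _
    have := (h0 y).norm
    rw [norm_zero] at this
    exact this.eventually_lt_const (by positivity)
  filter_upwards [hev] with i hi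
  rw [dist_zero_right, norm_norm]
  refine lt_of_le_of_lt (b := 2 * (ε / 3)) ?_ (by linarith)
  refine ContinuousLinearMap.opNorm_le_of_unit_norm (𝕜 := ℂ) (by positivity) fun x hx => ?_
  obtain ⟨y, hy, hxy⟩ := Set.mem_iUnion₂.1 (hcov ⟨x, by simp [hx], rfl⟩)
  have h1 : ‖P i (K x - y)‖ ≤ ε / 3 := by
    refine ((P i).le_of_opNorm_le (hP i) _).trans ?_
    rw [one_mul, ← dist_eq_norm]
    exact (Metric.mem_ball.1 hxy).le
  calc ‖(P i * K) x‖ = ‖P i (K x - y) + P i y‖ := by rw [← map_add]; simp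
    _ ≤ ε / 3 + ε / 3 := (norm_add_le _ _).trans (add_le_add h1 (hi y hy).le)
    _ = 2 * (ε / 3) := by ring

theorem norm_sq_eq_re_inner_star_mul [CompleteSpace H] (A : H →L[ℂ] H) (x : H) :
    ‖A x‖ ^ 2 = RCLike.re ⟪(star A * A) x, x⟫_ℂ := by
  rw [mul_apply_eq_comp, ContinuousLinearMap.star_eq_adjoint,
    ContinuousLinearMap.adjoint_inner_left, inner_self_eq_norm_sq]

/-- The adjoint of a compact operator is compact: an `ε`-net for `K K⋆` yields one for `K⋆`,
because `‖K⋆ x‖² = ⟪K K⋆ x, x⟫`. -/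
theorem IsCompactOperator.star [CompleteSpace H] {K : H →L[ℂ] H} (hK : IsCompactOperator K) :
    IsCompactOperator (star K : H →L[ℂ] H) := by
  have h2 := (isCompactOperator_iff_totallyBounded _).1 (hK.mul_right (Star.star K))
  rw [isCompactOperator_iff_totallyBounded, Metric.totallyBounded_iff]
  intro ε hε
  obtain ⟨t, hts, htf, hcov⟩ := h2.exists_subset
    (Metric.dist_mem_uniformity (show 0 < ε ^ 2 / 3 by positivity))
  have hts' : ∀ y ∈ t, ∃ w ∈ Metric.closedBall (0 : H) 1, (K * Star.star K) w = y := hts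
  choose! g hg hgt using hts'
  refine ⟨(fun y => Star.star K (g y)) '' t, htf.image _, ?_⟩
  rintro _ ⟨x, hx, rfl⟩
  obtain ⟨y, hy, hxy⟩ := Set.mem_iUnion₂.1 (hcov ⟨x, hx, rfl⟩)
  refine Set.mem_iUnion₂.2 ⟨_, ⟨y, hy, rfl⟩, ?_⟩
  have h3 : ‖(K * Star.star K) (x - g y)‖ < ε ^ 2 / 3 := by
    have : dist ((K * Star.star K) x) y < ε ^ 2 / 3 := hxy
    rwa [map_sub, hgt y hy, ← dist_eq_norm]
  have h4 : ‖x - g y‖ ≤ 2 := by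
    have h5 := hg y hy
    rw [mem_closedBall_zero_iff] at hx h5
    exact (norm_sub_le _ _).trans (by linarith)
  rw [Metric.mem_ball, dist_eq_norm, ← map_sub]
  refine lt_of_pow_lt_pow_left₀ 2 hε.le ?_
  rw [norm_sq_eq_re_inner_star_mul, star_star]
  refine (Complex.re_le_norm _).trans_lt ((norm_inner_le_norm _ _).trans_lt ?_)
  nlinarith [norm_nonneg (x - g y), norm_nonneg ((K * Star.star K) (x - g y))]

/-- The sum of a family of operators with mutually orthogonal ranges. -/
theorem exists_hasSum_of_orthogonal_ranges {ι : Type*} [CompleteSpace H] {Z : ι → H →L[ℂ] H} {a : ℝ}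
    (ha : 0 ≤ a) (horth : ∀ i j, i ≠ j → ∀ x y, ⟪Z i x, Z j y⟫_ℂ = 0)
    (hb : ∀ (s : Finset ι) x, ∑ i ∈ s, ‖Z i x‖ ^ 2 ≤ a ^ 2 * ‖x‖ ^ 2) :
    ∃ T : H →L[ℂ] H, ‖T‖ ≤ a ∧ ∀ x, HasSum (fun i => Z i x) (T x) := by
  have hV : OrthogonalFamily ℂ (fun i => (LinearMap.range (Z i : H →ₗ[ℂ] H)))
      fun i => (LinearMap.range (Z i : H →ₗ[ℂ] H)).subtypeₗᵢ := by
    rintro i j hij ⟨_, x, rfl⟩ ⟨_, y, rfl⟩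
    exact horth i j hij x y
  have hs : ∀ x, Summable fun i => Z i x := fun x =>
    (hV.summable_iff_norm_sq_summable fun i => ⟨Z i x, x, rfl⟩).2
      (summable_of_sum_le (fun i => sq_nonneg _) fun s => hb s x)
  have hn : ∀ (s : Finset ι) x, ‖∑ i ∈ s, Z i x‖ ≤ a * ‖x‖ := by
    intro s x
    have h : ‖∑ i ∈ s, Z i x‖ ^ 2 = ∑ i ∈ s, ‖Z i x‖ ^ 2 :=
      hV.norm_sum (fun i => ⟨Z i x, x, rfl⟩) s
    refine (sq_le_sq₀ (norm_nonneg _) (by positivity)).1 ?_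
    rw [mul_pow]
    exact h.trans_le (hb s x)
  let T₀ : H →ₗ[ℂ] H :=
    { toFun := fun x => ∑' i, Z i x
      map_add' := fun x y => by
        simp only [map_add]
        exact (hs x).tsum_add (hs y)
      map_smul' := fun c x => by
        simp only [map_smul, RingHom.id_apply]
        exact (hs x).tsum_const_smul c }
  refine ⟨T₀.mkContinuous a fun x => ?_, T₀.mkContinuous_norm_le ha _, fun x => (hs x).hasSum⟩
  exact le_of_tendsto (hs x).hasSum.norm (Eventually.of_forall fun s => hn s x)

theorem essNorm_nonneg (T : H →L[ℂ] H) : 0 ≤ essNorm T := Metric.infDist_nonneg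

theorem essNorm_lt_iff {T : H →L[ℂ] H} {a : ℝ} :
    essNorm T < a ↔ ∃ K : H →L[ℂ] H, IsCompactOperator K ∧ ‖T - K‖ < a := by
  rw [essNorm, Metric.infDist_lt_iff ⟨0, isCompactOperator_zero⟩]
  simp only [dist_eq_norm, Set.mem_ofPred_eq]

theorem essNorm_le_norm (T : H →L[ℂ] H) : essNorm T ≤ ‖T‖ := by
  refine le_of_forall_gt fun a ha => essNorm_lt_iff.2 ⟨0, isCompactOperator_zero, by simpa using ha⟩

theorem essNorm_eq_zero {T : H →L[ℂ] H} (hT : IsCompactOperator T) : essNorm T = 0 :=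
  Metric.infDist_zero_of_mem hT

theorem essNorm_star [CompleteSpace H] (T : H →L[ℂ] H) : essNorm (star T) = essNorm T := by
  have h : ∀ S : H →L[ℂ] H, essNorm (star S) ≤ essNorm S := fun S => by
    refine le_of_forall_gt fun a ha => ?_
    obtain ⟨K, hK, h⟩ := essNorm_lt_iff.1 ha
    exact essNorm_lt_iff.2 ⟨star K, hK.star, by rwa [← star_sub, norm_star]⟩
  exact le_antisymm (h T) (by simpa using h (star T))

theorem essNorm_mul_mul_le {A B : H →L[ℂ] H} (hA : ‖A‖ ≤ 1) (hB : ‖B‖ ≤ 1) (T : H →L[ℂ] H) :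
    essNorm (A * T * B) ≤ essNorm T := by
  refine le_of_forall_gt fun a ha => ?_
  obtain ⟨K, hK, h⟩ := essNorm_lt_iff.1 ha
  refine essNorm_lt_iff.2 ⟨A * K * B, (hK.mul_left A).mul_right B, lt_of_le_of_lt ?_ h⟩
  rw [← sub_mul, ← mul_sub]
  refine (norm_mul_le _ _).trans ((mul_le_of_le_one_right (norm_nonneg _) hB).trans ?_)
  exact (norm_mul_le _ _).trans (mul_le_of_le_one_left (norm_nonneg _) hA)

/-- Bounded sequences converge weakly along an ultrafilter. -/
theorem exists_weak_limit [CompleteSpace H] {ι : Type*} (u : Ultrafilter ι) {x : ι → H}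
    (hx : ∀ i, ‖x i‖ ≤ 1) :
    ∃ z : H, ∀ y, Tendsto (fun i => ⟪x i, y⟫_ℂ) u (𝓝 ⟪z, y⟫_ℂ) := by
  let f : ι → WeakDual ℂ H := fun i => StrongDual.toWeakDual (InnerProductSpace.toDual ℂ H (x i))
  obtain ⟨φ, -, hφ⟩ := (WeakDual.isCompact_closedBall (0 : StrongDual ℂ H) 1).ultrafilter_le_nhds'
    (u.map f) (by
      refine Filter.mem_map.2 (Eventually.of_forall fun i => ?_)
      simp [f, hx i])
  refine ⟨(InnerProductSpace.toDual ℂ H).symm (WeakDual.toStrongDual φ), fun y => ?_⟩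
  rw [InnerProductSpace.toDual_symm_apply]
  exact ((WeakDual.eval_continuous y).tendsto φ).comp hφ

/-- Compact operators turn bounded weakly convergent families into norm convergent ones. -/
theorem IsCompactOperator.tendsto_of_weak [CompleteSpace H] {ι : Type*} (u : Ultrafilter ι)
    {K : H →L[ℂ] H} (hK : IsCompactOperator K) {y : ι → H} {r : ℝ} (hy : ∀ i, ‖y i‖ ≤ r)
    (h0 : ∀ w, Tendsto (fun i => ⟪y i, w⟫_ℂ) u (𝓝 0)) :
    Tendsto (fun i => K (y i)) u (𝓝 0) := by
  have hc := IsCompactOperator.isCompact_closure_image_closedBall (f := (K : H →ₗ[ℂ] H)) hK r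
  obtain ⟨z, -, hz⟩ := hc.ultrafilter_le_nhds' (u.map fun i => K (y i))
    (Filter.mem_map.2 (Eventually.of_forall fun i => subset_closure ⟨y i, by simp [hy i], rfl⟩))
  have hz' : Tendsto (fun i => K (y i)) u (𝓝 z) := hz
  have : ∀ w, ⟪z, w⟫_ℂ = 0 := fun w => by
    refine tendsto_nhds_unique (hz'.inner tendsto_const_nhds) ?_
    refine (h0 (ContinuousLinearMap.adjoint K w)).congr fun i => ?_
    rw [ContinuousLinearMap.adjoint_inner_right]
  rw [inner_self_eq_zero.1 (this z)] at hz'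
  exact hz'

/-- A column `B + C` of norm less than `a` modulo the compact operators, whose first entry `B` has
norm less than `a`, gets norm less than `a` when its second entry `C` is multiplied by a
contraction that is close to `0` in the strong topology. -/
theorem exists_norm_add_mul_lt [CompleteSpace H] {B C K : H →L[ℂ] H} {v : ℕ → H →L[ℂ] H} {a : ℝ}
    (hB : ‖B‖ < a) (hK : IsCompactOperator K) (hA : ‖B + C - K‖ < a)
    (hBC : ∀ x y, ⟪B x, C y⟫_ℂ = 0) (hBv : ∀ n x y, ⟪B x, v n y⟫_ℂ = 0)
    (hv : ∀ n, ‖v n‖ ≤ 1) (hv0 : ∀ x, Tendsto (fun n => v n x) atTop (𝓝 0)) :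
    ∃ n, ‖B + v n * C‖ < a := by
  -- Otherwise there are unit vectors `x n` at which `B + v n * C` exceeds a number `b < a`. Split
  -- them into their weak limit `z` and a weakly null part `y n`. Up to terms that tend to `0`, the
  -- contribution of `z` is only that of `B`, since `v n (C z)` tends to `0`, and the contribution
  -- of `y n` is at most that of `A`, since `K (y n)` tends to `0`.
  set A := B + C - K with hAdef
  obtain ⟨b, hb, hba⟩ := exists_between (max_lt hB hA)
  obtain ⟨hBb, hAb⟩ := max_lt_iff.1 hb
  have hb0 : 0 ≤ b := (norm_nonneg _).trans hBb.le
  set β := max ‖B‖ ‖A‖ with hβ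
  have hβ0 : 0 ≤ β := (norm_nonneg _).trans (le_max_left _ _)
  by_contra! hcon
  have hx : ∀ n, ∃ x, ‖x‖ ≤ 1 ∧ b < ‖(B + v n * C) x‖ := fun n => by
    obtain ⟨x, hx, hxb⟩ := (B + v n * C).exists_lt_apply_of_lt_opNorm (hba.trans_le (hcon n))
    exact ⟨x, hx.le, hxb⟩
  choose x hx1 hxb using hx
  let u : Ultrafilter ℕ := Filter.hyperfilter ℕ
  have hu : (u : Filter ℕ) ≤ atTop := Nat.hyperfilter_le_atTop
  obtain ⟨z, hz⟩ := exists_weak_limit u hx1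
  set y : ℕ → H := fun n => x n - z with hy
  have hxy : ∀ n, x n = z + y n := fun n => by simp [hy]
  have hy0 : ∀ w, Tendsto (fun n => ⟪y n, w⟫_ℂ) u (𝓝 0) := fun w => by
    have := (hz w).sub_const ⟪z, w⟫_ℂ
    simpa only [hy, inner_sub_left, sub_self] using this
  have hyb : ∀ n, ‖y n‖ ≤ 1 + ‖z‖ := fun n =>
    (norm_sub_le _ _).trans (add_le_add_left (hx1 n) _)
  have hKy := (hK.tendsto_of_weak u hyb hy0).norm
  rw [norm_zero] at hKy
  have hvC := ((hv0 (C z)).mono_left hu).norm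
  rw [norm_zero] at hvC
  have hBB : Tendsto (fun n => RCLike.re ⟪B (y n), B z⟫_ℂ) u (𝓝 0) := by
    have := hy0 (ContinuousLinearMap.adjoint B (B z))
    simp only [ContinuousLinearMap.adjoint_inner_right] at this
    simpa [Function.comp_def] using (RCLike.continuous_re.tendsto (0 : ℂ)).comp this
  have hyz : Tendsto (fun n => RCLike.re ⟪y n, z⟫_ℂ) u (𝓝 0) := by
    simpa [Function.comp_def] using (RCLike.continuous_re.tendsto (0 : ℂ)).comp (hy0 z)
  have key : ∀ n, b ^ 2 ≤ β ^ 2 + (2 * RCLike.re ⟪B (y n), B z⟫_ℂ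
      - β ^ 2 * (2 * RCLike.re ⟪y n, z⟫_ℂ)
      + ‖v n (C z)‖ * (‖v n (C z)‖ + 2 * (‖C‖ * (1 + ‖z‖)))
      + ‖K (y n)‖ * (‖K (y n)‖ + 2 * (‖A‖ * (1 + ‖z‖)))) := by
    intro n
    have e1 : ‖(B + v n * C) (x n)‖ ^ 2 = ‖B (x n)‖ ^ 2 + ‖v n (C (x n))‖ ^ 2 := by
      rw [sq, sq, sq]
      exact norm_add_sq_eq_norm_sq_add_norm_sq_of_inner_eq_zero _ _ (hBv _ _ _)
    have e2 : ‖B (x n)‖ ^ 2 = ‖B z‖ ^ 2 + 2 * RCLike.re ⟪B (y n), B z⟫_ℂ + ‖B (y n)‖ ^ 2 := by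
      rw [hxy n, add_comm z, map_add, @norm_add_sq ℂ]
      ring
    have e3 : ‖x n‖ ^ 2 = ‖z‖ ^ 2 + 2 * RCLike.re ⟪y n, z⟫_ℂ + ‖y n‖ ^ 2 := by
      rw [hxy n, add_comm z, @norm_add_sq ℂ]
      ring
    have e4 : ‖(B + C) (y n)‖ ^ 2 = ‖B (y n)‖ ^ 2 + ‖C (y n)‖ ^ 2 := by
      rw [sq, sq, sq]
      exact norm_add_sq_eq_norm_sq_add_norm_sq_of_inner_eq_zero _ _ (hBC _ _)
    have i1 : ‖v n (C (x n))‖ ≤ ‖v n (C z)‖ + ‖C (y n)‖ := by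
      rw [hxy n, map_add, map_add]
      refine (norm_add_le _ _).trans (add_le_add_right ?_ _)
      simpa using (v n).le_of_opNorm_le (hv n) (C (y n))
    have i2 : ‖(B + C) (y n)‖ ≤ ‖A‖ * ‖y n‖ + ‖K (y n)‖ := by
      have : (B + C) (y n) = A (y n) + K (y n) := by simp [hAdef]
      rw [this]
      exact (norm_add_le _ _).trans (add_le_add_left (A.le_opNorm _) _)
    have i3 : ‖C (y n)‖ ≤ ‖C‖ * (1 + ‖z‖) :=
      (C.le_opNorm _).trans (mul_le_mul_of_nonneg_left (hyb n) (norm_nonneg _))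
    have i4 : ‖A‖ * ‖y n‖ ≤ ‖A‖ * (1 + ‖z‖) := mul_le_mul_of_nonneg_left (hyb n) (norm_nonneg _)
    have i5 : ‖B z‖ ≤ β * ‖z‖ := B.le_of_opNorm_le (le_max_left _ _) z
    have i6 : ‖A‖ * ‖y n‖ ≤ β * ‖y n‖ :=
      mul_le_mul_of_nonneg_right (le_max_right _ _) (norm_nonneg _)
    have j1 : b ^ 2 ≤ ‖(B + v n * C) (x n)‖ ^ 2 := pow_le_pow_left₀ hb0 (hxb n).le 2
    have j2 : ‖v n (C (x n))‖ ^ 2 ≤ (‖v n (C z)‖ + ‖C (y n)‖) ^ 2 :=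
      pow_le_pow_left₀ (norm_nonneg _) i1 2
    have j3 : ‖(B + C) (y n)‖ ^ 2 ≤ (‖A‖ * ‖y n‖ + ‖K (y n)‖) ^ 2 :=
      pow_le_pow_left₀ (norm_nonneg _) i2 2
    have j4 : ‖B z‖ ^ 2 ≤ (β * ‖z‖) ^ 2 := pow_le_pow_left₀ (norm_nonneg _) i5 2
    have j5 : (‖A‖ * ‖y n‖) ^ 2 ≤ (β * ‖y n‖) ^ 2 := pow_le_pow_left₀ (by positivity) i6 2
    have j6 : ‖x n‖ ^ 2 ≤ 1 := pow_le_one₀ (norm_nonneg _) (hx1 n)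
    have j7 := mul_le_mul_of_nonneg_left i3 (norm_nonneg (v n (C z)))
    have j8 := mul_le_mul_of_nonneg_left i4 (norm_nonneg (K (y n)))
    have j9 := mul_le_mul_of_nonneg_left j6 (sq_nonneg β)
    rw [e3] at j9
    nlinarith
  have hlim := ((((hBB.const_mul 2).sub ((hyz.const_mul 2).const_mul (β ^ 2))).add
    (hvC.mul (hvC.add_const (2 * (‖C‖ * (1 + ‖z‖)))))).add
    (hKy.mul (hKy.add_const (2 * (‖A‖ * (1 + ‖z‖)))))).const_add (β ^ 2)
  have := ge_of_tendsto' hlim key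
  have h2 : β ^ 2 < b ^ 2 := pow_lt_pow_left₀ hb hβ0 two_ne_zero
  simp only [mul_zero, sub_zero, zero_mul, add_zero, zero_add] at this
  linarith

end Operators

/-! ### Spectral families -/

/-- A strongly continuous increasing family of orthogonal projections indexed by the real line (the
values `0` and `1` at `∓∞` are not required), together with a compact positive injective operator
`G` that is Lipschitz along the family. Every continuous nest on a separable space has such a
parametrisation, the parameter of `N` being the trace of the compression of `G` to `N`. -/
structure SpectralFamily (H : Type*) [NormedAddCommGroup H] [InnerProductSpace ℂ H]
    [CompleteSpace H] where
  E : ℝ → H →L[ℂ] H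
  isStarProjection : ∀ t, IsStarProjection (E t)
  mul_of_le : ∀ {s t}, s ≤ t → E s * E t = E s
  continuous_apply : ∀ x, Continuous fun t => E t x
  G : H →L[ℂ] H
  isCompactOperator_G : IsCompactOperator G
  isSelfAdjoint_G : IsSelfAdjoint G
  pos_G : ∀ x, x ≠ 0 → 0 < RCLike.re ⟪G x, x⟫_ℂ
  norm_G_le : ∀ {s t}, s ≤ t → ‖(E t - E s) * G * (E t - E s)‖ ≤ t - s

namespace SpectralFamily

variable {H : Type*} [NormedAddCommGroup H] [InnerProductSpace ℂ H] [CompleteSpace H]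
  (F : SpectralFamily H)

/-- The family of complementary projections, with reversed parameter. Taking adjoints carries the
operators that are upper triangular for `F` to those that are upper triangular for `F.dual`. -/
def dual : SpectralFamily H where
  E t := 1 - F.E (-t)
  isStarProjection t := (F.isStarProjection _).one_sub
  mul_of_le {s t} h := by
    have := F.mul_of_le (neg_le_neg h)
    have h2 := congrArg star this
    rw [star_mul, (F.isStarProjection _).isSelfAdjoint.star_eq,
      (F.isStarProjection _).isSelfAdjoint.star_eq] at h2
    rw [mul_sub, sub_mul, sub_mul, h2]
    simp
  continuous_apply x := by
    have := (F.continuous_apply x).comp continuous_neg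
    exact continuous_const.sub this
  G := F.G
  isCompactOperator_G := F.isCompactOperator_G
  isSelfAdjoint_G := F.isSelfAdjoint_G
  pos_G := F.pos_G
  norm_G_le {s t} h := by
    have := F.norm_G_le (neg_le_neg h)
    rw [sub_sub_sub_cancel_left]
    linarith

theorem star_E (t : ℝ) : star (F.E t) = F.E t := (F.isStarProjection t).isSelfAdjoint.star_eq

theorem mul_of_ge {s t : ℝ} (h : s ≤ t) : F.E t * F.E s = F.E s := by
  have := congrArg star (F.mul_of_le h)
  rwa [star_mul, F.star_E, F.star_E] at this

theorem E_mul_self (t : ℝ) : F.E t * F.E t = F.E t := F.mul_of_le le_rfl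

/-- The difference of two projections of the family. -/
def gap (s t : ℝ) : H →L[ℂ] H := F.E t - F.E s

theorem gap_add_gap (s t u : ℝ) : F.gap s t + F.gap t u = F.gap s u := by
  simp only [gap]; abel

@[simp] theorem gap_self (s : ℝ) : F.gap s s = 0 := sub_self _

theorem star_gap (s t : ℝ) : star (F.gap s t) = F.gap s t := by
  rw [gap, star_sub, F.star_E, F.star_E]

theorem dual_gap (s t : ℝ) : F.dual.gap s t = F.gap (-t) (-s) := by
  simp [gap, dual]

theorem gap_mul_gap {s s' t' t : ℝ} (h1 : s ≤ s') (h2 : s' ≤ t') (h3 : t' ≤ t) :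
    F.gap s' t' * F.gap s t = F.gap s' t' := by
  simp only [gap, mul_sub, sub_mul, F.mul_of_le h3, F.mul_of_le (h2.trans h3),
    F.mul_of_ge (h1.trans h2), F.mul_of_ge h1]
  abel

theorem gap_mul_gap' {s s' t' t : ℝ} (h1 : s ≤ s') (h2 : s' ≤ t') (h3 : t' ≤ t) :
    F.gap s t * F.gap s' t' = F.gap s' t' := by
  have := congrArg star (F.gap_mul_gap h1 h2 h3)
  rwa [star_mul, star_gap, star_gap] at this

theorem gap_mul_gap_eq_zero {s t s' t' : ℝ} (h1 : s ≤ t) (h2 : t ≤ s') (h3 : s' ≤ t') :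
    F.gap s t * F.gap s' t' = 0 := by
  simp only [gap, mul_sub, sub_mul, F.mul_of_le h2, F.mul_of_le (h2.trans h3),
    F.mul_of_le (h1.trans h2), F.mul_of_le (h1.trans (h2.trans h3))]
  abel

theorem gap_mul_gap_eq_zero' {s t s' t' : ℝ} (h1 : s ≤ t) (h2 : t ≤ s') (h3 : s' ≤ t') :
    F.gap s' t' * F.gap s t = 0 := by
  have := congrArg star (F.gap_mul_gap_eq_zero h1 h2 h3)
  rwa [star_mul, star_gap, star_gap, star_zero] at this

theorem gap_mul_self {s t : ℝ} (h : s ≤ t) : F.gap s t * F.gap s t = F.gap s t :=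
  F.gap_mul_gap le_rfl h le_rfl

theorem gap_isStarProjection {s t : ℝ} (h : s ≤ t) : IsStarProjection (F.gap s t) :=
  ⟨F.gap_mul_self h, F.star_gap s t⟩

theorem norm_gap_le {s t : ℝ} (h : s ≤ t) : ‖F.gap s t‖ ≤ 1 :=
  IsStarProjection.norm_le _ (F.gap_isStarProjection h)

theorem norm_gap_apply_le {s t : ℝ} (h : s ≤ t) (x : H) : ‖F.gap s t x‖ ≤ ‖x‖ := by
  simpa using (F.gap s t).le_of_opNorm_le (F.norm_gap_le h) x

theorem inner_gap_left (s t : ℝ) (x y : H) : ⟪F.gap s t x, y⟫_ℂ = ⟪x, F.gap s t y⟫_ℂ := by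
  rw [← ContinuousLinearMap.adjoint_inner_right, ← ContinuousLinearMap.star_eq_adjoint, F.star_gap]

theorem tendsto_gap {ι : Type*} {l : Filter ι} {u v : ι → ℝ} {r : ℝ} (hu : Tendsto u l (𝓝 r))
    (hv : Tendsto v l (𝓝 r)) (x : H) : Tendsto (fun i => F.gap (u i) (v i) x) l (𝓝 0) := by
  have := (((F.continuous_apply x).tendsto r).comp hv).sub
    (((F.continuous_apply x).tendsto r).comp hu)
  simpa [gap, Function.comp_def] using this

theorem commute_E_gap (r s t : ℝ) : Commute (F.E r) (F.gap s t) := by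
  have h : ∀ a b, Commute (F.E a) (F.E b) := fun a b => by
    rcases le_total a b with h | h
    · exact (F.mul_of_le h).trans (F.mul_of_ge h).symm
    · exact (F.mul_of_ge h).trans (F.mul_of_le h).symm
  exact (h r t).sub_right (h r s)

/-- The operators that leave the ranges of all the projections invariant. -/
def alg : Subalgebra ℂ (H →L[ℂ] H) where
  carrier := {X | ∀ t, F.E t * X * F.E t = X * F.E t}
  mul_mem' {X Y} hX hY t := by
    calc F.E t * (X * Y) * F.E t = F.E t * X * (Y * F.E t) := by simp only [mul_assoc]
      _ = (F.E t * X * F.E t) * Y * F.E t := by rw [← hY t]; simp only [mul_assoc]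
      _ = X * (F.E t * Y * F.E t) := by rw [hX t]; simp only [mul_assoc]
      _ = X * Y * F.E t := by rw [hY t, mul_assoc]
  add_mem' {X Y} hX hY t := by rw [mul_add, add_mul, add_mul, hX t, hY t]
  algebraMap_mem' c t := by
    rw [← Algebra.commutes, mul_assoc, F.E_mul_self]

variable {F}

theorem mem_alg_of_commute {X : H →L[ℂ] H} (h : ∀ t, Commute X (F.E t)) : X ∈ F.alg := fun t => by
  rw [← (h t).eq, mul_assoc, F.E_mul_self]

theorem E_mem_alg (r : ℝ) : F.E r ∈ F.alg := mem_alg_of_commute fun t => by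
  simpa [gap] using ((F.commute_E_gap t t r).symm.add_left (Commute.refl (F.E t)))

theorem gap_mem_alg (s t : ℝ) : F.gap s t ∈ F.alg := F.alg.sub_mem (E_mem_alg t) (E_mem_alg s)

theorem star_mem_dual_alg {X : H →L[ℂ] H} (h : X ∈ F.alg) : star X ∈ F.dual.alg := fun t => by
  have := congrArg star (h (-t))
  rw [star_mul, star_mul, star_mul, F.star_E] at this
  simp only [dual, mul_sub, sub_mul, one_mul, mul_one]
  rw [mul_assoc, this]
  abel

theorem mem_alg_of_star {X : H →L[ℂ] H} (h : star X ∈ F.dual.alg) : X ∈ F.alg := fun t => by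
  have := congrArg star (h (-t))
  simp only [dual, mul_sub, sub_mul, one_mul, mul_one, neg_neg] at this
  simp only [star_sub, star_mul, star_star, F.star_E] at this
  rw [sub_sub, sub_right_inj] at this
  rw [mul_assoc]
  have h2 : X * F.E t - F.E t * (X * F.E t) = 0 := by
    rw [← sub_eq_zero] at this
    rw [← this]
    abel
  exact (sub_eq_zero.1 h2).symm

/-- An upper triangular operator maps no vector below `s` to a vector above `s`. -/
theorem gap_mul_mul_gap_eq_zero {X : H →L[ℂ] H} (hX : X ∈ F.alg) {s t s' t' : ℝ} (h1 : s ≤ t)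
    (h2 : t ≤ s') (h3 : s' ≤ t') : F.gap s' t' * X * F.gap s t = 0 := by
  have h : X * F.gap s t = F.E t * (X * F.gap s t) := by
    have e : F.gap s t = F.E t * F.gap s t := by
      rw [gap, mul_sub, F.E_mul_self, F.mul_of_ge h1]
    conv_lhs => rw [e, ← mul_assoc, ← hX t, mul_assoc, ← e, mul_assoc]
  have h' : F.gap s' t' * F.E t = 0 := by
    rw [gap, sub_mul, F.mul_of_ge (h2.trans h3), F.mul_of_ge h2, sub_self]
  rw [mul_assoc, h, ← mul_assoc, h', zero_mul]

variable (F)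

/-- The compression of an operator to the range of `F.gap s t`. -/
def cut (s t : ℝ) (X : H →L[ℂ] H) : H →L[ℂ] H := F.gap s t * X * F.gap s t

theorem cut_add (s t : ℝ) (X Y : H →L[ℂ] H) : F.cut s t (X + Y) = F.cut s t X + F.cut s t Y := by
  simp only [cut, mul_add, add_mul]

theorem cut_sub (s t : ℝ) (X Y : H →L[ℂ] H) : F.cut s t (X - Y) = F.cut s t X - F.cut s t Y := by
  simp only [cut, mul_sub, sub_mul]

theorem cut_smul (s t : ℝ) (c : ℂ) (X : H →L[ℂ] H) : F.cut s t (c • X) = c • F.cut s t X := by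
  simp only [cut, mul_smul_comm, smul_mul_assoc]

@[simp] theorem cut_zero (s t : ℝ) : F.cut s t 0 = 0 := by simp [cut]

theorem cut_cut {s s' t' t : ℝ} (h1 : s ≤ s') (h2 : s' ≤ t') (h3 : t' ≤ t) (X : H →L[ℂ] H) :
    F.cut s' t' (F.cut s t X) = F.cut s' t' X := by
  calc _ = (F.gap s' t' * F.gap s t) * X * (F.gap s t * F.gap s' t') := by
        simp only [cut, mul_assoc]
    _ = _ := by rw [F.gap_mul_gap h1 h2 h3, F.gap_mul_gap' h1 h2 h3, cut]

theorem cut_cut' {s s' t' t : ℝ} (h1 : s ≤ s') (h2 : s' ≤ t') (h3 : t' ≤ t) (X : H →L[ℂ] H) :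
    F.cut s t (F.cut s' t' X) = F.cut s' t' X := by
  calc _ = (F.gap s t * F.gap s' t') * X * (F.gap s' t' * F.gap s t) := by
        simp only [cut, mul_assoc]
    _ = _ := by rw [F.gap_mul_gap h1 h2 h3, F.gap_mul_gap' h1 h2 h3, cut]

theorem norm_cut_le {s t : ℝ} (h : s ≤ t) (X : H →L[ℂ] H) : ‖F.cut s t X‖ ≤ ‖X‖ :=
  (norm_mul_le _ _).trans ((mul_le_of_le_one_right (norm_nonneg _) (F.norm_gap_le h)).trans
    ((norm_mul_le _ _).trans (mul_le_of_le_one_left (norm_nonneg _) (F.norm_gap_le h))))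

theorem norm_cut_le_cut {s s' t' t : ℝ} (h1 : s ≤ s') (h2 : s' ≤ t') (h3 : t' ≤ t)
    (X : H →L[ℂ] H) : ‖F.cut s' t' X‖ ≤ ‖F.cut s t X‖ := by
  rw [← F.cut_cut h1 h2 h3]
  exact F.norm_cut_le h2 _

theorem essNorm_cut_le {s t : ℝ} (h : s ≤ t) (X : H →L[ℂ] H) :
    essNorm (F.cut s t X) ≤ essNorm X :=
  essNorm_mul_mul_le (F.norm_gap_le h) (F.norm_gap_le h) X

theorem essNorm_cut_le_cut {s s' t' t : ℝ} (h1 : s ≤ s') (h2 : s' ≤ t') (h3 : t' ≤ t)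
    (X : H →L[ℂ] H) : essNorm (F.cut s' t' X) ≤ essNorm (F.cut s t X) := by
  rw [← F.cut_cut h1 h2 h3]
  exact F.essNorm_cut_le h2 _

variable {F} in
theorem cut_mem_alg {X : H →L[ℂ] H} (hX : X ∈ F.alg) (s t : ℝ) : F.cut s t X ∈ F.alg :=
  F.alg.mul_mem (F.alg.mul_mem (gap_mem_alg s t) hX) (gap_mem_alg s t)

theorem star_cut (s t : ℝ) (X : H →L[ℂ] H) : star (F.cut s t X) = F.cut s t (star X) := by
  simp only [cut, star_mul, F.star_gap, mul_assoc]

theorem dual_cut (s t : ℝ) (X : H →L[ℂ] H) : F.dual.cut s t X = F.cut (-t) (-s) X := by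
  simp only [cut, dual_gap]

/-- The two-sided diagonal seminorm of `X` at the parameter `t` is less than `a`. -/
def JLt (X : H →L[ℂ] H) (t a : ℝ) : Prop := ∃ l m, l < t ∧ t < m ∧ ‖F.cut l m X‖ < a

/-- The right diagonal seminorm `i⁺` of `X` at the parameter `t` is less than `a`. -/
def ILt (X : H →L[ℂ] H) (t a : ℝ) : Prop := ∃ m, t < m ∧ ‖F.cut t m X‖ < a

/-- The right essential diagonal seminorm `e⁺` of `X` at the parameter `t` is less than `a`. -/
def ELt (X : H →L[ℂ] H) (t a : ℝ) : Prop :=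
  ∃ b < a, ∃ m, t < m ∧ ∀ l ∈ Set.Ioo t m, essNorm (F.cut l m X) ≤ b

/-- The two-sided diagonal seminorm of `X` at the parameter `t` vanishes. -/
def JZero (X : H →L[ℂ] H) (t : ℝ) : Prop := ∀ ε > 0, F.JLt X t ε

/-- The right diagonal seminorm `i⁺` of `X` at the parameter `t` vanishes. -/
def IZero (X : H →L[ℂ] H) (t : ℝ) : Prop := ∀ ε > 0, F.ILt X t ε

/-- The right essential diagonal seminorm `e⁺` of `X` at the parameter `t` vanishes. -/
def EZero (X : H →L[ℂ] H) (t : ℝ) : Prop := ∀ ε > 0, F.ELt X t ε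

variable {F}

theorem JLt.add {X Y : H →L[ℂ] H} {t a b : ℝ} (hX : F.JLt X t a) (hY : F.JLt Y t b) :
    F.JLt (X + Y) t (a + b) := by
  obtain ⟨l, m, hl, hm, h⟩ := hX
  obtain ⟨l', m', hl', hm', h'⟩ := hY
  refine ⟨max l l', min m m', max_lt hl hl', lt_min hm hm', ?_⟩
  have hlt : max l l' ≤ min m m' := ((max_lt hl hl').trans (lt_min hm hm')).le
  rw [cut_add]
  refine (norm_add_le _ _).trans_lt (add_lt_add ?_ ?_)
  · exact (F.norm_cut_le_cut (le_max_left _ _) hlt (min_le_left _ _) X).trans_lt h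
  · exact (F.norm_cut_le_cut (le_max_right _ _) hlt (min_le_right _ _) Y).trans_lt h'

theorem JZero.add {X Y : H →L[ℂ] H} {t : ℝ} (hX : F.JZero X t) (hY : F.JZero Y t) :
    F.JZero (X + Y) t := fun ε hε => by
  simpa using (hX (ε / 2) (half_pos hε)).add (hY (ε / 2) (half_pos hε))

theorem JZero.smul {X : H →L[ℂ] H} {t : ℝ} (c : ℂ) (hX : F.JZero X t) :
    F.JZero (c • X) t := fun ε hε => by
  obtain ⟨l, m, hl, hm, h⟩ := hX (ε / (‖c‖ + 1)) (by positivity)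
  refine ⟨l, m, hl, hm, ?_⟩
  rw [cut_smul, norm_smul]
  rw [lt_div_iff₀ (by positivity)] at h
  nlinarith [norm_nonneg (F.cut l m X)]

theorem jZero_zero (t : ℝ) : F.JZero 0 t := fun ε hε =>
  ⟨t - 1, t + 1, by linarith, by linarith, by simpa using hε⟩

/-- The condition `JLt` depends only on the operator near the diagonal. -/
theorem JLt.congr {X Y : H →L[ℂ] H} {t l m a : ℝ} (hX : F.JLt X t a) (hl : l < t) (hm : t < m)
    (h : F.cut l m X = F.cut l m Y) : F.JLt Y t a := by
  obtain ⟨l', m', hl', hm', h'⟩ := hX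
  have hlt : max l l' ≤ min m m' := ((max_lt hl hl').trans (lt_min hm hm')).le
  refine ⟨max l l', min m m', max_lt hl hl', lt_min hm hm', ?_⟩
  rw [← F.cut_cut (le_max_left _ _) hlt (min_le_left _ _), ← h,
    F.cut_cut (le_max_left _ _) hlt (min_le_left _ _)]
  exact (F.norm_cut_le_cut (le_max_right _ _) hlt (min_le_right _ _) _).trans_lt h'

theorem JZero.congr {X Y : H →L[ℂ] H} {t l m : ℝ} (hX : F.JZero X t) (hl : l < t) (hm : t < m)
    (h : F.cut l m X = F.cut l m Y) : F.JZero Y t := fun ε hε => (hX ε hε).congr hl hm h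

theorem ILt.congr {X Y : H →L[ℂ] H} {t m a : ℝ} (hX : F.ILt X t a) (hm : t < m)
    (h : F.cut t m X = F.cut t m Y) : F.ILt Y t a := by
  obtain ⟨m', hm', h'⟩ := hX
  have hlt : t ≤ min m m' := (lt_min hm hm').le
  refine ⟨min m m', lt_min hm hm', ?_⟩
  rw [← F.cut_cut le_rfl hlt (min_le_left _ _), ← h, F.cut_cut le_rfl hlt (min_le_left _ _)]
  exact (F.norm_cut_le_cut le_rfl hlt (min_le_right _ _) _).trans_lt h'

theorem ELt.congr {X Y : H →L[ℂ] H} {t m a : ℝ} (hX : F.ELt X t a) (hm : t < m)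
    (h : F.cut t m X = F.cut t m Y) : F.ELt Y t a := by
  obtain ⟨b, hb, m', hm', h'⟩ := hX
  refine ⟨b, hb, min m m', lt_min hm hm', fun l hl => ?_⟩
  rw [← F.cut_cut hl.1.le hl.2.le (min_le_left _ _), ← h,
    F.cut_cut hl.1.le hl.2.le (min_le_left _ _)]
  exact (F.essNorm_cut_le_cut le_rfl hl.2.le (min_le_right _ _) _).trans
    (h' l ⟨hl.1, hl.2.trans_le (min_le_right _ _)⟩)

/-- Compact operators vanish at the diagonal, since the family has no atoms. -/
theorem jZero_of_isCompactOperator {K : H →L[ℂ] H} (hK : IsCompactOperator K) (t : ℝ) :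
    F.JZero K t := fun ε hε => by
  have h0 := tendsto_one_div_add_atTop_nhds_zero_nat (𝕜 := ℝ)
  have hl : Tendsto (fun n : ℕ => t - 1 / ((n : ℝ) + 1)) atTop (𝓝 t) := by
    simpa using h0.const_sub t
  have hm : Tendsto (fun n : ℕ => t + 1 / ((n : ℝ) + 1)) atTop (𝓝 t) := by
    simpa using h0.const_add t
  have hpos : ∀ n : ℕ, 0 < 1 / ((n : ℝ) + 1) := fun n => by positivity
  have hle : ∀ n : ℕ, t - 1 / ((n : ℝ) + 1) ≤ t + 1 / ((n : ℝ) + 1) := fun n => by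
    linarith [hpos n]
  obtain ⟨n, hn⟩ := ((hK.tendsto_norm_mul (fun n : ℕ => F.norm_gap_le (hle n))
    (F.tendsto_gap hl hm)).eventually_lt_const hε).exists
  refine ⟨_, _, sub_lt_self _ (hpos n), lt_add_of_pos_right _ (hpos n), lt_of_le_of_lt ?_ hn⟩
  exact (norm_mul_le _ _).trans (mul_le_of_le_one_right (norm_nonneg _) (F.norm_gap_le (hle n)))

theorem isOpen_jLt (X : H →L[ℂ] H) (a : ℝ) : IsOpen {t | F.JLt X t a} := by
  rw [isOpen_iff_mem_nhds]
  rintro t ⟨l, m, hl, hm, h⟩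
  filter_upwards [Ioo_mem_nhds hl hm] with r hr
  exact ⟨l, m, hr.1, hr.2, h⟩

/-- Where `e⁺` is less than `a`, the two-sided seminorms are less than `a` on an interval to the
right. -/
theorem ELt.exists_jLt {X : H →L[ℂ] H} {t a : ℝ} (h : F.ELt X t a) :
    ∃ m, t < m ∧ ∀ r ∈ Set.Ioo t m, F.JLt X r a := by
  obtain ⟨b, hb, m, hm, h⟩ := h
  refine ⟨m, hm, fun r hr => ?_⟩
  obtain ⟨l, hl1, hl2⟩ := exists_between hr.1
  obtain ⟨K, hK, hKa⟩ := essNorm_lt_iff.1 ((h l ⟨hl1, hl2.trans hr.2⟩).trans_lt hb)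
  obtain ⟨b', hb1, hb2⟩ := exists_between hKa
  have h1 : F.JLt (F.cut l m X - K) r b' :=
    ⟨l, m, hl2, hr.2, (F.norm_cut_le (hl2.trans hr.2).le _).trans_lt hb1⟩
  have h2 := h1.add (jZero_of_isCompactOperator hK r (a - b') (sub_pos.2 hb2))
  rw [sub_add_cancel, add_sub_cancel] at h2
  exact h2.congr hl2 hr.2 (F.cut_cut le_rfl (hl2.trans hr.2).le le_rfl X)

/-- Where `i⁺` is less than `a`, the two-sided seminorms are less than `a` on an interval to the
right. -/
theorem ILt.exists_jLt {X : H →L[ℂ] H} {t a : ℝ} (h : F.ILt X t a) :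
    ∃ m, t < m ∧ ∀ r ∈ Set.Ioo t m, F.JLt X r a := by
  obtain ⟨m, hm, h⟩ := h
  exact ⟨m, hm, fun r hr => ⟨t, m, hr.1, hr.2, h⟩⟩

end SpectralFamily

/-! ### Functional calculus and partitions of unity -/

section Operators

variable {H : Type*} [NormedAddCommGroup H] [InnerProductSpace ℂ H] [CompleteSpace H]

/-- If `y` is nearly an eigenvector of `A` for the value `ρ`, then it is nearly an eigenvector of
`f(A)` for `f ρ`, when `f` is Lipschitz. -/
theorem norm_cfc_apply_sub_le {A : H →L[ℂ] H} (hA : IsSelfAdjoint A) {f : ℝ → ℝ}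
    (hf : Continuous f) {C : ℝ} (hC : 0 ≤ C) {ρ : ℝ} (hfC : ∀ x, |f x - f ρ| ≤ C * |x - ρ|)
    (y : H) :
    ‖cfc f A y - (f ρ : ℂ) • y‖ ≤ C * ‖A y - (ρ : ℂ) • y‖ := by
  have e1 : cfc (fun x => f x - f ρ) A = cfc f A - (f ρ : ℂ) • 1 := by
    rw [cfc_sub f (fun _ => f ρ) A hf.continuousOn, cfc_const (f ρ) A,
      Algebra.algebraMap_eq_smul_one]
    rfl
  have e2 : cfc (fun x => C * (x - ρ)) A = (C : ℂ) • (A - (ρ : ℂ) • 1) := by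
    rw [cfc_const_mul C (fun x => x - ρ) A, cfc_sub (fun x => x) (fun _ => ρ) A, cfc_const ρ A,
      cfc_id' ℝ A, Algebra.algebraMap_eq_smul_one]
    rfl
  have hle : cfc (fun x => (f x - f ρ) * (f x - f ρ)) A ≤
      cfc (fun x => (C * (x - ρ)) * (C * (x - ρ))) A := by
    refine cfc_mono fun x _ => ?_
    rw [← sq, ← sq]
    refine sq_le_sq.2 ?_
    rw [abs_mul, abs_of_nonneg hC]
    exact hfC x
  rw [cfc_mul (fun x => f x - f ρ) (fun x => f x - f ρ) A,
    cfc_mul (fun x => C * (x - ρ)) (fun x => C * (x - ρ)) A, ContinuousLinearMap.le_def] at hle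
  have s1 : star (cfc (fun x => f x - f ρ) A) = cfc (fun x => f x - f ρ) A :=
    (cfc_predicate (fun x => f x - f ρ) A).star_eq
  have s2 : star (cfc (fun x => C * (x - ρ)) A) = cfc (fun x => C * (x - ρ)) A :=
    (cfc_predicate (fun x => C * (x - ρ)) A).star_eq
  have key : ‖cfc (fun x => f x - f ρ) A y‖ ^ 2 ≤ ‖cfc (fun x => C * (x - ρ)) A y‖ ^ 2 := by
    rw [norm_sq_eq_re_inner_star_mul, norm_sq_eq_re_inner_star_mul, s1, s2, ← sub_nonneg,
      ← map_sub, ← inner_sub_left]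
    exact hle.re_inner_nonneg_left y
  have key2 := (sq_le_sq₀ (norm_nonneg _) (norm_nonneg _)).1 key
  rw [e1, e2] at key2
  simpa [norm_smul, abs_of_nonneg hC] using key2

/-- If `c² + d² = 1`, then `c X c + d Y d` is no larger in norm than `X` and `Y`. -/
theorem norm_mul_mul_add_le {c d X Y : H →L[ℂ] H} (hc : IsSelfAdjoint c) (hd : IsSelfAdjoint d)
    (hcd : c * c + d * d = 1) {a : ℝ} (ha : 0 ≤ a) (hX : ‖X‖ ≤ a) (hY : ‖Y‖ ≤ a) :
    ‖c * X * c + d * Y * d‖ ≤ a := by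
  have hsq : ∀ x : H, ‖c x‖ ^ 2 + ‖d x‖ ^ 2 = ‖x‖ ^ 2 := fun x => by
    rw [norm_sq_eq_re_inner_star_mul, norm_sq_eq_re_inner_star_mul, hc.star_eq, hd.star_eq,
      ← map_add, ← inner_add_left, ← add_apply, hcd]
    exact inner_self_eq_norm_sq (𝕜 := ℂ) x
  refine ContinuousLinearMap.opNorm_le_of_re_inner_le ha fun x y hx hy => ?_
  have hxy := hsq x
  have hyy := hsq y
  rw [hx] at hxy
  rw [hy] at hyy
  have e : ⟪(c * X * c + d * Y * d) x, y⟫_ℂ = ⟪X (c x), c y⟫_ℂ + ⟪Y (d x), d y⟫_ℂ := by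
    rw [add_apply, inner_add_left]
    congr 1
    · rw [← ContinuousLinearMap.adjoint_inner_left, ← ContinuousLinearMap.star_eq_adjoint,
        hc.star_eq]
      rfl
    · rw [← ContinuousLinearMap.adjoint_inner_left, ← ContinuousLinearMap.star_eq_adjoint,
        hd.star_eq]
      rfl
  have h1 : RCLike.re ⟪X (c x), c y⟫_ℂ ≤ a * (‖c x‖ * ‖c y‖) := by
    refine (RCLike.re_le_norm _).trans ((norm_inner_le_norm _ _).trans ?_)
    rw [← mul_assoc]
    exact mul_le_mul_of_nonneg_right (X.le_of_opNorm_le hX _) (norm_nonneg _)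
  have h2 : RCLike.re ⟪Y (d x), d y⟫_ℂ ≤ a * (‖d x‖ * ‖d y‖) := by
    refine (RCLike.re_le_norm _).trans ((norm_inner_le_norm _ _).trans ?_)
    rw [← mul_assoc]
    exact mul_le_mul_of_nonneg_right (Y.le_of_opNorm_le hY _) (norm_nonneg _)
  rw [e, map_add]
  have h3 : ‖c x‖ * ‖c y‖ + ‖d x‖ * ‖d y‖ ≤ 1 := by
    nlinarith [sq_nonneg (‖c x‖ - ‖c y‖), sq_nonneg (‖d x‖ - ‖d y‖)]
  nlinarith

end Operators

namespace SpectralFamily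

variable {H : Type*} [NormedAddCommGroup H] [InnerProductSpace ℂ H] [CompleteSpace H]
  (F : SpectralFamily H)

/-- The operator is close to the scalar `γ` near the parameter `r`. -/
def Near (c : H →L[ℂ] H) (γ r : ℝ) : Prop :=
  ∀ η > 0, ∃ l m, l < r ∧ r < m ∧ ∀ x, ‖c (F.gap l m x) - (γ : ℂ) • F.gap l m x‖ ≤ η * ‖x‖

/-- The affine function that rises from `0` at `s` to `1` at `t`, cut off to have values in
`[0,1]`, of the spectral family. -/
theorem exists_ramp {s t : ℝ} (hst : s < t) :
    ∃ A : H →L[ℂ] H, IsSelfAdjoint A ∧ (∀ r, Commute A (F.E r)) ∧ A * F.E s = 0 ∧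
      A * (1 - F.E t) = 1 - F.E t ∧
      ∀ r, ∃ ρ : ℝ, (r ≤ s → ρ = 0) ∧ (t ≤ r → ρ = 1) ∧ F.Near A ρ r := by
  have hts : 0 < t - s := sub_pos.2 hst
  have hcont : ∀ x, Continuous fun r => x - F.E r x := fun x =>
    continuous_const.sub (F.continuous_apply x)
  have hint : ∀ x a b, IntervalIntegrable (fun r => x - F.E r x) MeasureTheory.volume a b :=
    fun x a b => (hcont x).intervalIntegrable a b
  -- The ramp is the average of `1 - E r` over `r` in `(s,t)`, which is the integral of the cut-off
  -- affine function against the spectral measure.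
  let A₀ : H →ₗ[ℂ] H :=
    { toFun := fun x => ((t - s)⁻¹ : ℝ) • ∫ r in s..t, (x - F.E r x)
      map_add' := fun x y => by
        rw [← smul_add, ← intervalIntegral.integral_add (hint x s t) (hint y s t)]
        congr 2
        funext r
        rw [map_add]
        abel
      map_smul' := fun c x => by
        rw [RingHom.id_apply, smul_comm c, ← intervalIntegral.integral_smul c]
        congr 2
        funext r
        rw [map_smul, smul_sub] }
  have hnorm : ∀ x (r : ℝ), ‖x - F.E r x‖ ≤ ‖x‖ := fun x r => by
    have h1 : ‖(1 : H →L[ℂ] H) - F.E r‖ ≤ 1 :=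
      IsStarProjection.norm_le _ (F.isStarProjection r).one_sub
    simpa using ((1 : H →L[ℂ] H) - F.E r).le_of_opNorm_le h1 x
  have hI : ∀ (x : H) (a b : ℝ), a ≤ b → ‖∫ r in a..b, (x - F.E r x)‖ ≤ ‖x‖ * (b - a) :=
    fun x a b hab => by
      have := intervalIntegral.norm_integral_le_of_norm_le_const (a := a) (b := b)
        (f := fun r => x - F.E r x) (C := ‖x‖) fun r _ => hnorm x r
      rwa [abs_of_nonneg (sub_nonneg.2 hab)] at this
  have hA₀ : ∀ x, ‖A₀ x‖ ≤ 1 * ‖x‖ := fun x => by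
    change ‖((t - s)⁻¹ : ℝ) • ∫ r in s..t, (x - F.E r x)‖ ≤ _
    rw [norm_smul, Real.norm_of_nonneg (inv_nonneg.2 hts.le)]
    calc _ ≤ (t - s)⁻¹ * (‖x‖ * (t - s)) :=
          mul_le_mul_of_nonneg_left (hI x s t hst.le) (inv_nonneg.2 hts.le)
      _ = 1 * ‖x‖ := by field_simp
  let A := A₀.mkContinuous 1 hA₀
  have hA : ∀ x, A x = ((t - s)⁻¹ : ℝ) • ∫ r in s..t, (x - F.E r x) := fun x => rfl
  -- A compression of the ramp to a subinterval differs little from its value there.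
  have hnear : ∀ l m, l ≤ m → ∀ x,
      ‖A (F.gap l m x) - (((max s (min t l) - s) / (t - s) : ℝ) : ℂ) • F.gap l m x‖
        ≤ (m - l) / (t - s) * ‖x‖ := by
    intro l m hlm x
    set y := F.gap l m x with hy
    have hE1 : ∀ r, r ≤ l → F.E r y = 0 := fun r hr => by
      rw [hy, ← mul_apply_eq_comp, gap, mul_sub, F.mul_of_le hr, F.mul_of_le (hr.trans hlm)]
      simp
    have hE2 : ∀ r, m ≤ r → F.E r y = y := fun r hr => by
      rw [hy, ← mul_apply_eq_comp, gap, mul_sub, F.mul_of_ge hr, F.mul_of_ge (hlm.trans hr)]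
    set l' := max s (min t l) with hl'
    set m' := max s (min t m) with hm'
    have a1 : s ≤ l' := le_max_left _ _
    have a2 : l' ≤ m' := max_le_max le_rfl (min_le_min le_rfl hlm)
    have a3 : m' ≤ t := max_le hst.le (min_le_left _ _)
    have a4 : m' - l' ≤ m - l := by
      simp only [hl', hm', max_def, min_def]
      split_ifs <;> linarith
    have I1 : ∫ r in s..l', (y - F.E r y) = (l' - s : ℝ) • y := by
      rw [← intervalIntegral.integral_const]
      refine intervalIntegral.integral_congr_ae (Eventually.of_forall fun r hr => ?_)
      rw [Set.uIoc_of_le a1] at hr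
      have : r ≤ l := by
        by_contra hc
        have : l' ≤ max s l := max_le_max le_rfl (min_le_right _ _)
        have h2 := hr.2.trans this
        rcases le_max_iff.1 h2 with h3 | h3
        · exact absurd hr.1 (not_lt.2 h3)
        · exact hc h3
      rw [hE1 r this, sub_zero]
    have I3 : ∫ r in m'..t, (y - F.E r y) = 0 := by
      rw [← intervalIntegral.integral_zero (a := m') (b := t) (μ := MeasureTheory.volume)]
      refine intervalIntegral.integral_congr_ae (Eventually.of_forall fun r hr => ?_)
      rw [Set.uIoc_of_le a3] at hr
      have : m ≤ r := by
        by_contra hc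
        have h2 : min t m < r := (le_max_right _ _).trans_lt hr.1
        rcases min_lt_iff.1 h2 with h3 | h3
        · exact absurd hr.2 (not_le.2 h3)
        · exact hc h3.le
      rw [hE2 r this, sub_self]
    have hsum : A y - (((l' - s) / (t - s) : ℝ) : ℂ) • y =
        ((t - s)⁻¹ : ℝ) • ∫ r in l'..m', (y - F.E r y) := by
      rw [hA, ← intervalIntegral.integral_add_adjacent_intervals (hint y s m') (hint y m' t),
        ← intervalIntegral.integral_add_adjacent_intervals (hint y s l') (hint y l' m'), I1, I3,
        add_zero, smul_add, smul_smul, div_eq_inv_mul, Complex.coe_smul]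
      abel
    rw [hsum, norm_smul, Real.norm_of_nonneg (inv_nonneg.2 hts.le), div_eq_inv_mul, mul_assoc]
    refine mul_le_mul_of_nonneg_left ((hI y l' m' a2).trans ?_) (inv_nonneg.2 hts.le)
    rw [mul_comm]
    exact mul_le_mul a4 (F.norm_gap_apply_le hlm x) (norm_nonneg _) (by linarith)
  refine ⟨A, ?_, fun r => ?_, ?_, ?_, fun r => ⟨(max s (min t r) - s) / (t - s), fun h => ?_,
    fun h => ?_, fun η hη => ?_⟩⟩
  · rw [ContinuousLinearMap.isSelfAdjoint_iff_isSymmetric]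
    intro x y
    change ⟪A x, y⟫_ℂ = ⟪x, A y⟫_ℂ
    have hinner : ∀ x y, ⟪x, A y⟫_ℂ = ((t - s)⁻¹ : ℝ) • ∫ r in s..t, ⟪x, y - F.E r y⟫_ℂ := by
      intro x y
      rw [hA, inner_smul_right_eq_smul]
      congr 1
      exact ((innerSL ℂ x).intervalIntegral_comp_comm (hint y s t)).symm
    rw [← inner_conj_symm, hinner, hinner, Complex.real_smul, Complex.real_smul, map_mul,
      Complex.conj_ofReal]
    congr 1
    rw [← intervalIntegral.intervalIntegral_conj]
    congr 1
    funext r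
    rw [inner_conj_symm, inner_sub_left, inner_sub_right]
    congr 1
    rw [← ContinuousLinearMap.adjoint_inner_right, ← ContinuousLinearMap.star_eq_adjoint, F.star_E]
  · ext x
    rw [mul_apply_eq_comp, mul_apply_eq_comp, hA, hA, ← Complex.coe_smul, ← Complex.coe_smul,
      map_smul, ← (F.E r).intervalIntegral_comp_comm (hint x s t)]
    congr 2
    funext r'
    have := F.commute_E_gap r r r'
    rw [gap] at this
    have h2 : F.E r' * F.E r = F.E r * F.E r' := by
      have := this.eq
      rw [mul_sub, sub_mul, F.E_mul_self, sub_left_inj] at this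
      exact this.symm
    rw [map_sub, ← mul_apply_eq_comp, ← mul_apply_eq_comp, h2]
  · ext x
    rw [mul_apply_eq_comp, hA, intervalIntegral.integral_congr_ae (g := fun _ => (0 : H))]
    · simp
    · refine Eventually.of_forall fun r hr => ?_
      rw [Set.uIoc_of_le hst.le] at hr
      rw [← mul_apply_eq_comp, F.mul_of_ge hr.1.le, sub_self]
  · ext x
    rw [mul_apply_eq_comp, hA, intervalIntegral.integral_congr_ae (g := fun _ => (1 - F.E t) x)]
    · rw [intervalIntegral.integral_const, smul_smul, inv_mul_cancel₀ hts.ne', one_smul]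
    · refine Eventually.of_forall fun r hr => ?_
      rw [Set.uIoc_of_le hst.le] at hr
      rw [← mul_apply_eq_comp, mul_sub, F.mul_of_le hr.2]
      simp
  · rw [max_eq_left ((min_le_right _ _).trans h), sub_self, zero_div]
  · rw [min_eq_left h, max_eq_right hst.le, div_self hts.ne']
  · obtain ⟨δ, hδ, hδη⟩ : ∃ δ > 0, 3 * δ / (t - s) ≤ η :=
      ⟨η * (t - s) / 3, by positivity, le_of_eq (by field_simp)⟩
    refine ⟨r - δ, r + δ, by linarith, by linarith, fun x => ?_⟩
    have h1 := hnear (r - δ) (r + δ) (by linarith) x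
    set y := F.gap (r - δ) (r + δ) x with hy
    have h2 : |(max s (min t (r - δ)) - s) / (t - s) - (max s (min t r) - s) / (t - s)|
        ≤ δ / (t - s) := by
      rw [← sub_div, abs_div, abs_of_pos hts]
      refine div_le_div_of_nonneg_right ?_ hts.le
      rw [abs_le]
      simp only [max_def, min_def]
      constructor <;> split_ifs <;> linarith
    set p := (max s (min t (r - δ)) - s) / (t - s)
    set q := (max s (min t r) - s) / (t - s)
    have h3 : A y - (q : ℂ) • y = (A y - (p : ℂ) • y) + ((p - q : ℝ) : ℂ) • y := by
      push_cast
      rw [sub_smul]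
      abel
    rw [h3]
    refine (norm_add_le _ _).trans ?_
    rw [norm_smul, Complex.norm_real, Real.norm_eq_abs]
    have h4 : |p - q| * ‖y‖ ≤ δ / (t - s) * ‖x‖ :=
      mul_le_mul h2 (F.norm_gap_apply_le (by linarith) x) (norm_nonneg _) (by positivity)
    calc _ ≤ (r + δ - (r - δ)) / (t - s) * ‖x‖ + δ / (t - s) * ‖x‖ := add_le_add h1 h4
      _ = 3 * δ / (t - s) * ‖x‖ := by ring
      _ ≤ η * ‖x‖ := mul_le_mul_of_nonneg_right hδη (norm_nonneg _)

/-- A Lipschitz function of an operator that is close to `ρ` near `r` is close to `f ρ` there. -/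
theorem Near.cfc {F : SpectralFamily H} {A : H →L[ℂ] H} (hA : IsSelfAdjoint A) {ρ r : ℝ}
    (h : F.Near A ρ r) {f : ℝ → ℝ} (hf : Continuous f) {C : ℝ} (hC : 0 < C)
    (hfC : ∀ x y, |f x - f y| ≤ C * |x - y|) : F.Near (cfc f A) (f ρ) r := fun η hη => by
  obtain ⟨l, m, hl, hm, h⟩ := h (η / C) (by positivity)
  refine ⟨l, m, hl, hm, fun x => ?_⟩
  refine (norm_cfc_apply_sub_le hA hf hC.le (fun x => hfC x ρ) _).trans ?_
  calc _ ≤ C * (η / C * ‖x‖) := mul_le_mul_of_nonneg_left (h x) hC.le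
    _ = η * ‖x‖ := by field_simp

/-- Two operators in the von Neumann algebra of the family that form a quadratic partition of
unity, the transition taking place between `s` and `t`. They are the cosine and the sine of a
ramp. -/
theorem exists_partition {s t : ℝ} (hst : s < t) :
    ∃ c d : H →L[ℂ] H, IsSelfAdjoint c ∧ IsSelfAdjoint d ∧ c * c + d * d = 1 ∧
      (∀ r, Commute c (F.E r)) ∧ (∀ r, Commute d (F.E r)) ∧
      c * F.E s = F.E s ∧ d * F.E s = 0 ∧
      c * (1 - F.E t) = 0 ∧ d * (1 - F.E t) = 1 - F.E t ∧
      ∀ r, ∃ γ δ : ℝ, γ ^ 2 + δ ^ 2 = 1 ∧ (t ≤ r → γ = 0) ∧ (r ≤ s → δ = 0) ∧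
        F.Near c γ r ∧ F.Near d δ r := by
  obtain ⟨A, hA, hcomm, hs, ht, hnear⟩ := F.exists_ramp hst
  have hpi := Real.pi_pos
  have hcos : Continuous fun x : ℝ => Real.cos (Real.pi / 2 * x) := by fun_prop
  have hsin : Continuous fun x : ℝ => Real.sin (Real.pi / 2 * x) := by fun_prop
  have hcosL : ∀ x y : ℝ, |Real.cos (Real.pi / 2 * x) - Real.cos (Real.pi / 2 * y)| ≤
      Real.pi / 2 * |x - y| := fun x y => by
    refine (Real.abs_cos_sub_cos_le _ _).trans ?_
    rw [← mul_sub, abs_mul, abs_of_pos (by positivity)]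
  have hsinL : ∀ x y : ℝ, |Real.sin (Real.pi / 2 * x) - Real.sin (Real.pi / 2 * y)| ≤
      Real.pi / 2 * |x - y| := fun x y => by
    refine (Real.abs_sin_sub_sin_le _ _).trans ?_
    rw [← mul_sub, abs_mul, abs_of_pos (by positivity)]
  have hval : ∀ {f : ℝ → ℝ}, Continuous f →
      (∀ x y, |f x - f y| ≤ Real.pi / 2 * |x - y|) → ∀ {B : H →L[ℂ] H} {ρ : ℝ},
      A * B = (ρ : ℂ) • B → cfc f A * B = (f ρ : ℂ) • B := by
    intro f hf hfL B ρ hB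
    ext x
    have := norm_cfc_apply_sub_le hA hf (C := Real.pi / 2) (by positivity) (fun x => hfL x ρ) (B x)
    rw [← mul_apply_eq_comp A, hB, smul_apply, sub_self, norm_zero, mul_zero] at this
    rw [mul_apply_eq_comp, smul_apply, ← sub_eq_zero]
    exact norm_le_zero_iff.1 this
  have hs' : A * F.E s = ((0 : ℝ) : ℂ) • F.E s := by simpa using hs
  have ht' : A * (1 - F.E t) = ((1 : ℝ) : ℂ) • (1 - F.E t) := by simpa using ht
  have hAc : ∀ f : ℝ → ℝ, ∀ r, Commute (cfc f A) (F.E r) := fun f r =>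
    (hcomm r).cfc (by rw [hA.star_eq]; exact hcomm r) f
  refine ⟨cfc (fun x => Real.cos (Real.pi / 2 * x)) A, cfc (fun x => Real.sin (Real.pi / 2 * x)) A,
    cfc_predicate _ A, cfc_predicate _ A, ?_, hAc _, hAc _, ?_, ?_, ?_, ?_, fun r => ?_⟩
  · have hcc : Continuous fun x : ℝ =>
        Real.cos (Real.pi / 2 * x) * Real.cos (Real.pi / 2 * x) := hcos.mul hcos
    have hss : Continuous fun x : ℝ =>
        Real.sin (Real.pi / 2 * x) * Real.sin (Real.pi / 2 * x) := hsin.mul hsin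
    rw [← cfc_mul _ _ A hcos.continuousOn hcos.continuousOn,
      ← cfc_mul _ _ A hsin.continuousOn hsin.continuousOn,
      ← cfc_add (a := A) _ _ hcc.continuousOn hss.continuousOn,
      ← cfc_const_one ℝ A]
    refine cfc_congr fun x _ => ?_
    rw [← sq, ← sq]
    exact Real.cos_sq_add_sin_sq _
  · simpa using hval hcos hcosL hs'
  · simpa using hval hsin hsinL hs'
  · simpa using hval hcos hcosL ht'
  · simpa using hval hsin hsinL ht'
  · obtain ⟨ρ, h0, h1, hρ⟩ := hnear r
    refine ⟨Real.cos (Real.pi / 2 * ρ), Real.sin (Real.pi / 2 * ρ), Real.cos_sq_add_sin_sq _,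
      fun h => ?_, fun h => ?_, hρ.cfc hA hcos (by positivity) hcosL,
      hρ.cfc hA hsin (by positivity) hsinL⟩
    · rw [h1 h, mul_one, Real.cos_pi_div_two]
    · rw [h0 h, mul_zero, Real.sin_zero]

end SpectralFamily

/-! ### Gluing local copies -/

namespace SpectralFamily

variable {H : Type*} [NormedAddCommGroup H] [InnerProductSpace ℂ H] [CompleteSpace H]
  {F : SpectralFamily H}

/-- `Z` is an upper triangular operator of norm at most `a` that lives on the interval `(s,t)` and
agrees there with `X` near the diagonal. -/
structure IsLocalCopy (F : SpectralFamily H) (X : H →L[ℂ] H) (a s t : ℝ) (Z : H →L[ℂ] H) :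
    Prop where
  mem_alg : Z ∈ F.alg
  cut_eq : F.cut s t Z = Z
  norm_le : ‖Z‖ ≤ a
  jZero : ∀ r ∈ Set.Ioo s t, F.JZero (X - Z) r

variable (F) in
theorem cut_mul_mul {c Z : H →L[ℂ] H} {l m : ℝ} (h : c * F.gap l m = F.gap l m * c) :
    F.cut l m (c * Z * c) = (c * F.gap l m) * Z * (c * F.gap l m) := by
  calc F.gap l m * (c * Z * c) * F.gap l m = (F.gap l m * c) * Z * (c * F.gap l m) := by
        simp only [mul_assoc]
    _ = _ := by rw [← h]

/-- An operator that is close to a scalar near `r` acts near the diagonal at `r` as that scalar. -/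
theorem Near.jZero_sub {c : H →L[ℂ] H} {γ r : ℝ} (hc : F.Near c γ r)
    (hcomm : ∀ t, Commute c (F.E t)) (Z : H →L[ℂ] H) :
    F.JZero (((γ ^ 2 : ℝ) : ℂ) • Z - c * Z * c) r := fun ε hε => by
  set C := (2 * |γ| + 1) * ‖Z‖ + 1 with hC
  have hCpos : 0 < C := by positivity
  obtain ⟨l, m, hl, hm, h⟩ := hc (min 1 (ε / (2 * C))) (by positivity)
  refine ⟨l, m, hl, hm, ?_⟩
  set η := min 1 (ε / (2 * C)) with hη
  have hη0 : 0 ≤ η := by positivity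
  have hlm : l ≤ m := (hl.trans hm).le
  set P := F.gap l m with hP
  have hcP : c * P = P * c := ((hcomm m).sub_right (hcomm l)).eq
  set e := c * P - (γ : ℂ) • P with he
  have he1 : ‖e‖ ≤ η := ContinuousLinearMap.opNorm_le_bound _ hη0 fun x => by simpa [he] using h x
  have hcP1 : c * P = (γ : ℂ) • P + e := by rw [he]; abel
  have hP1 : ‖P‖ ≤ 1 := F.norm_gap_le hlm
  have hid : F.cut l m (((γ ^ 2 : ℝ) : ℂ) • Z - c * Z * c) =
      -((γ : ℂ) • (P * Z * e) + (γ : ℂ) • (e * Z * P) + e * Z * e) := by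
    have e1 : F.cut l m (c * Z * c) = (c * P) * Z * (c * P) := F.cut_mul_mul hcP
    rw [cut_sub, cut_smul, e1, hcP1, cut, ← hP]
    simp only [add_mul, mul_add, smul_mul_assoc, mul_smul_comm]
    push_cast
    module
  rw [hid, norm_neg]
  have n1 : ∀ A B : H →L[ℂ] H, ‖A‖ ≤ 1 → ‖B‖ ≤ η → ‖A * Z * B‖ ≤ ‖Z‖ * η := fun A B hA hB =>
    (norm_mul_le _ _).trans (mul_le_mul ((norm_mul_le _ _).trans
      (mul_le_of_le_one_left (norm_nonneg _) hA)) hB (norm_nonneg _) (norm_nonneg _))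
  have n2 : ‖e * Z * P‖ ≤ ‖Z‖ * η := by
    refine (norm_mul_le _ _).trans ((mul_le_of_le_one_right (norm_nonneg _) hP1).trans
      ((norm_mul_le _ _).trans ?_))
    rw [mul_comm]
    exact mul_le_mul_of_nonneg_left he1 (norm_nonneg _)
  have n3 : ‖(γ : ℂ) • (P * Z * e) + (γ : ℂ) • (e * Z * P) + e * Z * e‖ ≤
      |γ| * (‖Z‖ * η) + |γ| * (‖Z‖ * η) + ‖Z‖ * η := by
    refine (norm_add_le _ _).trans (add_le_add ((norm_add_le _ _).trans (add_le_add ?_ ?_)) ?_)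
    · rw [norm_smul, Complex.norm_real, Real.norm_eq_abs]
      exact mul_le_mul_of_nonneg_left (n1 P e hP1 he1) (abs_nonneg _)
    · rw [norm_smul, Complex.norm_real, Real.norm_eq_abs]
      exact mul_le_mul_of_nonneg_left n2 (abs_nonneg _)
    · exact n1 e e (he1.trans (min_le_left _ _)) he1
  have n4 : η * C ≤ ε / 2 := by
    have := mul_le_mul_of_nonneg_right (min_le_right 1 (ε / (2 * C))) hCpos.le
    refine this.trans (le_of_eq ?_)
    field_simp
  refine n3.trans_lt ?_
  rw [hC] at n4
  nlinarith

/-- Local copies on overlapping intervals are glued by a quadratic partition of unity. -/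
theorem IsLocalCopy.glue {X Z₁ Z₂ : H →L[ℂ] H} {a s u v t : ℝ} (h₁ : F.IsLocalCopy X a s v Z₁)
    (h₂ : F.IsLocalCopy X a u t Z₂) (hsu : s < u) (huv : u < v) (hvt : v < t) :
    ∃ Z, F.IsLocalCopy X a s t Z ∧ F.cut s u Z = F.cut s u Z₁ ∧ F.cut v t Z = F.cut v t Z₂ := by
  obtain ⟨c, d, hc, hd, hcd, hcc, hdc, hcs, hds, hct, hdt, hnear⟩ := F.exists_partition huv
  have ha : 0 ≤ a := (norm_nonneg _).trans h₁.norm_le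
  have hcg : ∀ l m, c * F.gap l m = F.gap l m * c := fun l m => ((hcc m).sub_right (hcc l)).eq
  have hdg : ∀ l m, d * F.gap l m = F.gap l m * d := fun l m => ((hdc m).sub_right (hdc l)).eq
  have hcut : ∀ l m, F.cut l m (c * Z₁ * c + d * Z₂ * d) =
      (c * F.gap l m) * Z₁ * (c * F.gap l m) + (d * F.gap l m) * Z₂ * (d * F.gap l m) :=
    fun l m => by rw [cut_add, F.cut_mul_mul (hcg l m), F.cut_mul_mul (hdg l m)]
  have hcut2 : ∀ l m, F.cut l m (c * Z₁ * c + d * Z₂ * d) =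
      c * F.cut l m Z₁ * c + d * F.cut l m Z₂ * d := by
    intro l m
    rw [hcut]
    congr 1
    · rw [(congrArg _ (hcg l m) : c * F.gap l m * Z₁ * (c * F.gap l m) = _), cut]
      simp only [mul_assoc]
    · rw [(congrArg _ (hdg l m) : d * F.gap l m * Z₂ * (d * F.gap l m) = _), cut]
      simp only [mul_assoc]
  refine ⟨c * Z₁ * c + d * Z₂ * d, ⟨?_, ?_, norm_mul_mul_add_le hc hd hcd ha h₁.norm_le h₂.norm_le,
    fun r hr => ?_⟩, ?_, ?_⟩
  · exact F.alg.add_mem (F.alg.mul_mem (F.alg.mul_mem (mem_alg_of_commute hcc) h₁.mem_alg)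
      (mem_alg_of_commute hcc)) (F.alg.mul_mem (F.alg.mul_mem (mem_alg_of_commute hdc) h₂.mem_alg)
      (mem_alg_of_commute hdc))
  · rw [hcut2, ← h₁.cut_eq, ← h₂.cut_eq, F.cut_cut' le_rfl (hsu.trans huv).le hvt.le,
      F.cut_cut' hsu.le (huv.trans hvt).le le_rfl]
  · obtain ⟨γ, δ, hγδ, hγ, hδ, hcn, hdn⟩ := hnear r
    have hγδ' : ((γ ^ 2 : ℝ) : ℂ) + ((δ ^ 2 : ℝ) : ℂ) = 1 := by exact_mod_cast hγδ
    have j1 : F.JZero (((γ ^ 2 : ℝ) : ℂ) • (X - Z₁)) r := by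
      rcases lt_or_ge r v with h | h
      · exact (h₁.jZero r ⟨hr.1, h⟩).smul _
      · rw [hγ h]
        simpa using jZero_zero r
    have j2 : F.JZero (((δ ^ 2 : ℝ) : ℂ) • (X - Z₂)) r := by
      rcases lt_or_ge u r with h | h
      · exact (h₂.jZero r ⟨h, hr.2⟩).smul _
      · rw [hδ h]
        simpa using jZero_zero r
    have := (j1.add j2).add ((hcn.jZero_sub hcc Z₁).add (hdn.jZero_sub hdc Z₂))
    convert this using 1
    rw [smul_sub, smul_sub]
    nth_rewrite 1 [← one_smul ℂ X]
    rw [← hγδ', add_smul]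
    abel
  · have e1 : F.gap s u = F.E u * F.gap s u := by
      rw [gap, mul_sub, F.E_mul_self, F.mul_of_ge hsu.le]
    have e2 : c * F.gap s u = F.gap s u := by rw [e1, ← mul_assoc, hcs]
    have e3 : d * F.gap s u = 0 := by rw [e1, ← mul_assoc, hds, zero_mul]
    rw [hcut, e2, e3, cut]
    simp
  · have e1 : F.gap v t = (1 - F.E v) * F.gap v t := by
      rw [sub_mul, one_mul, gap, mul_sub, F.E_mul_self, F.mul_of_le hvt.le]
      simp
    have e2 : d * F.gap v t = F.gap v t := by rw [e1, ← mul_assoc, hdt]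
    have e3 : c * F.gap v t = 0 := by rw [e1, ← mul_assoc, hct, zero_mul]
    rw [hcut, e2, e3, cut]
    simp

theorem IsLocalCopy.mono {X Z : H →L[ℂ] H} {a s s' t' t : ℝ} (h : F.IsLocalCopy X a s t Z)
    (h1 : s ≤ s') (h2 : s' ≤ t') (h3 : t' ≤ t) :
    F.IsLocalCopy X a s' t' (F.cut s' t' Z) := by
  refine ⟨cut_mem_alg h.mem_alg _ _, F.cut_cut le_rfl h2 le_rfl _, (F.norm_cut_le h2 _).trans
    h.norm_le, fun r hr => ?_⟩
  refine (h.jZero r ⟨h1.trans_lt hr.1, hr.2.trans_le h3⟩).congr hr.1 hr.2 ?_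
  rw [cut_sub, cut_sub, F.cut_cut le_rfl h2 le_rfl]

/-- If the compression of `X` to an interval has norm at most `a`, it is itself a local copy. -/
theorem isLocalCopy_cut {X : H →L[ℂ] H} (hX : X ∈ F.alg) {a s t : ℝ} (hst : s ≤ t)
    (h : ‖F.cut s t X‖ ≤ a) : F.IsLocalCopy X a s t (F.cut s t X) := by
  refine ⟨cut_mem_alg hX _ _, F.cut_cut le_rfl hst le_rfl _, h, fun r hr => ?_⟩
  refine (jZero_zero r).congr hr.1 hr.2 ?_
  rw [cut_sub, F.cut_cut le_rfl hst le_rfl, sub_self, cut_zero]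

/-- Local copies exist on every compact interval on which the two-sided seminorms are less than
`a`. -/
theorem exists_isLocalCopy {X : H →L[ℂ] H} (hX : X ∈ F.alg) {a s t : ℝ} (hst : s < t)
    (h : ∀ r ∈ Set.Icc s t, F.JLt X r a) : ∃ Z, F.IsLocalCopy X a s t Z := by
  have hloc : ∀ r ∈ Set.Icc s t, ∃ l m, l < r ∧ r < m ∧ ∃ Z, F.IsLocalCopy X a l m Z := by
    intro r hr
    obtain ⟨l, m, hl, hm, h⟩ := h r hr
    exact ⟨l, m, hl, hm, _, isLocalCopy_cut hX (hl.trans hm).le h.le⟩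
  obtain ⟨l₀, m₀, hl₀, hm₀, Z₀, hZ₀⟩ := hloc s ⟨le_rfl, hst.le⟩
  -- The supremum of the right endpoints up to which local copies exist cannot be less than `t`.
  let S : Set ℝ := {r | r ∈ Set.Icc s t ∧ ∃ m, r < m ∧ ∃ Z, F.IsLocalCopy X a l₀ m Z}
  have hsS : s ∈ S := ⟨⟨le_rfl, hst.le⟩, m₀, hm₀, Z₀, hZ₀⟩
  have hbdd : BddAbove S := ⟨t, fun r hr => hr.1.2⟩
  set σ := sSup S with hσ
  have hσs : s ≤ σ := le_csSup hbdd hsS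
  have hσt : σ ≤ t := csSup_le ⟨s, hsS⟩ fun r hr => hr.1.2
  obtain ⟨l, m, hl, hm, W, hW⟩ := hloc σ ⟨hσs, hσt⟩
  obtain ⟨r, hrS, hlr⟩ := exists_lt_of_lt_csSup ⟨s, hsS⟩ (max_lt hl (hl₀.trans_le hσs))
  obtain ⟨m', hrm', Z, hZ⟩ := hrS.2
  have hrσ : r ≤ σ := le_csSup hbdd hrS
  have hglue : ∃ Z', F.IsLocalCopy X a l₀ m Z' := by
    rcases le_or_gt m m' with hmm | hmm
    · exact ⟨_, hZ.mono le_rfl ((hl₀.trans_le hσs).trans hm).le hmm⟩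
    · have h1 : max l ((l₀ + r) / 2) < m' := max_lt ((le_max_left _ _).trans_lt (hlr.trans hrm'))
        (by have := hl₀.trans_le hrS.1.1; linarith)
      have hW' := hW.mono (le_max_left l ((l₀ + r) / 2)) (h1.trans hmm).le le_rfl
      obtain ⟨Z', hZ', -⟩ := hZ.glue hW' ((by
        have := hl₀.trans_le hrS.1.1
        linarith : l₀ < (l₀ + r) / 2).trans_le (le_max_right _ _)) h1 hmm
      exact ⟨Z', hZ'⟩
  obtain ⟨Z', hZ'⟩ := hglue
  have htσ : t < m := by
    by_contra hc
    have hmt : (σ + m) / 2 ∈ S :=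
      ⟨⟨by linarith, by linarith⟩, m, by linarith, Z', hZ'⟩
    linarith [le_csSup hbdd hmt]
  exact ⟨_, hZ'.mono hl₀.le hst.le htσ.le⟩

end SpectralFamily

/-! ### Volterra operators -/

namespace SpectralFamily

variable {H : Type*} [NormedAddCommGroup H] [InnerProductSpace ℂ H] [CompleteSpace H]
  (F : SpectralFamily H)

/-- The norm of a block diagonal operator is the maximum of the norms of its blocks. -/
theorem norm_add_le_of_cut_eq {s m t C : ℝ} (hsm : s ≤ m) (hmt : m ≤ t) {A B : H →L[ℂ] H}
    (hA : F.cut s m A = A) (hB : F.cut m t B = B) (hAC : ‖A‖ ≤ C) (hBC : ‖B‖ ≤ C) :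
    ‖A + B‖ ≤ C := by
  have hP := F.gap_isStarProjection hsm
  have h1 := hP.one_sub
  have e1 := hP.isIdempotentElem.eq
  have e2 := h1.isIdempotentElem.eq
  have hA' : F.gap s m * A * F.gap s m = A := hA
  have hB' : (1 - F.gap s m) * B * (1 - F.gap s m) = B := by
    have d1 := F.gap_mul_gap_eq_zero hsm le_rfl hmt
    have d2 := F.gap_mul_gap_eq_zero' hsm le_rfl hmt
    have b1 : F.gap s m * B = 0 := by
      rw [← hB, cut, ← mul_assoc, ← mul_assoc, d1, zero_mul, zero_mul]
    have b2 : B * F.gap s m = 0 := by rw [← hB, cut, mul_assoc, d2, mul_zero]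
    rw [sub_mul, one_mul, b1, sub_zero, mul_sub, mul_one, b2, sub_zero]
  have := norm_mul_mul_add_le hP.isSelfAdjoint h1.isSelfAdjoint (by rw [e1, e2]; abel)
    ((norm_nonneg _).trans hAC) hAC hBC
  rwa [hA', hB'] at this

/-- The approximations to the Volterra operator: the entries of `G` above the diagonal, off the
diagonal blocks of the `n`-th dyadic subdivision of `(s,t)`. -/
noncomputable def volterraApprox : ℕ → ℝ → ℝ → H →L[ℂ] H
  | 0, _, _ => 0
  | n + 1, s, t => volterraApprox n s ((s + t) / 2) +
      F.gap s ((s + t) / 2) * F.G * F.gap ((s + t) / 2) t + volterraApprox n ((s + t) / 2) t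

theorem volterraApprox_succ (n : ℕ) (s t : ℝ) : F.volterraApprox (n + 1) s t =
    F.volterraApprox n s ((s + t) / 2) + F.gap s ((s + t) / 2) * F.G * F.gap ((s + t) / 2) t +
      F.volterraApprox n ((s + t) / 2) t := rfl

variable {F}

theorem gap_mul_mul_gap_mem_alg {s m m' t : ℝ} (h1 : s ≤ m) (h2 : m ≤ m') (h3 : m' ≤ t)
    (K : H →L[ℂ] H) : F.gap s m * K * F.gap m' t ∈ F.alg := fun r => by
  rcases le_total r m' with h | h
  · have : F.gap m' t * F.E r = 0 := by
      rw [gap, sub_mul, F.mul_of_ge (h.trans h3), F.mul_of_ge h, sub_self]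
    rw [mul_assoc, mul_assoc _ (F.gap m' t), this, mul_zero, mul_zero]
  · have : F.E r * F.gap s m = F.gap s m := by
      rw [gap, mul_sub, F.mul_of_ge (h2.trans h), F.mul_of_ge ((h1.trans h2).trans h)]
    rw [← mul_assoc, ← mul_assoc, this]

theorem volterraApprox_mem_alg (n : ℕ) : ∀ {s t : ℝ}, s ≤ t → F.volterraApprox n s t ∈ F.alg := by
  induction n with
  | zero => exact fun _ => F.alg.zero_mem
  | succ n ih =>
    intro s t h
    exact F.alg.add_mem (F.alg.add_mem (ih (by linarith)) (gap_mul_mul_gap_mem_alg (by linarith)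
      le_rfl (by linarith) _)) (ih (by linarith))

theorem isCompactOperator_volterraApprox (n : ℕ) :
    ∀ s t : ℝ, IsCompactOperator (F.volterraApprox n s t) := by
  induction n with
  | zero => exact fun _ _ => isCompactOperator_zero
  | succ n ih =>
    intro s t
    exact ((ih _ _).add ((F.isCompactOperator_G.mul_left _).mul_right _)).add (ih _ _)

theorem cut_volterraApprox (n : ℕ) :
    ∀ {s t : ℝ}, s ≤ t → F.cut s t (F.volterraApprox n s t) = F.volterraApprox n s t := by
  induction n with
  | zero => exact fun _ => F.cut_zero _ _
  | succ n ih =>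
    intro s t h
    have h1 : s ≤ (s + t) / 2 := by linarith
    have h2 : (s + t) / 2 ≤ t := by linarith
    rw [volterraApprox, cut_add, cut_add]
    congr 1
    · congr 1
      · rw [← ih h1, F.cut_cut' le_rfl h1 h2]
      · rw [cut, mul_assoc, mul_assoc, mul_assoc, F.gap_mul_gap h1 h2 le_rfl, ← mul_assoc,
          F.gap_mul_gap' le_rfl h1 h2, mul_assoc]
    · rw [← ih h2, F.cut_cut' h1 h2 le_rfl]

/-- Two successive approximations differ by an operator that is block diagonal for the `n`-th dyadic
subdivision, so that its norm is at most that of a block of `G`. -/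
theorem norm_volterraApprox_succ_sub (n : ℕ) : ∀ {s t : ℝ}, s ≤ t →
    ‖F.volterraApprox (n + 1) s t - F.volterraApprox n s t‖ ≤ (t - s) * (1 / 2) ^ n := by
  induction n with
  | zero =>
    intro s t h
    have h1 : s ≤ (s + t) / 2 := by linarith
    have h2 : (s + t) / 2 ≤ t := by linarith
    have e : F.gap s ((s + t) / 2) * F.G * F.gap ((s + t) / 2) t =
        F.gap s ((s + t) / 2) * F.cut s t F.G * F.gap ((s + t) / 2) t := by
      rw [cut, ← mul_assoc, ← mul_assoc, F.gap_mul_gap le_rfl h1 h2, mul_assoc _ (F.gap s t),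
        F.gap_mul_gap' h1 h2 le_rfl]
    simp only [volterraApprox, zero_add, add_zero, sub_zero, pow_zero, mul_one]
    rw [e]
    refine (norm_mul_le _ _).trans ((mul_le_of_le_one_right (norm_nonneg _)
      (F.norm_gap_le h2)).trans ((norm_mul_le _ _).trans ((mul_le_of_le_one_left (norm_nonneg _)
      (F.norm_gap_le h1)).trans (F.norm_G_le h))))
  | succ n ih =>
    intro s t h
    have h1 : s ≤ (s + t) / 2 := by linarith
    have h2 : (s + t) / 2 ≤ t := by linarith
    have e : F.volterraApprox (n + 1 + 1) s t - F.volterraApprox (n + 1) s t =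
        (F.volterraApprox (n + 1) s ((s + t) / 2) - F.volterraApprox n s ((s + t) / 2)) +
        (F.volterraApprox (n + 1) ((s + t) / 2) t - F.volterraApprox n ((s + t) / 2) t) := by
      rw [volterraApprox_succ, volterraApprox_succ F n s t]
      abel
    rw [e]
    refine F.norm_add_le_of_cut_eq h1 h2 ?_ ?_ ?_ ?_
    · rw [cut_sub, cut_volterraApprox _ h1, cut_volterraApprox _ h1]
    · rw [cut_sub, cut_volterraApprox _ h2, cut_volterraApprox _ h2]
    · refine (ih h1).trans (le_of_eq ?_)
      rw [pow_succ]
      ring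
    · refine (ih h2).trans (le_of_eq ?_)
      rw [pow_succ]
      ring

/-- The approximations to the Volterra operator and their adjoints add up to `G` apart from the
diagonal blocks, which are small because `G` is Lipschitz along the family. -/
theorem norm_volterraApprox_add_star_sub (n : ℕ) : ∀ {s t : ℝ}, s ≤ t →
    ‖F.volterraApprox n s t + star (F.volterraApprox n s t) - F.cut s t F.G‖
      ≤ (t - s) * (1 / 2) ^ n := by
  induction n with
  | zero =>
    intro s t h
    simp only [volterraApprox, star_zero, add_zero, zero_sub, norm_neg, pow_zero, mul_one]
    exact F.norm_G_le h
  | succ n ih =>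
    intro s t h
    have h1 : s ≤ (s + t) / 2 := by linarith
    have h2 : (s + t) / 2 ≤ t := by linarith
    have e : F.volterraApprox (n + 1) s t + star (F.volterraApprox (n + 1) s t) - F.cut s t F.G =
        (F.volterraApprox n s ((s + t) / 2) + star (F.volterraApprox n s ((s + t) / 2)) -
          F.cut s ((s + t) / 2) F.G) +
        (F.volterraApprox n ((s + t) / 2) t + star (F.volterraApprox n ((s + t) / 2) t) -
          F.cut ((s + t) / 2) t F.G) := by
      rw [volterraApprox, cut, ← F.gap_add_gap s ((s + t) / 2) t]
      simp only [cut, star_add, star_mul, star_gap, F.isSelfAdjoint_G.star_eq, mul_add, add_mul,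
        mul_assoc]
      abel
    rw [e]
    refine F.norm_add_le_of_cut_eq h1 h2 ?_ ?_ ?_ ?_
    · rw [cut_sub, cut_add, ← star_cut, cut_volterraApprox _ h1, F.cut_cut le_rfl h1 le_rfl]
    · rw [cut_sub, cut_add, ← star_cut, cut_volterraApprox _ h2, F.cut_cut le_rfl h2 le_rfl]
    · refine (ih h1).trans (le_of_eq ?_)
      rw [pow_succ]
      ring
    · refine (ih h2).trans (le_of_eq ?_)
      rw [pow_succ]
      ring

variable (F) in
theorem continuous_cut (s t : ℝ) : Continuous (F.cut s t) :=
  (continuous_const.mul continuous_id).mul continuous_const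

/-- The Volterra operator: a compact upper triangular operator whose real part is `G / 2`. Since
the family has no atoms, the triangular truncation of `G` has no diagonal to account for. -/
theorem exists_volterra {s t : ℝ} (h : s ≤ t) :
    ∃ V ∈ F.alg, F.cut s t V = V ∧ IsCompactOperator V ∧ V + star V = F.cut s t F.G := by
  have hcau : CauchySeq fun n => F.volterraApprox n s t := by
    refine cauchySeq_of_le_geometric (1 / 2) (t - s) (by norm_num) fun n => ?_
    rw [dist_comm, dist_eq_norm]
    exact norm_volterraApprox_succ_sub n h
  obtain ⟨V, hV⟩ := cauchySeq_tendsto_of_complete hcau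
  refine ⟨V, fun r => ?_, ?_, ?_, ?_⟩
  · refine tendsto_nhds_unique ((hV.const_mul (F.E r)).mul_const (F.E r)) ?_
    refine (hV.mul_const (F.E r)).congr fun n => ?_
    exact (volterraApprox_mem_alg n h r).symm
  · refine tendsto_nhds_unique (((F.continuous_cut s t).tendsto V).comp hV) ?_
    exact hV.congr fun n => (cut_volterraApprox n h).symm
  · exact isCompactOperator_of_tendsto hV
      (Eventually.of_forall fun n => isCompactOperator_volterraApprox n s t)
  · have h1 : Tendsto (fun n => F.volterraApprox n s t + star (F.volterraApprox n s t)) atTop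
        (𝓝 (V + star V)) := hV.add ((continuous_star.tendsto V).comp hV)
    refine tendsto_nhds_unique h1 (tendsto_iff_norm_sub_tendsto_zero.2 ?_)
    have h2 : Tendsto (fun n : ℕ => (t - s) * (1 / 2 : ℝ) ^ n) atTop (𝓝 0) := by
      simpa using (tendsto_pow_atTop_nhds_zero_of_lt_one (by norm_num : (0 : ℝ) ≤ 1 / 2)
        (by norm_num)).const_mul (t - s)
    exact squeeze_zero (fun n => norm_nonneg _)
      (fun n => norm_volterraApprox_add_star_sub n h) h2

/-- Upper triangular contractions that are compact perturbations of the projection `F.gap s t` and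
tend to `0` strongly. They are the resolvents `(1 + n V)⁻¹` of the Volterra operator `V`, which are
contractions because the real part of `V` is positive. -/
theorem exists_contractions_tendsto_zero {s t : ℝ} (hst : s ≤ t) :
    ∃ v : ℕ → H →L[ℂ] H, (∀ n, v n ∈ F.alg ∧ F.gap s t * v n = v n ∧ v n * F.gap s t = v n ∧
      ‖v n‖ ≤ 1 ∧ IsCompactOperator (F.gap s t - v n)) ∧
      ∀ x, Tendsto (fun n => v n x) atTop (𝓝 0) := by
  obtain ⟨V, hV, hcut, hVc, hVG⟩ := F.exists_volterra hst
  set D := F.gap s t with hD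
  have hDD : D * D = D := F.gap_mul_self hst
  have hDV : D * V = V := by rw [← hcut, cut, ← hD, ← mul_assoc, ← mul_assoc, hDD]
  have hVD : V * D = V := by rw [← hcut, cut, ← hD, mul_assoc, hDD]
  have hre : ∀ x, 2 * RCLike.re ⟪V x, x⟫_ℂ = RCLike.re ⟪F.G (D x), D x⟫_ℂ := fun x => by
    have e1 : RCLike.re ⟪(V + star V) x, x⟫_ℂ = 2 * RCLike.re ⟪V x, x⟫_ℂ := by
      rw [add_apply, inner_add_left, ContinuousLinearMap.star_eq_adjoint,
        ContinuousLinearMap.adjoint_inner_left, map_add, ← inner_conj_symm x (V x), RCLike.conj_re]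
      ring
    rw [← e1, hVG, cut, ← hD, mul_assoc, mul_apply_eq_comp, F.inner_gap_left, mul_apply_eq_comp]
  have hacc : ∀ x, 0 ≤ RCLike.re ⟪V x, x⟫_ℂ := fun x => by
    have := hre x
    rcases eq_or_ne (D x) 0 with h | h
    · rw [h] at this
      simp only [map_zero, inner_zero_left] at this
      linarith
    · linarith [F.pos_G _ h]
  let S : ℕ → H →L[ℂ] H := fun n => 1 + (n : ℂ) • V
  have hS : ∀ n x, ‖x‖ ^ 2 ≤ RCLike.re ⟪S n x, x⟫_ℂ := fun n x => by
    have e : RCLike.re ⟪S n x, x⟫_ℂ = ‖x‖ ^ 2 + n * RCLike.re ⟪V x, x⟫_ℂ := by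
      simp only [S, add_apply, inner_add_left, one_apply_eq_self, smul_apply, inner_smul_left,
        map_add, inner_self_eq_norm_sq, map_natCast]
      congr 1
      exact RCLike.re_ofReal_mul (K := ℂ) n _
    rw [e]
    have := hacc x
    have : 0 ≤ (n : ℝ) * RCLike.re ⟪V x, x⟫_ℂ := by positivity
    linarith
  have hunit : ∀ n, IsUnit (S n) := fun n =>
    ContinuousLinearMap.isUnit_of_forall_le_norm_inner_map _ (c := 1) one_pos fun x => by
      rw [NNReal.coe_one, mul_one]
      exact (hS n x).trans (RCLike.re_le_norm _)
  choose U hU using hunit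
  let B : ℕ → H →L[ℂ] H := fun n => ((U n)⁻¹ : (H →L[ℂ] H)ˣ)
  have hSB : ∀ n, S n * B n = 1 := fun n => by rw [← hU n]; exact (U n).mul_inv
  have hBS : ∀ n, B n * S n = 1 := fun n => by rw [← hU n]; exact (U n).inv_mul
  have hSBx : ∀ n x, S n (B n x) = x := fun n x => by rw [← mul_apply_eq_comp, hSB]; rfl
  have hBx : ∀ n x, ‖B n x‖ ≤ ‖x‖ := fun n x => by
    have h1 := hS n (B n x)
    rw [hSBx] at h1
    have h2 := (RCLike.re_le_norm (K := ℂ) _).trans (norm_inner_le_norm (𝕜 := ℂ) x (B n x))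
    rcases (norm_nonneg (B n x)).eq_or_lt with h3 | h3
    · rw [← h3]; exact norm_nonneg _
    · nlinarith
  have hSD : ∀ n, S n * D = D * S n := fun n => by
    simp only [S, add_mul, mul_add, one_mul, mul_one, smul_mul_assoc, mul_smul_comm, hDV, hVD]
  have hBD : ∀ n, B n * D = D * B n := fun n => by
    calc B n * D = B n * D * (S n * B n) := by rw [hSB, mul_one]
      _ = B n * (D * S n) * B n := by simp only [mul_assoc]
      _ = (B n * S n) * D * B n := by rw [← hSD]; simp only [mul_assoc]
      _ = D * B n := by rw [hBS, one_mul]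
  -- For `y` in the range of `E r`, the component `w` of `(1 + n V)⁻¹ y` outside that range
  -- satisfies `w + n (1 - E r) V w = 0`, so that it vanishes because `V` is accretive.
  have hBalg : ∀ n, B n ∈ F.alg := fun n r => by
    have hEV : (1 - F.E r) * V = (1 - F.E r) * V * (1 - F.E r) := by
      have := hV r
      simp only [mul_sub, mul_one, sub_mul, one_mul, this, sub_self, sub_zero]
    have hP := (F.isStarProjection r).one_sub
    have hzero : (1 - F.E r) * B n * F.E r = 0 := by
      ext x
      set z := B n (F.E r x) with hz
      set w := (1 - F.E r) z with hw
      change w = 0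
      have h1 : (1 - F.E r) (S n z) = 0 := by
        rw [hz, hSBx, ← mul_apply_eq_comp, sub_mul, one_mul, F.E_mul_self, sub_self]
        rfl
      have h2 : w + (n : ℂ) • (1 - F.E r) (V w) = 0 := by
        rw [← h1]
        have : (1 - F.E r) (V w) = (1 - F.E r) (V z) := by
          have := congrArg (fun T : H →L[ℂ] H => T z) hEV
          exact this.symm
        rw [this, ← map_smul, hw, ← map_add]
        rfl
      have h3 : ⟪(1 - F.E r) (V w), w⟫_ℂ = ⟪V w, w⟫_ℂ := by
        rw [← ContinuousLinearMap.adjoint_inner_right, ← ContinuousLinearMap.star_eq_adjoint,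
          hP.isSelfAdjoint.star_eq, hw, ← mul_apply_eq_comp (1 - F.E r) (1 - F.E r),
          hP.isIdempotentElem.eq]
      have h4 : RCLike.re ⟪w + (n : ℂ) • (1 - F.E r) (V w), w⟫_ℂ =
          ‖w‖ ^ 2 + n * RCLike.re ⟪V w, w⟫_ℂ := by
        simp only [inner_add_left, inner_smul_left, h3, map_add, inner_self_eq_norm_sq,
          map_natCast]
        congr 1
        exact RCLike.re_ofReal_mul (K := ℂ) n _
      rw [h2, inner_zero_left, map_zero] at h4
      have h5 := hacc w
      have : 0 ≤ (n : ℝ) * RCLike.re ⟪V w, w⟫_ℂ := by positivity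
      have : ‖w‖ ^ 2 = 0 := le_antisymm (by linarith) (sq_nonneg _)
      exact norm_eq_zero.1 (pow_eq_zero_iff two_ne_zero |>.1 this)
    rw [sub_mul, one_mul, sub_mul, sub_eq_zero] at hzero
    exact hzero.symm
  refine ⟨fun n => D * B n, fun n => ⟨F.alg.mul_mem (gap_mem_alg s t) (hBalg n), ?_, ?_, ?_, ?_⟩,
    fun x => ?_⟩
  · rw [← mul_assoc, hDD]
  · rw [mul_assoc, hBD, ← mul_assoc, hDD]
  · refine ContinuousLinearMap.opNorm_le_bound _ zero_le_one fun x => ?_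
    rw [one_mul]
    exact (F.norm_gap_apply_le hst _).trans (hBx n x)
  · have e : D - D * B n = (n : ℂ) • (V * B n) := by
      calc D - D * B n = D * (S n * B n) - D * B n := by rw [hSB, mul_one]
        _ = _ := by
          simp only [S, add_mul, mul_add, one_mul, smul_mul_assoc, mul_smul_comm]
          rw [← mul_assoc, hDV]
          abel
    rw [e]
    exact (hVc.mul_right (B n)).smul (n : ℂ)
  -- `V` has dense range in the range of `D`, because its real part is injective there, and
  -- `n B n V = 1 - B n` is bounded by `2`.
  · have hrange : D x ∈ (LinearMap.range (V : H →ₗ[ℂ] H)).topologicalClosure := by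
      rw [← Submodule.orthogonal_orthogonal_eq_closure, Submodule.mem_orthogonal]
      intro w hw
      have h1 : ⟪V w, w⟫_ℂ = 0 := (Submodule.mem_orthogonal _ _).1 hw _ ⟨w, rfl⟩
      have h2 : D w = 0 := by
        by_contra hne
        have := hre w
        rw [h1, map_zero, mul_zero] at this
        exact (F.pos_G _ hne).ne this
      rw [← F.inner_gap_left, h2, inner_zero_left]
    rw [Metric.tendsto_atTop]
    intro ε hε
    obtain ⟨_, ⟨z, rfl⟩, hz⟩ := Metric.mem_closure_iff.1 hrange (ε / 2) (half_pos hε)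
    obtain ⟨N, hN⟩ := exists_nat_gt (2 * ‖z‖ / (ε / 2))
    refine ⟨N, fun k hk => ?_⟩
    have hk' : 2 * ‖z‖ / (ε / 2) < k := hN.trans_le (by exact_mod_cast hk)
    have hkpos : (0 : ℝ) < k := lt_of_le_of_lt (by positivity) hk'
    rw [div_lt_iff₀ (half_pos hε)] at hk'
    have h1 : (k : ℂ) • B k (V z) = z - B k z := by
      have := congrArg (fun T : H →L[ℂ] H => T z) (hBS k)
      simp only [S, mul_add, mul_one, mul_smul_comm, add_apply, smul_apply, mul_apply_eq_comp,
        one_apply_eq_self] at this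
      exact eq_sub_of_add_eq' this
    have h2 : k * ‖B k (V z)‖ ≤ 2 * ‖z‖ := by
      have := congrArg norm h1
      rw [norm_smul, Complex.norm_natCast] at this
      rw [this]
      refine (norm_sub_le _ _).trans ?_
      linarith [hBx k z]
    have h3 : ‖B k (V z)‖ < ε / 2 := by
      by_contra hc
      nlinarith
    rw [dist_zero_right]
    change ‖(D * B k) x‖ < ε
    rw [← hBD, mul_apply_eq_comp]
    have h4 : B k (D x) = B k (D x - V z) + B k (V z) := by rw [← map_add, sub_add_cancel]
    rw [h4]
    refine (norm_add_le _ _).trans_lt ?_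
    have h5 := hBx k (D x - V z)
    have h6 : ‖D x - V z‖ < ε / 2 := by
      rw [← dist_eq_norm]
      exact hz
    linarith

end SpectralFamily

/-! ### Coherent sequences and essential seminorms -/

/-- Dependent choice along the natural numbers. -/
theorem exists_seq_of_step {α : Type*} {P : ℕ → α → Prop} {R : ℕ → α → α → Prop}
    (h0 : ∃ x, P 0 x) (hs : ∀ n x, P n x → ∃ y, P (n + 1) y ∧ R n x y) :
    ∃ f : ℕ → α, ∀ n, P n (f n) ∧ R n (f n) (f (n + 1)) := by
  choose! g hg using hs
  obtain ⟨x₀, hx₀⟩ := h0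
  let f : ℕ → α := fun n => Nat.rec x₀ (fun n x => g n x) n
  have hf : ∀ n, P n (f n) := fun n => by
    induction n with
    | zero => exact hx₀
    | succ n ih => exact (hg n _ ih).1
  exact ⟨f, fun n => ⟨hf n, (hg n _ (hf n)).2⟩⟩

namespace SpectralFamily

variable {H : Type*} [NormedAddCommGroup H] [InnerProductSpace ℂ H] [CompleteSpace H]
  {F : SpectralFamily H}

/-- A coherent bounded sequence of operators on the intervals `(u n, t)`, each of which is cut out
of the next one from the left, comes from one operator on the union of the intervals. -/
theorem exists_of_coherent_rows {u : ℕ → ℝ} {p t a : ℝ} (ha : 0 ≤ a) (hu : ∀ n, u (n + 1) ≤ u n)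
    (hpu : ∀ n, p ≤ u n) (hut : ∀ n, u n ≤ t) {T : ℕ → H →L[ℂ] H} (hT : ∀ n, T n ∈ F.alg)
    (hcut : ∀ n, F.cut (u n) t (T n) = T n) (hco : ∀ n, F.gap (u n) t * T (n + 1) = T n)
    (hn : ∀ n, ‖T n‖ ≤ a) :
    ∃ Z ∈ F.alg, ‖Z‖ ≤ a ∧ F.cut p t Z = Z ∧ ∀ n, F.gap (u n) t * Z = T n := by
  have hanti : Antitone u := antitone_nat_of_succ_le hu
  have hgT : ∀ k n, k ≤ n → F.gap (u k) t * T n = T k := by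
    intro k n hkn
    induction n, hkn using Nat.le_induction with
    | base => rw [← hcut k, cut, ← mul_assoc, ← mul_assoc, F.gap_mul_self (hut k)]
    | succ n hkn ih =>
      rw [← F.gap_mul_gap (hanti hkn) (hut k) le_rfl, mul_assoc, hco, ih]
  -- The differences of successive terms have mutually orthogonal ranges.
  let Z : ℕ → H →L[ℂ] H := fun n => Nat.casesOn n (T 0) fun k => T (k + 1) - T k
  have hZs : ∀ k, Z (k + 1) = T (k + 1) - T k := fun k => rfl
  have hZ1 : ∀ n, F.gap (u n) t * Z n = Z n := by
    intro n
    cases n with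
    | zero => exact hgT 0 0 le_rfl
    | succ k =>
      rw [hZs, mul_sub, hgT _ _ le_rfl, ← hcut k, cut, ← mul_assoc, ← mul_assoc,
        F.gap_mul_gap' (hu k) (hut k) le_rfl]
  have hZ2 : ∀ i j, i < j → F.gap (u i) t * Z j = 0 := by
    intro i j hij
    obtain ⟨k, rfl⟩ : ∃ k, j = k + 1 := ⟨j - 1, by omega⟩
    rw [hZs, mul_sub, hgT _ _ (by omega), hgT _ _ (by omega), sub_self]
  have horth' : ∀ i j, i < j → ∀ x y, ⟪Z i x, Z j y⟫_ℂ = 0 := by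
    intro i j hij x y
    rw [← hZ1 i, mul_apply_eq_comp, F.inner_gap_left, ← mul_apply_eq_comp, hZ2 i j hij]
    simp
  have horth : ∀ i j, i ≠ j → ∀ x y, ⟪Z i x, Z j y⟫_ℂ = 0 := by
    intro i j hij x y
    rcases lt_or_gt_of_ne hij with h | h
    · exact horth' i j h x y
    · rw [← inner_conj_symm, horth' j i h, map_zero]
  have hsum : ∀ n x, ∑ i ∈ Finset.range (n + 1), Z i x = T n x := by
    intro n x
    induction n with
    | zero => simp [Z]
    | succ n ih => rw [Finset.sum_range_succ, ih, hZs, sub_apply]; abel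
  have hsq : ∀ n x, ∑ i ∈ Finset.range (n + 1), ‖Z i x‖ ^ 2 = ‖T n x‖ ^ 2 := by
    intro n x
    induction n with
    | zero => simp [Z]
    | succ n ih =>
      rw [Finset.sum_range_succ, ih, ← hsum (n + 1), Finset.sum_range_succ, hsum, sq, sq, sq]
      refine (norm_add_sq_eq_norm_sq_add_norm_sq_of_inner_eq_zero (𝕜 := ℂ) _ _ ?_).symm
      rw [← hsum n, sum_inner]
      exact Finset.sum_eq_zero fun i hi => horth _ _ (Finset.mem_range.1 hi).ne x x
  obtain ⟨S, hS, hSs⟩ := exists_hasSum_of_orthogonal_ranges ha horth fun s x => by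
    obtain ⟨n, hn'⟩ := s.exists_nat_subset_range
    calc _ ≤ ∑ i ∈ Finset.range (n + 1), ‖Z i x‖ ^ 2 :=
          Finset.sum_le_sum_of_subset_of_nonneg
            (hn'.trans (Finset.range_mono (Nat.le_succ n))) fun _ _ _ => sq_nonneg _
      _ = ‖T n x‖ ^ 2 := hsq n x
      _ ≤ (a * ‖x‖) ^ 2 := pow_le_pow_left₀ (norm_nonneg _) ((T n).le_of_opNorm_le (hn n) x) 2
      _ = a ^ 2 * ‖x‖ ^ 2 := mul_pow _ _ _
  have hlim : ∀ x, Tendsto (fun n => T n x) atTop (𝓝 (S x)) := fun x => by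
    have := ((hSs x).tendsto_sum_nat).comp (tendsto_add_atTop_nat 1)
    exact this.congr fun n => hsum n x
  have hlim2 : ∀ (A B : H →L[ℂ] H) x, Tendsto (fun n => (A * T n * B) x) atTop
      (𝓝 ((A * S * B) x)) := fun A B x => (A.continuous.tendsto _).comp (hlim (B x))
  refine ⟨S, fun r => ?_, hS, ?_, fun n => ?_⟩
  · ext x
    refine tendsto_nhds_unique (hlim2 (F.E r) (F.E r) x) ?_
    refine (hlim (F.E r x)).congr fun n => ?_
    rw [hT n r]
    rfl
  · ext x
    refine tendsto_nhds_unique (hlim2 _ _ x) ((hlim x).congr fun n => ?_)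
    have := F.cut_cut' (hpu n) (hut n) le_rfl (T n)
    rw [hcut] at this
    exact congrArg (fun A : H →L[ℂ] H => A x) this.symm
  · ext x
    refine tendsto_nhds_unique (f := fun k => (F.gap (u n) t * T k) x)
      (((F.gap (u n) t).continuous.tendsto _).comp (hlim x)) ?_
    refine tendsto_const_nhds.congr' ?_
    filter_upwards [eventually_ge_atTop n] with k hk
    rw [hgT n k hk]

/-- An operator whose rows in `(s,t)` are those of an operator that lives on `(s,t)` is cut off to
the latter. -/
theorem cut_eq_of_gap_mul {Z T : H →L[ℂ] H} {s t : ℝ} (h : F.gap s t * Z = T)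
    (hT : F.cut s t T = T) (hst : s ≤ t) : F.cut s t Z = T := by
  rw [cut, h, ← hT, cut, mul_assoc, F.gap_mul_self hst]

/-- A sequence that decreases strictly from `t` to `p`. -/
theorem exists_seq_decreasing_to {p t : ℝ} (hpt : p < t) :
    ∃ u : ℕ → ℝ, u 0 = t ∧ (∀ n, u (n + 1) < u n) ∧ (∀ n, p < u n) ∧ (∀ n, u n ≤ t) ∧
      ∀ r, p < r → ∃ n, u n < r := by
  have hd : 0 < t - p := sub_pos.2 hpt
  refine ⟨fun n => p + (t - p) * (1 / ((n : ℝ) + 1)), by simp, fun n => ?_, fun n => ?_,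
    fun n => ?_, fun r hr => ?_⟩
  · have : 1 / (((n + 1 : ℕ) : ℝ) + 1) < 1 / ((n : ℝ) + 1) :=
      one_div_lt_one_div_of_lt (by positivity) (by push_cast; linarith)
    have := mul_lt_mul_of_pos_left this hd
    linarith
  · have : 0 < (t - p) * (1 / ((n : ℝ) + 1)) := by positivity
    linarith
  · have : 1 / ((n : ℝ) + 1) ≤ 1 := by
      rw [div_le_one (by positivity)]
      have : (0 : ℝ) ≤ n := n.cast_nonneg
      linarith
    have := mul_le_mul_of_nonneg_left this hd.le
    linarith
  · have h0 := (tendsto_one_div_add_atTop_nhds_zero_nat (𝕜 := ℝ)).const_mul (t - p)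
    have h1 := h0.const_add p
    rw [mul_zero, add_zero] at h1
    exact (h1.eventually_lt_const hr).exists

/-- A local copy up to an endpoint at which nothing is required, obtained by gluing infinitely many
local copies. -/
theorem exists_isLocalCopy_left_free {X : H →L[ℂ] H} (hX : X ∈ F.alg) {a p t : ℝ} (hpt : p < t)
    (h : ∀ r ∈ Set.Ioc p t, F.JLt X r a) : ∃ Z, F.IsLocalCopy X a p t Z := by
  obtain ⟨u, hu0, hu, hpu, hut, hlim⟩ := exists_seq_decreasing_to hpt
  have hu1 : ∀ n, u (n + 1) < t := fun n => (hu n).trans_le (hut n)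
  have hloc : ∀ n t', u n < t' → t' ≤ t → ∃ Z, F.IsLocalCopy X a (u n) t' Z := fun n t' h1 h2 =>
    exists_isLocalCopy hX h1 fun r hr => h r ⟨(hpu n).trans_le hr.1, hr.2.trans h2⟩
  obtain ⟨Z, hZ⟩ := exists_seq_of_step (P := fun n Z => F.IsLocalCopy X a (u (n + 2)) t Z)
    (R := fun n Z Z' => F.cut (u (n + 1)) t Z' = F.cut (u (n + 1)) t Z)
    (hloc _ _ (hu1 _) le_rfl) fun n Z hZ => by
      obtain ⟨W, hW⟩ := hloc (n + 3) (u (n + 1)) ((hu _).trans (hu _)) (hut _)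
      obtain ⟨Z', hZ', -, h3⟩ := hW.glue hZ (hu _) (hu _) (hu1 _)
      exact ⟨Z', hZ', h3⟩
  have ha : 0 ≤ a := (norm_nonneg _).trans (hZ 0).1.norm_le
  have hco : ∀ n, F.gap (u (n + 1)) t * F.cut (u (n + 1 + 1)) t (Z (n + 1)) =
      F.cut (u (n + 1)) t (Z n) := fun n => by
    have h1 := gap_mul_mul_gap_eq_zero (hZ (n + 1)).1.mem_alg (hu (n + 1)).le le_rfl (hut (n + 1))
    rw [cut, ← mul_assoc, ← mul_assoc, F.gap_mul_gap (hu _).le (hut _) le_rfl,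
      ← F.gap_add_gap (u (n + 1 + 1)) (u (n + 1)) t, mul_add, h1, zero_add]
    exact (hZ n).2
  obtain ⟨Z', hZ'alg, hZ'n, hZ'cut, hZ'⟩ := F.exists_of_coherent_rows (u := fun n => u (n + 1))
    (p := p) (t := t) (T := fun n => F.cut (u (n + 1)) t (Z n)) ha (fun n => (hu _).le)
    (fun n => (hpu _).le) (fun n => hut _) (fun n => cut_mem_alg (hZ n).1.mem_alg _ _)
    (fun n => F.cut_cut le_rfl (hut _) le_rfl _) hco
    (fun n => (F.norm_cut_le (hut _) _).trans (hZ n).1.norm_le)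
  refine ⟨Z', hZ'alg, hZ'cut, hZ'n, fun r hr => ?_⟩
  obtain ⟨n, hn⟩ := hlim r hr.1
  have hn1 : u (n + 1) < r := (hu n).trans hn
  refine ((hZ n).1.jZero r ⟨(hu _).trans hn1, hr.2⟩).congr hn1 hr.2 ?_
  rw [cut_sub, cut_sub, cut_eq_of_gap_mul (hZ' n) (F.cut_cut le_rfl (hut _) le_rfl _) (hut _)]

/-- A local copy up to an endpoint at which `e⁺` is less than `a`; it differs from `X` near the
endpoint by an operator whose compressions away from the endpoint are compact. -/
theorem exists_isLocalCopy_of_eLt {X : H →L[ℂ] H} (hX : X ∈ F.alg) {a p : ℝ} (h : F.ELt X p a) :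
    ∃ t, p < t ∧ ∃ Z, F.IsLocalCopy X a p t Z ∧ F.EZero (X - Z) p := by
  obtain ⟨b, hba, t, hpt, hess⟩ := h
  obtain ⟨u, hu0, hu, hpu, hut, hlim⟩ := exists_seq_decreasing_to hpt
  have ha : 0 < a := ((essNorm_nonneg _).trans (hess _ (⟨hpu 1, (hu 0).trans_le (hut 0)⟩ :
    u 1 ∈ Set.Ioo p t))).trans_lt hba
  obtain ⟨Z, hZ⟩ := exists_seq_of_step
    (P := fun n (Z : H →L[ℂ] H) => Z ∈ F.alg ∧ F.cut (u n) t Z = Z ∧ ‖Z‖ < a ∧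
      IsCompactOperator (F.cut (u n) t X - Z))
    (R := fun n Z Z' => F.gap (u n) t * Z' = Z)
    ⟨0, F.alg.zero_mem, F.cut_zero _ _, by simpa using ha, by
      simpa [hu0, cut] using isCompactOperator_zero⟩ fun n Z ⟨hZalg, hZcut, hZn, hZc⟩ => by
      have hun1 : u (n + 1) < t := (hu n).trans_le (hut n)
      set D := F.gap (u (n + 1)) (u n) with hD
      set Q := F.gap (u n) t with hQ
      set Q' := F.gap (u (n + 1)) t with hQ'
      have hDQ : D + Q = Q' := F.gap_add_gap _ _ _
      have hQD : Q * D = 0 := F.gap_mul_gap_eq_zero' (hu n).le le_rfl (hut n)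
      have hDQ0 : D * Q = 0 := F.gap_mul_gap_eq_zero (hu n).le le_rfl (hut n)
      have hQQ : Q * Q = Q := F.gap_mul_self (hut n)
      have hQZ : Q * Z = Z := by rw [← hZcut, cut, ← mul_assoc, ← mul_assoc, hQQ]
      have hQ'Z : Q' * Z = Z := by
        rw [← hDQ, add_mul, hQZ, ← hQZ, ← mul_assoc, hDQ0, zero_mul, zero_add]
      have hZQ' : Z * Q' = Z := by
        rw [← hZcut, cut, mul_assoc, F.gap_mul_gap (hu n).le (hut n) le_rfl]
      have hQ'Q' : Q' * Q' = Q' := F.gap_mul_self (hut _)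
      have hQ'D : Q' * D = D := F.gap_mul_gap' le_rfl (hu n).le (hut n)
      obtain ⟨v, hv, hv0⟩ := F.exists_contractions_tendsto_zero (hu n).le
      rw [← hD] at hv
      -- `C` is the row that the compression to `(u (n + 1), t)` adds to the one to `(u n, t)`.
      set C := D * X * Q' with hC
      have hrow : F.cut (u (n + 1)) t X = C + F.cut (u n) t X := by
        have := gap_mul_mul_gap_eq_zero hX (hu n).le le_rfl (hut n)
        rw [← hD, ← hQ] at this
        rw [cut, cut, ← hQ', ← hQ, hC, ← hDQ]
        simp only [add_mul, mul_add, this]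
        abel
      obtain ⟨K, hK, hKa⟩ := essNorm_lt_iff.1 ((hess _ ⟨hpu (n + 1), hun1⟩).trans_lt hba)
      obtain ⟨k, hk⟩ := exists_norm_add_mul_lt (B := Z) (C := C)
        (K := K - (F.cut (u n) t X - Z)) (v := v) hZn (hK.sub hZc)
        (by
          refine lt_of_eq_of_lt (congrArg norm ?_) hKa
          rw [hrow]
          abel)
        (fun x y => by
          rw [← hQZ, mul_apply_eq_comp, F.inner_gap_left, hC, mul_assoc, mul_apply_eq_comp D,
            ← mul_apply_eq_comp Q D, hQD]
          simp)
        (fun n x y => by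
          rw [← hQZ, mul_apply_eq_comp, F.inner_gap_left, ← (hv n).2.1, mul_apply_eq_comp D,
            ← mul_apply_eq_comp Q D, hQD]
          simp)
        (fun n => (hv n).2.2.2.1) hv0
      obtain ⟨hvalg, hDv, hvD, -, hvc⟩ := hv k
      refine ⟨Z + v k * C, ⟨?_, ?_, hk, ?_⟩, ?_⟩
      · exact F.alg.add_mem hZalg (F.alg.mul_mem hvalg (F.alg.mul_mem (F.alg.mul_mem
          (gap_mem_alg _ _) hX) (gap_mem_alg _ _)))
      · have h1 : Q' * v k = v k := by rw [← hDv, ← mul_assoc, hQ'D]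
        have h2 : C * Q' = C := by rw [hC, mul_assoc, hQ'Q']
        rw [cut, ← hQ', mul_add, hQ'Z, add_mul, hZQ', ← mul_assoc, h1, mul_assoc, h2]
      · have e : F.cut (u (n + 1)) t X - (Z + v k * C) =
            (F.cut (u n) t X - Z) + (D - v k) * C := by
          have hDC : D * C = C := by
            rw [hC, ← mul_assoc, ← mul_assoc, F.gap_mul_self (hu n).le]
          rw [hrow, sub_mul, hDC]
          abel
        rw [e]
        exact hZc.add (hvc.mul_right C)
      · rw [mul_add, hQZ, ← hDv, mul_assoc D, ← mul_assoc Q, hQD, zero_mul, add_zero]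
  obtain ⟨Z', hZ'alg, hZ'n, hZ'cut, hZ'⟩ := F.exists_of_coherent_rows (u := u) (p := p) (t := t)
    (T := Z) ha.le (fun n => (hu n).le) (fun n => (hpu n).le) hut (fun n => (hZ n).1.1)
    (fun n => (hZ n).1.2.1) (fun n => (hZ n).2) (fun n => (hZ n).1.2.2.1.le)
  have hcomp : ∀ n, IsCompactOperator (F.cut (u n) t (X - Z')) := fun n => by
    rw [cut_sub, cut_eq_of_gap_mul (hZ' n) (hZ n).1.2.1 (hut n)]
    exact (hZ n).1.2.2.2
  refine ⟨t, hpt, Z', ⟨hZ'alg, hZ'cut, hZ'n, fun r hr => ?_⟩, fun ε hε =>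
    ⟨0, hε, t, hpt, fun l hl => ?_⟩⟩
  · obtain ⟨n, hn⟩ := hlim r hr.1
    exact (jZero_of_isCompactOperator (hcomp n) r).congr hn hr.2
      (F.cut_cut le_rfl (hut n) le_rfl _)
  · obtain ⟨n, hn⟩ := hlim l hl.1
    rw [← F.cut_cut hn.le hl.2.le le_rfl]
    exact (essNorm_eq_zero (((hcomp n).mul_left _).mul_right _)).le

end SpectralFamily

/-! ### Intervals and their orthogonal sums -/

/-- Every point of a bounded open set of real numbers lies in an interval that is contained in the
set while its endpoints are not. -/
theorem IsOpen.exists_component {U : Set ℝ} (hU : IsOpen U) (hb : BddBelow U) (ha : BddAbove U)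
    {t : ℝ} (ht : t ∈ U) :
    ∃ p q, p < t ∧ t < q ∧ Set.Ioo p q ⊆ U ∧ p ∉ U ∧ q ∉ U := by
  obtain ⟨b, hb⟩ := hb
  obtain ⟨c, hc⟩ := ha
  have hL : (Uᶜ ∩ Set.Iic t).Nonempty :=
    ⟨b - 1, fun h => by linarith [hb h], by have := hb ht; simp only [Set.mem_Iic]; linarith⟩
  have hR : (Uᶜ ∩ Set.Ici t).Nonempty :=
    ⟨c + 1, fun h => by linarith [hc h], by have := hc ht; simp only [Set.mem_Ici]; linarith⟩
  have hLb : BddAbove (Uᶜ ∩ Set.Iic t) := ⟨t, fun r hr => hr.2⟩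
  have hRb : BddBelow (Uᶜ ∩ Set.Ici t) := ⟨t, fun r hr => hr.2⟩
  obtain ⟨hp1, hp2⟩ := (hU.isClosed_compl.inter isClosed_Iic).csSup_mem hL hLb
  obtain ⟨hq1, hq2⟩ := (hU.isClosed_compl.inter isClosed_Ici).csInf_mem hR hRb
  refine ⟨_, _, lt_of_le_of_ne hp2 fun h => hp1 (by rw [h]; exact ht),
    lt_of_le_of_ne hq2 fun h => hq1 (by rw [← h]; exact ht), fun r hr => ?_, hp1, hq1⟩
  by_contra hrU
  rcases le_total r t with h | h
  · exact absurd (le_csSup hLb ⟨hrU, h⟩) (not_le.2 hr.1)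
  · exact absurd (csInf_le hRb ⟨hrU, h⟩) (not_le.2 hr.2)

namespace SpectralFamily

variable {H : Type*} [NormedAddCommGroup H] [InnerProductSpace ℂ H] [CompleteSpace H]
  (F : SpectralFamily H)

/-- To the right of the parameter `p`, the operator `Z` agrees with `X` in the sense of each of the
seminorms `i⁺` and `e⁺` that is less than `a` at `X`. -/
def AgreesRight (X Z : H →L[ℂ] H) (p a : ℝ) : Prop :=
  (F.ILt X p a → F.IZero (X - Z) p) ∧ (F.ELt X p a → F.EZero (X - Z) p)

variable {F}

theorem iZero_zero (t : ℝ) : F.IZero 0 t := fun ε hε => ⟨t + 1, by linarith, by simpa using hε⟩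

theorem eZero_zero (t : ℝ) : F.EZero 0 t := fun ε hε =>
  ⟨0, hε, t + 1, by linarith, fun l _ => by
    rw [cut_zero]
    exact (essNorm_eq_zero isCompactOperator_zero).le⟩

theorem IZero.congr {X Y : H →L[ℂ] H} {t m : ℝ} (hX : F.IZero X t) (hm : t < m)
    (h : F.cut t m X = F.cut t m Y) : F.IZero Y t := fun ε hε => (hX ε hε).congr hm h

theorem EZero.congr {X Y : H →L[ℂ] H} {t m : ℝ} (hX : F.EZero X t) (hm : t < m)
    (h : F.cut t m X = F.cut t m Y) : F.EZero Y t := fun ε hε => (hX ε hε).congr hm h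

theorem AgreesRight.congr {X Z Z' : H →L[ℂ] H} {p m a : ℝ} (h : F.AgreesRight X Z p a)
    (hm : p < m) (hZ : F.cut p m Z = F.cut p m Z') : F.AgreesRight X Z' p a := by
  have : F.cut p m (X - Z) = F.cut p m (X - Z') := by rw [cut_sub, cut_sub, hZ]
  exact ⟨fun hI => (h.1 hI).congr hm this, fun hE => (h.2 hE).congr hm this⟩

/-- At the left end of an interval on which the two-sided seminorms are less than `a`, there is a
local copy that also agrees with `X` at the endpoint as far as possible. -/
theorem exists_isLocalCopy_left {X : H →L[ℂ] H} (hX : X ∈ F.alg) {a p q : ℝ} (hpq : p < q)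
    (h : ∀ r ∈ Set.Ioo p q, F.JLt X r a) :
    ∃ m ∈ Set.Ioo p q, ∃ Z, F.IsLocalCopy X a p m Z ∧ F.AgreesRight X Z p a := by
  by_cases hI : F.ILt X p a
  · obtain ⟨m, hm, hma⟩ := hI
    have h1 : p < min m ((p + q) / 2) := lt_min hm (by linarith)
    refine ⟨min m ((p + q) / 2), ⟨h1, (min_le_right _ _).trans_lt (by linarith)⟩, _,
      isLocalCopy_cut hX h1.le ((F.norm_cut_le_cut le_rfl h1.le (min_le_left _ _) X).trans
        hma.le), ?_⟩
    have h2 : F.cut p (min m ((p + q) / 2)) 0 = F.cut p (min m ((p + q) / 2))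
        (X - F.cut p (min m ((p + q) / 2)) X) := by
      rw [cut_sub, F.cut_cut le_rfl h1.le le_rfl, sub_self, cut_zero]
    exact ⟨fun _ => (iZero_zero p).congr h1 h2, fun _ => (eZero_zero p).congr h1 h2⟩
  by_cases hE : F.ELt X p a
  · obtain ⟨m, hm, Z, hZ, hZE⟩ := exists_isLocalCopy_of_eLt hX hE
    have h1 : p < min m ((p + q) / 2) := lt_min hm (by linarith)
    have h2 : F.AgreesRight X Z p a := ⟨fun h => absurd h hI, fun _ => hZE⟩
    exact ⟨min m ((p + q) / 2), ⟨h1, (min_le_right _ _).trans_lt (by linarith)⟩, _,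
      hZ.mono le_rfl h1.le (min_le_left _ _), h2.congr h1 (F.cut_cut le_rfl h1.le le_rfl Z).symm⟩
  · obtain ⟨Z, hZ⟩ := exists_isLocalCopy_left_free hX (t := (p + q) / 2) (by linarith)
      fun r hr => h r ⟨hr.1, hr.2.trans_lt (by linarith)⟩
    exact ⟨(p + q) / 2, ⟨by linarith, by linarith⟩, Z, hZ, fun h => absurd h hI,
      fun h => absurd h hE⟩

theorem jLt_dual_star {X : H →L[ℂ] H} {r a : ℝ} :
    F.dual.JLt (star X) (-r) a ↔ F.JLt X r a := by
  constructor
  · rintro ⟨l, m, hl, hm, h⟩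
    refine ⟨-m, -l, by linarith, by linarith, ?_⟩
    rwa [dual_cut, ← star_cut, norm_star] at h
  · rintro ⟨l, m, hl, hm, h⟩
    refine ⟨-m, -l, by linarith, by linarith, ?_⟩
    rwa [dual_cut, ← star_cut, norm_star, neg_neg, neg_neg]

/-- Taking adjoints carries local copies for the dual family to local copies. -/
theorem isLocalCopy_of_dual {X Z : H →L[ℂ] H} {a s t : ℝ}
    (h : F.dual.IsLocalCopy (star X) a (-t) (-s) (star Z)) : F.IsLocalCopy X a s t Z := by
  refine ⟨mem_alg_of_star h.mem_alg, ?_, by simpa using h.norm_le, fun r hr => ?_⟩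
  · have := h.cut_eq
    rw [dual_cut, ← star_cut, neg_neg, neg_neg] at this
    exact star_injective this
  · have := h.jZero (-r) ⟨neg_lt_neg hr.2, neg_lt_neg hr.1⟩
    rw [← star_sub] at this
    exact fun ε hε => jLt_dual_star.1 (this ε hε)

/-- On an interval on which the two-sided seminorms are less than `a`, there is a local copy that
also agrees with `X` at both endpoints as far as possible. -/
theorem exists_isLocalCopy_component {X : H →L[ℂ] H} (hX : X ∈ F.alg) {a p q : ℝ} (hpq : p < q)
    (h : ∀ r ∈ Set.Ioo p q, F.JLt X r a) :
    ∃ Z, F.IsLocalCopy X a p q Z ∧ F.AgreesRight X Z p a ∧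
      F.dual.AgreesRight (star X) (star Z) (-q) a := by
  obtain ⟨m, hm, Z₁, hZ₁, hA₁⟩ := exists_isLocalCopy_left hX hpq h
  obtain ⟨m', hm', W, hW, hA₂⟩ := exists_isLocalCopy_left (F := F.dual) (star_mem_dual_alg hX)
    (neg_lt_neg hpq) fun r hr => by
      have := jLt_dual_star.2 (h (-r) ⟨by linarith [hr.2], by linarith [hr.1]⟩)
      rwa [neg_neg] at this
  obtain ⟨n, rfl⟩ : ∃ n, m' = -n := ⟨-m', (neg_neg _).symm⟩
  obtain ⟨Z₃, rfl⟩ : ∃ Z, W = star Z := ⟨star W, (star_star _).symm⟩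
  have hn : n ∈ Set.Ioo p q := ⟨neg_lt_neg_iff.1 hm'.2, neg_lt_neg_iff.1 hm'.1⟩
  have hZ₃ := isLocalCopy_of_dual hW
  obtain ⟨s, hs1, hs2⟩ := exists_between hm.1
  obtain ⟨t, ht1, ht2⟩ := exists_between (max_lt hm.2 hn.2)
  have hmt : m < t := (le_max_left _ _).trans_lt ht1
  have hnt : n < t := (le_max_right _ _).trans_lt ht1
  obtain ⟨Z₂, hZ₂⟩ := exists_isLocalCopy hX (hs2.trans hmt) fun r hr =>
    h r ⟨hs1.trans_le hr.1, hr.2.trans_lt ht2⟩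
  obtain ⟨Z₁₂, hZ₁₂, hl₁₂, -⟩ := hZ₁.glue hZ₂ hs1 hs2 hmt
  obtain ⟨Z, hZ, hl, hr⟩ := hZ₁₂.glue hZ₃ hn.1 hnt ht2
  refine ⟨Z, hZ, ?_, hA₂.congr (neg_lt_neg ht2) ?_⟩
  · have h1 : p < min s n := lt_min hs1 hn.1
    refine hA₁.congr h1 ?_
    rw [← F.cut_cut le_rfl h1.le (min_le_left s n), ← hl₁₂,
      F.cut_cut le_rfl h1.le (min_le_left s n), ← F.cut_cut le_rfl h1.le (min_le_right s n), ← hl,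
      F.cut_cut le_rfl h1.le (min_le_right s n)]
  · rw [dual_cut, dual_cut, neg_neg, neg_neg, ← star_cut, ← star_cut, hr]

/-- Bounded operators on disjoint intervals have an orthogonal sum. -/
theorem exists_block_sum {ι : Type*} {p q : ι → ℝ} {a : ℝ} (ha : 0 ≤ a) (hpq : ∀ i, p i < q i)
    (hdisj : ∀ i j, i ≠ j → q i ≤ p j ∨ q j ≤ p i) {Z : ι → H →L[ℂ] H} (hZ : ∀ i, Z i ∈ F.alg)
    (hcut : ∀ i, F.cut (p i) (q i) (Z i) = Z i) (hn : ∀ i, ‖Z i‖ ≤ a) :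
    ∃ T ∈ F.alg, ‖T‖ ≤ a ∧ ∀ i, F.cut (p i) (q i) T = Z i := by
  classical
  let P : ι → H →L[ℂ] H := fun i => F.gap (p i) (q i)
  have hPP : ∀ i, P i * P i = P i := fun i => F.gap_mul_self (hpq i).le
  have hPij : ∀ i j, i ≠ j → P i * P j = 0 := fun i j hij => by
    rcases hdisj i j hij with h | h
    · exact F.gap_mul_gap_eq_zero (hpq i).le h (hpq j).le
    · exact F.gap_mul_gap_eq_zero' (hpq j).le h (hpq i).le
  have hPZ : ∀ i, P i * Z i = Z i := fun i => by
    rw [← hcut i, cut, ← mul_assoc, ← mul_assoc, F.gap_mul_self (hpq i).le]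
  have hZP : ∀ i, Z i * P i = Z i := fun i => by
    rw [← hcut i, cut, mul_assoc, F.gap_mul_self (hpq i).le]
  have hbessel : ∀ (s : Finset ι) x, ∑ i ∈ s, ‖P i x‖ ^ 2 ≤ ‖x‖ ^ 2 := by
    intro s x
    have hS : IsStarProjection (∑ i ∈ s, P i) := by
      refine ⟨?_, ?_⟩
      · rw [IsIdempotentElem, Finset.sum_mul]
        refine Finset.sum_congr rfl fun i hi => ?_
        rw [Finset.mul_sum, Finset.sum_eq_single i (fun j _ hj => hPij i j hj.symm)
          (fun h => absurd hi h), hPP]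
      · rw [IsSelfAdjoint, star_sum]
        exact Finset.sum_congr rfl fun i _ => F.star_gap _ _
    have h1 : ∀ i, ‖P i x‖ ^ 2 = RCLike.re ⟪P i x, x⟫_ℂ := fun i => by
      rw [norm_sq_eq_re_inner_star_mul, F.star_gap, hPP]
    have h2 : ∑ i ∈ s, ‖P i x‖ ^ 2 = ‖(∑ i ∈ s, P i) x‖ ^ 2 := by
      rw [norm_sq_eq_re_inner_star_mul, hS.isSelfAdjoint.star_eq, hS.isIdempotentElem.eq,
        sum_apply, sum_inner, map_sum]
      exact Finset.sum_congr rfl fun i _ => h1 i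
    rw [h2]
    refine pow_le_pow_left₀ (norm_nonneg _) ?_ 2
    simpa using (∑ i ∈ s, P i).le_of_opNorm_le (IsStarProjection.norm_le _ hS) x
  obtain ⟨T, hT, hsum⟩ := exists_hasSum_of_orthogonal_ranges ha (Z := Z) (fun i j hij x y => by
      rw [← hPZ i, mul_apply_eq_comp, F.inner_gap_left, ← hPZ j, mul_apply_eq_comp,
        ← mul_apply_eq_comp (F.gap (p i) (q i))]
      change ⟪Z i x, (P i * P j) (Z j y)⟫_ℂ = 0
      rw [hPij i j hij]
      simp) fun s x => by
    calc _ ≤ ∑ i ∈ s, a ^ 2 * ‖P i x‖ ^ 2 := Finset.sum_le_sum fun i _ => by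
          rw [← mul_pow]
          refine pow_le_pow_left₀ (norm_nonneg _) ?_ 2
          have := (Z i).le_of_opNorm_le (hn i) (P i x)
          rwa [← mul_apply_eq_comp, hZP] at this
      _ ≤ _ := by
          rw [← Finset.mul_sum]
          exact mul_le_mul_of_nonneg_left (hbessel s x) (sq_nonneg _)
  have hsum2 : ∀ (A B : H →L[ℂ] H) x, HasSum (fun i => (A * Z i * B) x) ((A * T * B) x) :=
    fun A B x => (hsum (B x)).mapL A
  refine ⟨T, fun r => ?_, hT, fun i => ?_⟩
  · ext x
    refine (hsum2 (F.E r) (F.E r) x).unique ?_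
    have e : (fun i => (F.E r * Z i * F.E r) x) = fun i => Z i (F.E r x) := by
      funext i
      rw [hZ i r]
      rfl
    rw [e]
    exact hsum (F.E r x)
  · ext x
    refine (hsum2 (P i) (P i) x).unique ?_
    convert hasSum_single i fun j hj => ?_ using 1
    · rw [hPZ, hZP]
    · rw [← hPZ j, ← mul_assoc, hPij i j hj.symm]
      simp

/-- The heart of the matter: an upper triangular operator whose two-sided diagonal seminorms are
less than `a` on an open set agrees near the diagonal over that set with an operator of norm at
most `a`. At the endpoints of the components, it also agrees in the sense of those one-sided
seminorms that are less than `a`. -/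
theorem exists_norm_le_agreeing {X : H →L[ℂ] H} (hX : X ∈ F.alg) {a : ℝ} (ha : 0 ≤ a) {U : Set ℝ}
    (hU : IsOpen U) (hUb : BddBelow U) (hUa : BddAbove U) (h : ∀ t ∈ U, F.JLt X t a) :
    ∃ Z ∈ F.alg, ‖Z‖ ≤ a ∧ (∀ t ∈ U, F.JZero (X - Z) t) ∧
      (∀ t m, t ∉ U → t < m → Set.Ioo t m ⊆ U → F.AgreesRight X Z t a) ∧
      (∀ l t, t ∉ U → l < t → Set.Ioo l t ⊆ U →
        F.dual.AgreesRight (star X) (star Z) (-t) a) := by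
  -- the components of `U`
  let ι := {c : ℝ × ℝ // c.1 < c.2 ∧ Set.Ioo c.1 c.2 ⊆ U ∧ c.1 ∉ U ∧ c.2 ∉ U}
  have hloc : ∀ i : ι, ∃ Z, F.IsLocalCopy X a i.1.1 i.1.2 Z ∧ F.AgreesRight X Z i.1.1 a ∧
      F.dual.AgreesRight (star X) (star Z) (-i.1.2) a := fun i =>
    exists_isLocalCopy_component hX i.2.1 fun r hr => h r (i.2.2.1 hr)
  choose Z hZ hZl hZr using hloc
  obtain ⟨T, hTalg, hT, hTcut⟩ := exists_block_sum (p := fun i : ι => i.1.1)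
    (q := fun i : ι => i.1.2) ha (fun i => i.2.1) (fun i j hij => by
      by_contra! hcon
      refine hij (Subtype.ext (Prod.ext ?_ ?_))
      · rcases lt_trichotomy i.1.1 j.1.1 with h1 | h1 | h1
        · exact absurd (i.2.2.1 ⟨h1, hcon.1⟩) j.2.2.2.1
        · exact h1
        · exact absurd (j.2.2.1 ⟨h1, hcon.2⟩) i.2.2.2.1
      · rcases lt_trichotomy i.1.2 j.1.2 with h1 | h1 | h1
        · exact absurd (j.2.2.1 ⟨hcon.1, h1⟩) i.2.2.2.2
        · exact h1
        · exact absurd (i.2.2.1 ⟨hcon.2, h1⟩) j.2.2.2.2)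
    (fun i => (hZ i).mem_alg) (fun i => (hZ i).cut_eq) fun i => (hZ i).norm_le
  have hcut : ∀ i : ι, F.cut i.1.1 i.1.2 (Z i) = F.cut i.1.1 i.1.2 T := fun i => by
    rw [hTcut i, (hZ i).cut_eq]
  refine ⟨T, hTalg, hT, fun t ht => ?_, fun t m ht htm hm => ?_, fun l t ht hlt hl => ?_⟩
  · obtain ⟨p, q, hp, hq, hi⟩ := hU.exists_component hUb hUa ht
    let i : ι := ⟨(p, q), hp.trans hq, hi⟩
    refine ((hZ i).jZero t ⟨hp, hq⟩).congr hp hq ?_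
    rw [cut_sub, cut_sub]
    congr 1
    exact hcut i
  · obtain ⟨r, hr1, hr2⟩ := exists_between htm
    obtain ⟨p, q, hp, hq, hi⟩ := hU.exists_component hUb hUa (hm ⟨hr1, hr2⟩)
    have hpt : p = t := by
      rcases lt_trichotomy p t with h1 | h1 | h1
      · exact absurd (hi.1 ⟨h1, hr1.trans hq⟩) ht
      · exact h1
      · exact absurd (hm ⟨h1, hp.trans hr2⟩) hi.2.1
    subst hpt
    let i : ι := ⟨(p, q), hp.trans hq, hi⟩
    exact (hZl i).congr i.2.1 (hcut i)
  · obtain ⟨r, hr1, hr2⟩ := exists_between hlt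
    obtain ⟨p, q, hp, hq, hi⟩ := hU.exists_component hUb hUa (hl ⟨hr1, hr2⟩)
    have hqt : q = t := by
      rcases lt_trichotomy q t with h1 | h1 | h1
      · exact absurd (hl ⟨hr1.trans hq, h1⟩) hi.2.2
      · exact h1
      · exact absurd (hi.1 ⟨hp.trans hr2, h1⟩) ht
    subst hqt
    let i : ι := ⟨(p, q), hp.trans hq, hi⟩
    refine (hZr i).congr (neg_lt_neg i.2.1) ?_
    rw [dual_cut, dual_cut, neg_neg, neg_neg, ← star_cut, ← star_cut]
    exact congrArg star (hcut i)

end SpectralFamily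

/-! ### Projections of a nest -/

namespace ContinuousNest

variable {H : Type*} [NormedAddCommGroup H] [InnerProductSpace ℂ H] [CompleteSpace H]
  {𝒩 : ContinuousNest H}

theorem isStarProjection_proj (N : 𝒩.carrier) : IsStarProjection (proj N) :=
  isStarProjection_starProjection

theorem proj_apply_eq_self_iff {N : 𝒩.carrier} {x : H} : proj N x = x ↔ x ∈ N.1 :=
  Submodule.starProjection_eq_self_iff

theorem proj_apply_mem (N : 𝒩.carrier) (x : H) : proj N x ∈ N.1 :=
  Submodule.starProjection_apply_mem _ x

theorem le_total_carrier (L M : 𝒩.carrier) : L ≤ M ∨ M ≤ L := 𝒩.isChain.total L.2 M.2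

theorem le_of_proj_mul {L M : 𝒩.carrier} (h : proj M * proj L = proj L) : L ≤ M := by
  intro x hx
  have hx' : x ∈ L.1 := hx
  have h1 := congrArg (fun T : H →L[ℂ] H => T x) h
  simp only [mul_apply_eq_comp, proj_apply_eq_self_iff.2 hx'] at h1
  exact proj_apply_eq_self_iff.1 h1

/-- The projections onto the members of a subset of the nest tend to the projection onto the
supremum. -/
theorem tendsto_proj_sSup (S : Set 𝒩.carrier) (Q : 𝒩.carrier)
    (hQ : Q.1 = sSup (Subtype.val '' S)) (x : H) :
    Tendsto (fun N : S => proj N.1 x) atTop (𝓝 (proj Q x)) := by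
  have hmono : Monotone fun N : S => N.1.1.toSubmodule := fun A B h => h
  have h1 := Submodule.starProjection_tendsto_closure_iSup (fun N : S => N.1.1.toSubmodule) hmono x
  have h2 : (⨆ N : S, N.1.1.toSubmodule).topologicalClosure = Q.1.toSubmodule := by
    have e : (⨆ N : S, N.1.1.toSubmodule) =
        ⨆ K ∈ (Subtype.val '' S : Set (ClosedSubmodule ℂ H)), K.toSubmodule := by
      rw [iSup_image, iSup_subtype']
    rw [hQ, ClosedSubmodule.toSubmodule_sSup, e]
    rfl
  simp only [h2] at h1
  exact h1

/-- The projections onto the members of a subset of the nest tend to the projection onto the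
infimum. -/
theorem tendsto_proj_sInf (S : Set 𝒩.carrier) (Q : 𝒩.carrier)
    (hQ : Q.1 = sInf (Subtype.val '' S)) (x : H) :
    Tendsto (fun N : S => proj N.1 x) atBot (𝓝 (proj Q x)) := by
  have hmono : Monotone fun N : Sᵒᵈ => (OrderDual.ofDual N).1.1.toSubmoduleᗮ :=
    fun A B h => Submodule.orthogonal_le h
  have h1 := Submodule.starProjection_tendsto_closure_iSup
    (fun N : Sᵒᵈ => (OrderDual.ofDual N).1.1.toSubmoduleᗮ) hmono x
  have h2 : (⨆ N : Sᵒᵈ, (OrderDual.ofDual N).1.1.toSubmoduleᗮ).topologicalClosure =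
      Q.1.toSubmoduleᗮ := by
    rw [← Submodule.orthogonal_orthogonal_eq_closure, ← Submodule.iInf_orthogonal]
    simp only [Submodule.orthogonal_orthogonal]
    congr 1
    rw [hQ, ClosedSubmodule.toSubmodule_sInf, iInf_image, iInf_subtype']
    rfl
  simp only [h2, Submodule.starProjection_orthogonal'] at h1
  have h3 : Tendsto (fun N : Sᵒᵈ => proj (OrderDual.ofDual N).1 x) atTop (𝓝 (proj Q x)) := by
    have := h1.const_sub x
    simpa [proj] using this
  exact h3

end ContinuousNest

/-! ### Gram operators -/

section Gramian

open InnerProductSpace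

variable {H : Type*} [NormedAddCommGroup H] [InnerProductSpace ℂ H] {x : ℕ → H}

theorem summable_norm_sq_apply (hx : ∀ k, ‖x k‖ ^ 2 ≤ (1 / 2 : ℝ) ^ k) {T : H →L[ℂ] H}
    (hT : ‖T‖ ≤ 1) : Summable fun k => ‖T (x k)‖ ^ 2 :=
  Summable.of_nonneg_of_le (fun _ => by positivity)
    (fun k => (pow_le_pow_left₀ (norm_nonneg _) (by simpa using T.le_of_opNorm_le hT (x k)) 2).trans
      (hx k)) summable_geometric_two

variable [CompleteSpace H]

/-- The positive trace class operator `∑ₖ xₖ ⊗ xₖ`. -/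
noncomputable def gramian (x : ℕ → H) : H →L[ℂ] H := ∑' k, rankOne ℂ (x k) (x k)

theorem hasSum_gramian (hx : ∀ k, ‖x k‖ ^ 2 ≤ (1 / 2 : ℝ) ^ k) :
    HasSum (fun k => rankOne ℂ (x k) (x k)) (gramian x) := by
  refine Summable.hasSum (.of_norm_bounded summable_geometric_two fun k => ?_)
  rw [norm_rankOne, ← sq]
  exact hx k

theorem isCompactOperator_gramian (hx : ∀ k, ‖x k‖ ^ 2 ≤ (1 / 2 : ℝ) ^ k) :
    IsCompactOperator (gramian x) := by
  refine isCompactOperator_of_tendsto (hasSum_gramian hx) (Eventually.of_forall fun s => ?_)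
  refine (compactOperator (RingHom.id ℂ) H H).sum_mem fun k _ => ?_
  exact (isCompactOperator_of_locallyCompactSpace_rng
    (ContinuousLinearMap.toSpanSingleton ℂ (x k))).comp_clm (innerSL ℂ (x k))

theorem isSelfAdjoint_gramian (hx : ∀ k, ‖x k‖ ^ 2 ≤ (1 / 2 : ℝ) ^ k) :
    IsSelfAdjoint (gramian x) := by
  have h := (hasSum_gramian hx).star
  simp only [ContinuousLinearMap.star_eq_adjoint, adjoint_rankOne] at h
  exact h.unique (hasSum_gramian hx)

theorem hasSum_re_inner_gramian (hx : ∀ k, ‖x k‖ ^ 2 ≤ (1 / 2 : ℝ) ^ k) (y : H) :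
    HasSum (fun k => ‖⟪x k, y⟫_ℂ‖ ^ 2) (RCLike.re ⟪gramian x y, y⟫_ℂ) := by
  have h1 := (((hasSum_gramian hx).mapL (ContinuousLinearMap.apply ℂ H y)).mapL
    (innerSL ℂ y)).mapL Complex.reCLM
  rw [inner_re_symm]
  refine HasSum.congr_fun h1 fun k => ?_
  simp only [ContinuousLinearMap.apply_apply, rankOne_apply, innerSL_apply_apply, inner_smul_right]
  refine Eq.trans ?_ (inner_mul_symm_re_eq_norm (𝕜 := ℂ) (x k) y).symm
  rw [norm_mul, norm_inner_symm y, sq]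

theorem pos_gramian (hx : ∀ k, ‖x k‖ ^ 2 ≤ (1 / 2 : ℝ) ^ k)
    (hd : Dense (Submodule.span ℂ (Set.range x) : Set H)) {y : H} (hy : y ≠ 0) :
    0 < RCLike.re ⟪gramian x y, y⟫_ℂ := by
  have h := hasSum_re_inner_gramian hx y
  refine lt_of_le_of_ne (h.nonneg fun k => by positivity) fun h0 => hy ?_
  rw [← h0, hasSum_zero_iff_of_nonneg fun k => by positivity] at h
  refine hd.eq_zero_of_inner_right ℂ fun v hv => ?_
  induction hv using Submodule.span_induction with
  | mem v hv =>
    obtain ⟨k, rfl⟩ := hv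
    simpa using congrFun h k
  | zero => simp
  | add v w _ _ h1 h2 => rw [inner_add_left, h1, h2, add_zero]
  | smul c v _ h1 => rw [inner_smul_left, h1, mul_zero]

theorem norm_mul_gramian_mul_le (hx : ∀ k, ‖x k‖ ^ 2 ≤ (1 / 2 : ℝ) ^ k) {D : H →L[ℂ] H}
    (hD : IsSelfAdjoint D) (hD1 : ‖D‖ ≤ 1) :
    ‖D * gramian x * D‖ ≤ ∑' k, ‖D (x k)‖ ^ 2 := by
  have h := ((hasSum_gramian hx).mul_left D).mul_right D
  rw [← h.tsum_eq]
  refine tsum_of_norm_bounded (summable_norm_sq_apply hx hD1).hasSum fun k => le_of_eq ?_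
  rw [ContinuousLinearMap.mul_def, ContinuousLinearMap.mul_def, comp_rankOne, rankOne_comp,
    norm_rankOne, ← ContinuousLinearMap.star_eq_adjoint, hD.star_eq, sq]

/-- In a separable space some sequence that is quadratically dominated by a geometric sequence
spans a dense subspace. -/
theorem exists_small_seq_dense_span (H : Type*) [NormedAddCommGroup H] [InnerProductSpace ℂ H]
    [TopologicalSpace.SeparableSpace H] : ∃ x : ℕ → H, (∀ k, ‖x k‖ ^ 2 ≤ (1 / 2 : ℝ) ^ k) ∧
      Dense (Submodule.span ℂ (Set.range x) : Set H) := by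
  set d := TopologicalSpace.denseSeq H
  set c : ℕ → ℝ := fun k => (1 / 2 : ℝ) ^ k / (1 + ‖d k‖)
  have hc : ∀ k, 0 < c k := fun k => by positivity
  refine ⟨fun k => ((c k : ℝ) : ℂ) • d k, fun k => ?_, ?_⟩
  · have h1 : c k * ‖d k‖ ≤ (1 / 2 : ℝ) ^ k := by
      rw [div_mul_eq_mul_div, div_le_iff₀ (by positivity)]
      have : 0 < (1 / 2 : ℝ) ^ k := by positivity
      nlinarith [norm_nonneg (d k)]
    have h2 : (1 / 2 : ℝ) ^ k ≤ 1 := pow_le_one₀ (by norm_num) (by norm_num)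
    rw [norm_smul, Complex.norm_real, Real.norm_of_nonneg (hc k).le]
    have h3 : 0 ≤ c k * ‖d k‖ := by have := hc k; positivity
    nlinarith
  · refine (TopologicalSpace.denseRange_denseSeq H).mono ?_
    rintro _ ⟨k, rfl⟩
    have hk : ((c k : ℝ) : ℂ) ≠ 0 := Complex.ofReal_ne_zero.2 (hc k).ne'
    have := Submodule.smul_mem (Submodule.span ℂ (Set.range fun k => ((c k : ℝ) : ℂ) • d k))
      ((c k : ℝ) : ℂ)⁻¹ (Submodule.subset_span ⟨k, rfl⟩)
    rwa [smul_smul, inv_mul_cancel₀ hk, one_smul] at this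

end Gramian

/-! ### Parametrisation of a nest -/

namespace ContinuousNest

variable {H : Type*} [NormedAddCommGroup H] [InnerProductSpace ℂ H] [CompleteSpace H]
  {𝒩 : ContinuousNest H} {x : ℕ → H}

theorem norm_proj_le (N : 𝒩.carrier) : ‖proj N‖ ≤ 1 :=
  IsStarProjection.norm_le _ (isStarProjection_proj N)

theorem isSelfAdjoint_proj_sub (L M : 𝒩.carrier) : IsSelfAdjoint (proj M - proj L) :=
  (isStarProjection_proj M).isSelfAdjoint.sub (isStarProjection_proj L).isSelfAdjoint

theorem norm_sq_proj_sub_apply {L M : 𝒩.carrier} (h : L ≤ M) (y : H) :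
    ‖(proj M - proj L) y‖ ^ 2 = ‖proj M y‖ ^ 2 - ‖proj L y‖ ^ 2 := by
  have h0 : ∀ A : 𝒩.carrier, proj A * proj A = proj A := fun A => (proj_mul_proj le_rfl).1
  have h1 : ∀ A : 𝒩.carrier, star (proj A) = proj A := fun A =>
    (isStarProjection_proj A).isSelfAdjoint.star_eq
  obtain ⟨h2, h3⟩ := proj_mul_proj h
  have e : star (proj M - proj L) * (proj M - proj L) = proj M - proj L := by
    rw [(isSelfAdjoint_proj_sub L M).star_eq, mul_sub, sub_mul, sub_mul, h0, h0, h2, h3]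
    abel
  rw [norm_sq_eq_re_inner_star_mul, norm_sq_eq_re_inner_star_mul, norm_sq_eq_re_inner_star_mul, e,
    h1, h1, h0, h0, sub_apply, inner_sub_left, map_sub]

/-- The trace of the compression of the Gram operator of `x` to a member of the nest. -/
noncomputable def weight (x : ℕ → H) (N : 𝒩.carrier) : ℝ := ∑' k, ‖proj N (x k)‖ ^ 2

theorem hasSum_weight_sub (hx : ∀ k, ‖x k‖ ^ 2 ≤ (1 / 2 : ℝ) ^ k) {L M : 𝒩.carrier} (h : L ≤ M) :
    HasSum (fun k => ‖(proj M - proj L) (x k)‖ ^ 2) (weight x M - weight x L) := by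
  simp only [norm_sq_proj_sub_apply h]
  exact (summable_norm_sq_apply hx (norm_proj_le M)).hasSum.sub
    (summable_norm_sq_apply hx (norm_proj_le L)).hasSum

theorem monotone_weight (hx : ∀ k, ‖x k‖ ^ 2 ≤ (1 / 2 : ℝ) ^ k) :
    Monotone (weight x : 𝒩.carrier → ℝ) := fun _ _ h =>
  sub_nonneg.1 ((hasSum_weight_sub hx h).nonneg fun _ => by positivity)

theorem strictMono_weight (hx : ∀ k, ‖x k‖ ^ 2 ≤ (1 / 2 : ℝ) ^ k)
    (hd : Dense (Submodule.span ℂ (Set.range x) : Set H)) :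
    StrictMono (weight x : 𝒩.carrier → ℝ) := fun L M h => by
  refine lt_of_le_of_ne (monotone_weight hx h.le) fun he => h.not_ge (le_of_proj_mul ?_)
  have h1 := hasSum_weight_sub hx h.le
  rw [he, sub_self, hasSum_zero_iff_of_nonneg fun k => by positivity] at h1
  have h2 : proj M - proj L = 0 := by
    refine ContinuousLinearMap.coeFn_injective
      (Continuous.ext_on (hd.mono fun y hy => ?_) (proj M - proj L).continuous
        (0 : H →L[ℂ] H).continuous fun y hy => hy)
    show (proj M - proj L) y = (0 : H →L[ℂ] H) y
    induction hy using Submodule.span_induction with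
    | mem y hy =>
      obtain ⟨k, rfl⟩ := hy
      simpa using congrFun h1 k
    | zero => simp
    | add v w _ _ h1 h2 => simp only [map_add, h1, h2]
    | smul c v _ h1 => simp only [map_smul, h1]
  rw [sub_eq_zero.1 h2]
  exact (proj_mul_proj le_rfl).1

theorem tendsto_weight (hx : ∀ k, ‖x k‖ ^ 2 ≤ (1 / 2 : ℝ) ^ k) {ι : Type*} {l : Filter ι}
    {u : ι → 𝒩.carrier} {Q : 𝒩.carrier}
    (h : ∀ y, Tendsto (fun i => proj (u i) y) l (𝓝 (proj Q y))) :
    Tendsto (fun i => weight x (u i)) l (𝓝 (weight x Q)) := by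
  refine tendsto_tsum_of_dominated_convergence summable_geometric_two
    (fun k => ((h (x k)).norm.pow 2)) (Eventually.of_forall fun i k => ?_)
  rw [Real.norm_of_nonneg (by positivity)]
  exact (pow_le_pow_left₀ (norm_nonneg _)
    (by simpa using (proj (u i)).le_of_opNorm_le (norm_proj_le _) (x k)) 2).trans (hx k)

/-- The values of the weight fill an interval, because the nest is complete and has no gaps. -/
theorem exists_weight_eq (hx : ∀ k, ‖x k‖ ^ 2 ≤ (1 / 2 : ℝ) ^ k) {B T : 𝒩.carrier} {c : ℝ}
    (hB : weight x B ≤ c) (hT : c ≤ weight x T) : ∃ N : 𝒩.carrier, weight x N = c := by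
  set S : Set 𝒩.carrier := {N | weight x N ≤ c}
  set S' : Set 𝒩.carrier := {N | c ≤ weight x N}
  set Q : 𝒩.carrier := ⟨sSup (Subtype.val '' S), 𝒩.sSup_mem _ (by rintro _ ⟨N, -, rfl⟩; exact N.2)⟩
  set R : 𝒩.carrier := ⟨sInf (Subtype.val '' S'), 𝒩.sInf_mem _ (by rintro _ ⟨N, -, rfl⟩; exact N.2)⟩
  have hQ1 : ∀ N ∈ S, N ≤ Q := fun N hN => le_sSup (Set.mem_image_of_mem Subtype.val hN)
  have hR1 : ∀ N ∈ S', R ≤ N := fun N hN => sInf_le (Set.mem_image_of_mem Subtype.val hN)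
  have : Nonempty S := ⟨⟨B, hB⟩⟩
  have : Nonempty S' := ⟨⟨T, hT⟩⟩
  have : IsDirectedOrder S := ⟨fun A B => (le_total_carrier A.1 B.1).elim
    (fun h => ⟨B, h, le_rfl⟩) fun h => ⟨A, le_rfl, h⟩⟩
  have : IsCodirectedOrder S' := ⟨fun A B => (le_total_carrier A.1 B.1).elim
    (fun h => ⟨A, le_rfl, h⟩) fun h => ⟨B, h, le_rfl⟩⟩
  have hQ : weight x Q ≤ c := le_of_tendsto
    (tendsto_weight hx fun y => tendsto_proj_sSup S Q rfl y) (Eventually.of_forall fun N => N.2)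
  have hR : c ≤ weight x R := ge_of_tendsto
    (tendsto_weight hx fun y => tendsto_proj_sInf S' R rfl y) (Eventually.of_forall fun N => N.2)
  by_contra! hne
  have hQR : Q < R := by
    refine lt_of_le_not_ge ((le_total_carrier Q R).resolve_right fun h => ?_) fun h => ?_ <;>
    exact hne Q (hQ.antisymm (hR.trans (monotone_weight hx h)))
  obtain ⟨P, hP1, hP2⟩ := nonempty_Ioo hQR
  rcases le_total (weight x P) c with h | h
  · exact (hQ1 P h).not_gt hP1
  · exact (hR1 P h).not_gt hP2

/-- A parametrisation of a nest by an interval: an order isomorphism `param` from the nest to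
`[0, length]` that is inverse to a spectral family. -/
structure Parametrization (𝒩 : ContinuousNest H) where
  family : SpectralFamily H
  param : 𝒩.carrier → ℝ
  length : ℝ
  strictMono : StrictMono param
  param_bot : param ⟨⊥, 𝒩.bot_mem⟩ = 0
  param_top : param ⟨⊤, 𝒩.top_mem⟩ = length
  E_param : ∀ N, family.E (param N) = proj N
  exists_param_eq : ∀ t ∈ Set.Icc 0 length, ∃ N, param N = t
  E_of_nonpos : ∀ t ≤ 0, family.E t = 0
  E_of_ge : ∀ t, length ≤ t → family.E t = 1

/-- A continuous nest on a separable space is the set of values of a strongly continuous increasing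
family of projections. -/
theorem nonempty_parametrization [TopologicalSpace.SeparableSpace H] (𝒩 : ContinuousNest H) :
    Nonempty (Parametrization 𝒩) := by
  obtain ⟨x, hx, hd⟩ := exists_small_seq_dense_span H
  set B : 𝒩.carrier := ⟨⊥, 𝒩.bot_mem⟩
  set T : 𝒩.carrier := ⟨⊤, 𝒩.top_mem⟩
  have hB : proj B = 0 := by simp [proj, B]
  have hT : proj T = 1 := ContinuousLinearMap.ext fun y =>
    proj_apply_eq_self_iff.2 (show y ∈ (⊤ : ClosedSubmodule ℂ H) from trivial)
  have hφ : StrictMono (weight x : 𝒩.carrier → ℝ) := strictMono_weight hx hd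
  have hB0 : weight x B = 0 := by simp [weight, hB]
  have hBle : ∀ N : 𝒩.carrier, 0 ≤ weight x N := fun N => tsum_nonneg fun k => by positivity
  have hleT : ∀ N : 𝒩.carrier, weight x N ≤ weight x T := fun N =>
    monotone_weight hx (show N.1 ≤ ⊤ from le_top)
  have hinj : ∀ {L M : 𝒩.carrier}, weight x L ≤ weight x M → L ≤ M := fun {L M} h =>
    (le_total_carrier L M).elim id fun h' => by
      rcases h'.eq_or_lt with h' | h'
      · exact h'.ge
      · exact absurd (hφ h') h.not_gt
  set C := weight x T
  have hclamp : ∀ t : ℝ, ∃ N : 𝒩.carrier, weight x N = max 0 (min t C) := fun t =>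
    exists_weight_eq hx (B := B) (T := T) (hB0.trans_le (le_max_left _ _))
      (max_le (hBle T) (min_le_right _ _))
  choose N hN using hclamp
  have hmono : Monotone N := fun s t h => hinj (by
    rw [hN, hN]; exact max_le_max le_rfl (min_le_min_right _ h))
  have hlip : ∀ {s t}, s ≤ t → weight x (N t) - weight x (N s) ≤ t - s := fun {s t} h => by
    rw [hN, hN]
    have := hBle T
    simp only [max_def, min_def]
    split_ifs <;> linarith
  have hNφ : ∀ M, N (weight x M) = M := fun M => by
    have h : weight x (N (weight x M)) = weight x M := by
      rw [hN, min_eq_left (hleT M), max_eq_right (hBle M)]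
    exact (hinj h.le).antisymm (hinj h.ge)
  have hnorm : ∀ {s t}, s ≤ t → ‖proj (N t) - proj (N s)‖ ≤ 1 := fun h =>
    norm_proj_sub_le (hmono h)
  have hsq : ∀ k s t, s ≤ t → ‖proj (N t) (x k) - proj (N s) (x k)‖ ^ 2 ≤ t - s := fun k s t h => by
    have h1 := hasSum_weight_sub hx (hmono h)
    exact (le_hasSum h1 k fun _ _ => by positivity).trans (hlip h)
  have hcont0 : ∀ k, Continuous fun t => proj (N t) (x k) := fun k => by
    refine Metric.continuous_iff.2 fun s ε hε => ⟨ε ^ 2, by positivity, fun t ht => ?_⟩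
    refine lt_of_pow_lt_pow_left₀ 2 hε.le (lt_of_le_of_lt ?_ ht)
    rw [Real.dist_eq]
    rcases le_total s t with h | h
    · rw [dist_eq_norm]
      exact (hsq k s t h).trans (le_abs_self _)
    · rw [dist_eq_norm']
      exact (hsq k t s h).trans ((neg_sub t s).symm.trans_le (neg_le_abs _))
  have hcont : ∀ y, Continuous fun t => proj (N t) y := fun y => by
    refine continuous_of_uniform_approx_of_continuous fun u hu => ?_
    obtain ⟨ε, hε, hu⟩ := Metric.mem_uniformity_dist.1 hu
    obtain ⟨z, hz, hzy⟩ := hd.exists_dist_lt y hε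
    refine ⟨fun t => proj (N t) z, ?_, fun t => hu ?_⟩
    · clear hzy
      induction hz using Submodule.span_induction with
      | mem v hv =>
        obtain ⟨k, rfl⟩ := hv
        exact hcont0 k
      | zero => simpa using continuous_const
      | add v w _ _ h1 h2 => simp only [map_add]; exact h1.add h2
      | smul c v _ h1 => simp only [map_smul]; exact h1.const_smul c
    · rw [dist_eq_norm, ← map_sub]
      rw [dist_eq_norm] at hzy
      exact ((proj (N t)).le_of_opNorm_le (norm_proj_le _) _).trans_lt (by simpa using hzy)
  refine ⟨⟨fun t => proj (N t), fun t => isStarProjection_proj _,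
    fun h => (proj_mul_proj (hmono h)).2, hcont, gramian x, isCompactOperator_gramian hx,
    isSelfAdjoint_gramian hx, fun y hy => pos_gramian hx hd hy, fun {s t} h => ?_⟩,
    weight x, C, hφ, hB0, rfl, fun M => by simp only [hNφ], fun t ht => ⟨N t, ?_⟩,
    fun t ht => ?_, fun t ht => ?_⟩
  · refine (norm_mul_gramian_mul_le hx (isSelfAdjoint_proj_sub _ _) (hnorm h)).trans ?_
    rw [(hasSum_weight_sub hx (hmono h)).tsum_eq]
    exact hlip h
  · rw [hN, min_eq_left ht.2, max_eq_right ht.1]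
  · have h : weight x (N t) = weight x B := by
      rw [hN, hB0, min_eq_left (ht.trans (hBle T)), max_eq_left ht]
    exact (congrArg proj ((hinj h.le).antisymm (hinj h.ge))).trans hB
  · have h : weight x (N t) = weight x T := by
      rw [hN, min_eq_right ht, max_eq_right (hBle T)]
    exact (congrArg proj ((hinj h.le).antisymm (hinj h.ge))).trans hT

end ContinuousNest

/-! ### Seminorms in terms of the parameter -/

namespace SpectralFamily

variable {H : Type*} [NormedAddCommGroup H] [InnerProductSpace ℂ H] [CompleteSpace H]
  {F : SpectralFamily H} {X : H →L[ℂ] H} {t a : ℝ}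

theorem JLt.iLt (h : F.JLt X t a) : F.ILt X t a := by
  obtain ⟨l, m, hl, hm, h⟩ := h
  exact ⟨m, hm, (F.norm_cut_le_cut hl.le hm.le le_rfl X).trans_lt h⟩

theorem ILt.eLt (h : F.ILt X t a) : F.ELt X t a := by
  obtain ⟨m, hm, h⟩ := h
  refine ⟨_, h, m, hm, fun l hl => ?_⟩
  exact (F.essNorm_cut_le_cut hl.1.le hl.2.le le_rfl X).trans (essNorm_le_norm _)

theorem JZero.iZero (h : F.JZero X t) : F.IZero X t := fun ε hε => (h ε hε).iLt

theorem IZero.eZero (h : F.IZero X t) : F.EZero X t := fun ε hε => (h ε hε).eLt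

theorem iLt_dual_star :
    F.dual.ILt (star X) (-t) a ↔ ∃ l < t, ‖F.cut l t X‖ < a := by
  constructor
  · rintro ⟨m, hm, h⟩
    refine ⟨-m, by linarith, ?_⟩
    rwa [dual_cut, neg_neg, ← star_cut, norm_star] at h
  · rintro ⟨l, hl, h⟩
    refine ⟨-l, by linarith, ?_⟩
    rwa [dual_cut, neg_neg, neg_neg, ← star_cut, norm_star]

theorem eLt_dual_star :
    F.dual.ELt (star X) (-t) a ↔
      ∃ b < a, ∃ l < t, ∀ m ∈ Set.Ioo l t, essNorm (F.cut l m X) ≤ b := by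
  constructor
  · rintro ⟨b, hb, m, hm, h⟩
    refine ⟨b, hb, -m, by linarith, fun r hr => ?_⟩
    have := h (-r) ⟨by linarith [hr.2], by linarith [hr.1]⟩
    rwa [dual_cut, neg_neg, ← star_cut, essNorm_star] at this
  · rintro ⟨b, hb, l, hl, h⟩
    refine ⟨b, hb, -l, by linarith, fun r hr => ?_⟩
    have := h (-r) ⟨by linarith [hr.2], by linarith [hr.1]⟩
    rwa [dual_cut, neg_neg, ← star_cut, essNorm_star]

theorem JZero.dual_star (h : F.JZero X t) : F.dual.JZero (star X) (-t) := fun ε hε =>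
  jLt_dual_star.2 (h ε hε)

end SpectralFamily

namespace ContinuousNest

open SpectralFamily

variable {H : Type*} [NormedAddCommGroup H] [InnerProductSpace ℂ H] [CompleteSpace H]
  {𝒩 : ContinuousNest H}

theorem ePlus_nonneg (N : 𝒩.carrier) (X : 𝒩.alg) : 0 ≤ ePlus N X := by
  rw [ePlus]
  split_ifs
  · exact le_rfl
  · exact Real.iInf_nonneg fun _ => Real.iSup_nonneg fun _ => essNorm_nonneg _

theorem eMinus_nonneg (N : 𝒩.carrier) (X : 𝒩.alg) : 0 ≤ eMinus N X := by
  rw [eMinus]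
  split_ifs
  · exact le_rfl
  · exact Real.iInf_nonneg fun _ => Real.iSup_nonneg fun _ => essNorm_nonneg _

theorem iPlus_nonneg (N : 𝒩.carrier) (X : 𝒩.alg) : 0 ≤ iPlus N X := by
  rw [iPlus]
  split_ifs
  · exact le_rfl
  · exact Real.iInf_nonneg fun _ => norm_nonneg _

theorem iMinus_nonneg (N : 𝒩.carrier) (X : 𝒩.alg) : 0 ≤ iMinus N X := by
  rw [iMinus]
  split_ifs
  · exact le_rfl
  · exact Real.iInf_nonneg fun _ => norm_nonneg _

theorem j_nonneg (N : 𝒩.carrier) (X : 𝒩.alg) : 0 ≤ j N X := by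
  rw [j]
  split_ifs
  · exact iPlus_nonneg N X
  · exact iMinus_nonneg N X
  · exact Real.iInf_nonneg fun _ => norm_nonneg _

theorem lt_top_of_ne {N : 𝒩.carrier} (h : N.1 ≠ ⊤) : N < ⟨⊤, 𝒩.top_mem⟩ :=
  lt_of_le_of_ne (show N.1 ≤ ⊤ from le_top) fun h' => h (congrArg Subtype.val h')

theorem bot_lt_of_ne {N : 𝒩.carrier} (h : N.1 ≠ ⊥) : (⟨⊥, 𝒩.bot_mem⟩ : 𝒩.carrier) < N :=
  lt_of_le_of_ne (show ⊥ ≤ N.1 from bot_le) fun h' => h (congrArg Subtype.val h').symm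

namespace Parametrization

variable (P : Parametrization 𝒩)

theorem param_lt_iff {L M : 𝒩.carrier} : P.param L < P.param M ↔ L < M := by
  refine ⟨fun h => lt_of_le_not_ge ((le_total_carrier L M).resolve_right fun h' => ?_)
    fun h' => ?_, fun h => P.strictMono h⟩ <;>
  exact (P.strictMono.monotone h').not_gt h

theorem param_mem_Icc (N : 𝒩.carrier) : P.param N ∈ Set.Icc 0 P.length := by
  rw [← P.param_bot, ← P.param_top]
  exact ⟨P.strictMono.monotone (show ⊥ ≤ N.1 from bot_le),
    P.strictMono.monotone (show N.1 ≤ ⊤ from le_top)⟩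

theorem exists_E_eq (t : ℝ) : ∃ N : 𝒩.carrier, P.family.E t = proj N := by
  rcases le_total t 0 with h | h
  · refine ⟨⟨⊥, 𝒩.bot_mem⟩, ?_⟩
    rw [P.E_of_nonpos t h, ← P.E_param, P.param_bot, P.E_of_nonpos 0 le_rfl]
  rcases le_total t P.length with h' | h'
  · obtain ⟨N, rfl⟩ := P.exists_param_eq t ⟨h, h'⟩
    exact ⟨N, P.E_param N⟩
  · refine ⟨⟨⊤, 𝒩.top_mem⟩, ?_⟩
    rw [P.E_of_ge t h', ← P.E_param, P.param_top, P.E_of_ge _ le_rfl]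

theorem mem_alg_iff {X : H →L[ℂ] H} : X ∈ 𝒩.alg ↔ X ∈ P.family.alg := by
  refine ⟨fun h t => ?_, fun h N hN x hx => ?_⟩
  · obtain ⟨N, hN⟩ := P.exists_E_eq t
    rw [hN]
    ext x
    exact proj_apply_eq_self_iff.2 (h N N.2 _ (proj_apply_mem N x))
  · have h1 := h (P.param ⟨N, hN⟩)
    rw [P.E_param] at h1
    have h2 := congrArg (fun T : H →L[ℂ] H => T x) h1
    have h3 : proj (⟨N, hN⟩ : 𝒩.carrier) x = x := proj_apply_eq_self_iff.2 hx
    simp only [mul_apply_eq_comp, h3] at h2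
    exact proj_apply_eq_self_iff.1 h2

theorem compress_eq_cut (L M : 𝒩.carrier) (X : H →L[ℂ] H) :
    compress L M X = P.family.cut (P.param L) (P.param M) X := by
  rw [compress, SpectralFamily.cut, SpectralFamily.gap, P.E_param, P.E_param]

theorem cut_eq_zero_of_ge {s t : ℝ} (hs : P.length ≤ s) (ht : P.length ≤ t) (X : H →L[ℂ] H) :
    P.family.cut s t X = 0 := by
  simp [SpectralFamily.cut, SpectralFamily.gap, P.E_of_ge s hs, P.E_of_ge t ht]

theorem cut_eq_zero_of_nonpos {s t : ℝ} (hs : s ≤ 0) (ht : t ≤ 0) (X : H →L[ℂ] H) :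
    P.family.cut s t X = 0 := by
  simp [SpectralFamily.cut, SpectralFamily.gap, P.E_of_nonpos s hs, P.E_of_nonpos t ht]

theorem param_eq_length {N : 𝒩.carrier} (h : N.1 = ⊤) : P.param N = P.length := by
  rw [← P.param_top]
  exact congrArg P.param (Subtype.ext h)

theorem param_eq_zero {N : 𝒩.carrier} (h : N.1 = ⊥) : P.param N = 0 := by
  rw [← P.param_bot]
  exact congrArg P.param (Subtype.ext h)

/-- To the right of a member of the nest other than the greatest, there are members with parameters
arbitrarily close. -/
theorem exists_param_mem_Ioc {N : 𝒩.carrier} (hN : N.1 ≠ ⊤) {m : ℝ} (hm : P.param N < m) :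
    ∃ M, N < M ∧ P.param M ≤ m := by
  have h : P.param N < min m P.length := by
    refine lt_min hm ?_
    rw [← P.param_top]
    exact P.strictMono (lt_top_of_ne hN)
  obtain ⟨M, hM⟩ := P.exists_param_eq (min m P.length)
    ⟨((P.param_mem_Icc N).1.trans_lt h).le, min_le_right _ _⟩
  exact ⟨M, P.param_lt_iff.1 (hM ▸ h), hM.le.trans (min_le_left _ _)⟩

/-- To the left of a member of the nest other than the least, there are members with parameters
arbitrarily close. -/
theorem exists_param_mem_Ico {N : 𝒩.carrier} (hN : N.1 ≠ ⊥) {l : ℝ} (hl : l < P.param N) :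
    ∃ L, L < N ∧ l ≤ P.param L := by
  have h : max l 0 < P.param N := by
    refine max_lt hl ?_
    rw [← P.param_bot]
    exact P.strictMono (bot_lt_of_ne hN)
  obtain ⟨L, hL⟩ := P.exists_param_eq (max l 0)
    ⟨le_max_right _ _, (h.trans_le (P.param_mem_Icc N).2).le⟩
  exact ⟨L, P.param_lt_iff.1 (hL ▸ h), (le_max_left _ _).trans hL.ge⟩

variable (N : 𝒩.carrier) (X : 𝒩.alg)

theorem iPlus_lt_iff {a : ℝ} (ha : 0 < a) :
    iPlus N X < a ↔ P.family.ILt X.1 (P.param N) a := by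
  by_cases hN : N.1 = ⊤
  · rw [iPlus, if_pos hN]
    refine iff_of_true ha ⟨P.param N + 1, by linarith, ?_⟩
    have := P.param_eq_length hN
    rwa [P.cut_eq_zero_of_ge this.ge (by linarith), norm_zero]
  rw [iPlus, if_neg hN]
  have : Nonempty (Set.Ioi N) := ⟨⟨_, lt_top_of_ne hN⟩⟩
  constructor
  · intro h
    obtain ⟨M, hM⟩ := exists_lt_of_ciInf_lt h
    rw [P.compress_eq_cut] at hM
    exact ⟨_, P.strictMono M.2, hM⟩
  · rintro ⟨m, hm, h⟩
    obtain ⟨M, hNM, hMm⟩ := P.exists_param_mem_Ioc hN hm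
    refine (ciInf_le ⟨0, ?_⟩ (⟨M, hNM⟩ : Set.Ioi N)).trans_lt ?_
    · rintro _ ⟨_, rfl⟩
      exact norm_nonneg _
    · rw [P.compress_eq_cut]
      exact (P.family.norm_cut_le_cut le_rfl (P.strictMono hNM).le hMm _).trans_lt h

theorem iMinus_lt_iff {a : ℝ} (ha : 0 < a) :
    iMinus N X < a ↔ P.family.dual.ILt (star X.1) (-P.param N) a := by
  rw [iLt_dual_star]
  by_cases hN : N.1 = ⊥
  · rw [iMinus, if_pos hN]
    refine iff_of_true ha ⟨P.param N - 1, by linarith, ?_⟩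
    have := P.param_eq_zero hN
    rwa [P.cut_eq_zero_of_nonpos (by linarith) this.le, norm_zero]
  rw [iMinus, if_neg hN]
  have : Nonempty (Set.Iio N) := ⟨⟨_, bot_lt_of_ne hN⟩⟩
  constructor
  · intro h
    obtain ⟨L, hL⟩ := exists_lt_of_ciInf_lt h
    rw [P.compress_eq_cut] at hL
    exact ⟨_, P.strictMono L.2, hL⟩
  · rintro ⟨l, hl, h⟩
    obtain ⟨L, hLN, hlL⟩ := P.exists_param_mem_Ico hN hl
    refine (ciInf_le ⟨0, ?_⟩ (⟨L, hLN⟩ : Set.Iio N)).trans_lt ?_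
    · rintro _ ⟨_, rfl⟩
      exact norm_nonneg _
    · rw [P.compress_eq_cut]
      exact (P.family.norm_cut_le_cut hlL (P.strictMono hLN).le le_rfl _).trans_lt h

theorem ePlus_lt_iff {a : ℝ} (ha : 0 < a) :
    ePlus N X < a ↔ P.family.ELt X.1 (P.param N) a := by
  by_cases hN : N.1 = ⊤
  · rw [ePlus, if_pos hN]
    refine iff_of_true ha ⟨0, ha, P.param N + 1, by linarith, fun l hl => ?_⟩
    have := P.param_eq_length hN
    rw [P.cut_eq_zero_of_ge (this.ge.trans hl.1.le) (by linarith)]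
    exact (essNorm_eq_zero isCompactOperator_zero).le
  rw [ePlus, if_neg hN]
  have : Nonempty (Set.Ioi N) := ⟨⟨_, lt_top_of_ne hN⟩⟩
  constructor
  · intro h
    obtain ⟨M, hM⟩ := exists_lt_of_ciInf_lt h
    refine ⟨_, hM, P.param M, P.strictMono M.2, fun l hl => ?_⟩
    obtain ⟨L, rfl⟩ := P.exists_param_eq l
      ⟨(P.param_mem_Icc N).1.trans hl.1.le, hl.2.le.trans (P.param_mem_Icc _).2⟩
    rw [← P.compress_eq_cut]
    refine le_ciSup (f := fun L : Set.Ioo N M.1 => essNorm (compress L.1 M.1 X.1)) ?_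
      ⟨L, P.param_lt_iff.1 hl.1, P.param_lt_iff.1 hl.2⟩
    refine ⟨essNorm (compress N M.1 X.1), ?_⟩
    rintro _ ⟨K, rfl⟩
    exact essNorm_compress_le K.2.1.le K.2.2.le le_rfl _
  · rintro ⟨b, hb, m, hm, h⟩
    obtain ⟨M, hNM, hMm⟩ := P.exists_param_mem_Ioc hN hm
    refine (ciInf_le ⟨0, ?_⟩ (⟨M, hNM⟩ : Set.Ioi N)).trans_lt (lt_of_le_of_lt ?_ hb)
    · rintro _ ⟨_, rfl⟩
      exact Real.iSup_nonneg fun _ => essNorm_nonneg _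
    · have := (nonempty_Ioo hNM).to_subtype
      refine ciSup_le fun L => ?_
      rw [P.compress_eq_cut]
      have h1 := P.strictMono L.2.1
      have h2 := P.strictMono L.2.2
      exact (P.family.essNorm_cut_le_cut le_rfl h2.le hMm _).trans (h _ ⟨h1, h2.trans_le hMm⟩)

theorem eMinus_lt_iff {a : ℝ} (ha : 0 < a) :
    eMinus N X < a ↔ P.family.dual.ELt (star X.1) (-P.param N) a := by
  rw [eLt_dual_star]
  by_cases hN : N.1 = ⊥
  · rw [eMinus, if_pos hN]
    refine iff_of_true ha ⟨0, ha, P.param N - 1, by linarith, fun m hm => ?_⟩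
    have := P.param_eq_zero hN
    rw [P.cut_eq_zero_of_nonpos (by linarith) (hm.2.le.trans this.le)]
    exact (essNorm_eq_zero isCompactOperator_zero).le
  rw [eMinus, if_neg hN]
  have : Nonempty (Set.Iio N) := ⟨⟨_, bot_lt_of_ne hN⟩⟩
  constructor
  · intro h
    obtain ⟨L, hL⟩ := exists_lt_of_ciInf_lt h
    refine ⟨_, hL, P.param L, P.strictMono L.2, fun m hm => ?_⟩
    obtain ⟨M, rfl⟩ := P.exists_param_eq m
      ⟨(P.param_mem_Icc _).1.trans hm.1.le, hm.2.le.trans (P.param_mem_Icc _).2⟩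
    rw [← P.compress_eq_cut]
    refine le_ciSup (f := fun M : Set.Ioo L.1 N => essNorm (compress L.1 M.1 X.1)) ?_
      ⟨M, P.param_lt_iff.1 hm.1, P.param_lt_iff.1 hm.2⟩
    refine ⟨essNorm (compress L.1 N X.1), ?_⟩
    rintro _ ⟨K, rfl⟩
    exact essNorm_compress_le le_rfl K.2.1.le K.2.2.le _
  · rintro ⟨b, hb, l, hl, h⟩
    obtain ⟨L, hLN, hlL⟩ := P.exists_param_mem_Ico hN hl
    refine (ciInf_le ⟨0, ?_⟩ (⟨L, hLN⟩ : Set.Iio N)).trans_lt (lt_of_le_of_lt ?_ hb)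
    · rintro _ ⟨_, rfl⟩
      exact Real.iSup_nonneg fun _ => essNorm_nonneg _
    · have := (nonempty_Ioo hLN).to_subtype
      refine ciSup_le fun M => ?_
      rw [P.compress_eq_cut]
      have h1 := P.strictMono M.2.1
      have h2 := P.strictMono M.2.2
      exact (P.family.essNorm_cut_le_cut hlL h1.le le_rfl _).trans (h _ ⟨hlL.trans_lt h1, h2⟩)

/-- At `0` and at `I`, where `j` is one-sided, the two-sided condition on the spectral family is
equivalent to the one-sided one, because the family is constant beyond these parameters. -/
theorem j_lt_iff {a : ℝ} (ha : 0 < a) :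
    j N X < a ↔ P.family.JLt X.1 (P.param N) a := by
  rw [j]
  by_cases h0 : N.1 = ⊥
  · rw [if_pos h0, P.iPlus_lt_iff N X ha, P.param_eq_zero h0]
    refine ⟨fun ⟨m, hm, h⟩ => ⟨-1, m, by norm_num, hm, ?_⟩, JLt.iLt⟩
    rwa [SpectralFamily.cut, SpectralFamily.gap, P.E_of_nonpos (-1) (by norm_num),
      ← P.E_of_nonpos 0 le_rfl]
  by_cases h1 : N.1 = ⊤
  · rw [if_neg h0, if_pos h1, P.iMinus_lt_iff N X ha, ← jLt_dual_star]
    refine ⟨fun h => jLt_dual_star.2 ?_, JLt.iLt⟩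
    obtain ⟨l, hl, h⟩ := iLt_dual_star.1 h
    refine ⟨l, P.param N + 1, hl, by linarith, ?_⟩
    have h2 := P.param_eq_length h1
    rwa [SpectralFamily.cut, SpectralFamily.gap, P.E_of_ge (P.param N + 1) (by linarith),
      ← P.E_of_ge (P.param N) h2.ge]
  rw [if_neg h0, if_neg h1]
  have : Nonempty (Set.Ioi N) := ⟨⟨_, lt_top_of_ne h1⟩⟩
  have : Nonempty (Set.Iio N) := ⟨⟨_, bot_lt_of_ne h0⟩⟩
  constructor
  · intro h
    obtain ⟨p, hp⟩ := exists_lt_of_ciInf_lt h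
    rw [P.compress_eq_cut] at hp
    exact ⟨_, _, P.strictMono p.2.2, P.strictMono p.1.2, hp⟩
  · rintro ⟨l, m, hl, hm, h⟩
    obtain ⟨M, hNM, hMm⟩ := P.exists_param_mem_Ioc h1 hm
    obtain ⟨L, hLN, hlL⟩ := P.exists_param_mem_Ico h0 hl
    refine (ciInf_le ⟨0, ?_⟩ ((⟨M, hNM⟩, ⟨L, hLN⟩) : Set.Ioi N × Set.Iio N)).trans_lt ?_
    · rintro _ ⟨_, rfl⟩
      exact norm_nonneg _
    · rw [P.compress_eq_cut]
      exact (P.family.norm_cut_le_cut hlL (P.strictMono (hLN.trans hNM)).le hMm _).trans_lt h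

end Parametrization

end ContinuousNest

/-! ### Greatest diagonal seminorm functions -/

namespace ContinuousNest

open SpectralFamily

variable {H : Type*} [NormedAddCommGroup H] [InnerProductSpace ℂ H] [CompleteSpace H]
  {𝒩 : ContinuousNest H}

/-- The possible values at `N` of a diagonal seminorm function. -/
def IsDiagonalSeminormAt (N : 𝒩.carrier) (s : 𝒩.alg → ℝ) : Prop :=
  s = j N ∨ ∃ a ∈ ({0, ePlus N, iPlus N} : Set (𝒩.alg → ℝ)),
    ∃ b ∈ ({0, eMinus N, iMinus N} : Set (𝒩.alg → ℝ)), s = a ⊔ b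

/-- The values of a greatest diagonal seminorm function are chosen independently at the members of
the nest, so each of them dominates every such seminorm that is less than `c` at `Y`. -/
theorem le_of_isGreatest {ν : 𝒩.carrier → 𝒩.alg → ℝ} {Y : 𝒩.alg} {c : ℝ}
    (h : IsGreatest {μ | IsDiagonalSeminormFunction μ ∧ ∀ N, μ N Y < c} ν) {N : 𝒩.carrier}
    {s : 𝒩.alg → ℝ} (hs : IsDiagonalSeminormAt N s) (hY : s Y < c) (X : 𝒩.alg) : s X ≤ ν N X := by
  classical
  have h1 : Function.update ν N s ∈
      {μ : 𝒩.carrier → 𝒩.alg → ℝ | IsDiagonalSeminormFunction μ ∧ ∀ N, μ N Y < c} := by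
    refine ⟨fun M => ?_, fun M => ?_⟩ <;> rcases eq_or_ne M N with rfl | hM
    · rw [Function.update_self]
      exact hs
    · rw [Function.update_of_ne hM]
      exact h.1.1 M
    · rwa [Function.update_self]
    · rw [Function.update_of_ne hM]
      exact h.1.2 M
  simpa using h.2 h1 N X

theorem isDiagonalSeminormAt_ePlus (N : 𝒩.carrier) : IsDiagonalSeminormAt N (ePlus N) :=
  .inr ⟨ePlus N, by simp, 0, by simp, (sup_eq_left.2 fun X => ePlus_nonneg N X).symm⟩

theorem isDiagonalSeminormAt_iPlus (N : 𝒩.carrier) : IsDiagonalSeminormAt N (iPlus N) :=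
  .inr ⟨iPlus N, by simp, 0, by simp, (sup_eq_left.2 fun X => iPlus_nonneg N X).symm⟩

theorem isDiagonalSeminormAt_eMinus (N : 𝒩.carrier) : IsDiagonalSeminormAt N (eMinus N) :=
  .inr ⟨0, by simp, eMinus N, by simp, (sup_eq_right.2 fun X => eMinus_nonneg N X).symm⟩

theorem isDiagonalSeminormAt_iMinus (N : 𝒩.carrier) : IsDiagonalSeminormAt N (iMinus N) :=
  .inr ⟨0, by simp, iMinus N, by simp, (sup_eq_right.2 fun X => iMinus_nonneg N X).symm⟩

theorem IsDiagonalSeminormAt.nonneg {N : 𝒩.carrier} {s : 𝒩.alg → ℝ}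
    (hs : IsDiagonalSeminormAt N s) (X : 𝒩.alg) : 0 ≤ s X := by
  obtain rfl | ⟨a, ha, b, -, rfl⟩ := hs
  · exact j_nonneg N X
  · refine le_trans ?_ (le_sup_left : a X ≤ a X ⊔ b X)
    obtain rfl | rfl | rfl := ha
    exacts [le_rfl, ePlus_nonneg N X, iPlus_nonneg N X]

/-- Every operator of the nest algebra whose greatest diagonal seminorms are less than `a` is within
distance `a` of an operator at which they vanish. -/
theorem exists_diagonal_perturbation [TopologicalSpace.SeparableSpace H]
    {ν : 𝒩.carrier → 𝒩.alg → ℝ} (hν : IsGreatestDiagonalSeminormFunction ν) (X : 𝒩.alg) {a : ℝ}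
    (hX : ∀ N, ν N X < a) :
    ∃ T : 𝒩.alg, ‖(X : H →L[ℂ] H) - T‖ ≤ a ∧ ∀ N, ν N T = 0 := by
  obtain ⟨Y, c, hc, hG⟩ := hν
  obtain ⟨P⟩ := nonempty_parametrization 𝒩
  set F := P.family
  have ha : 0 < a :=
    (IsDiagonalSeminormAt.nonneg (hG.1.1 ⟨⊥, 𝒩.bot_mem⟩) X).trans_lt (hX _)
  have hlt : ∀ {N s}, IsDiagonalSeminormAt N s → s Y < c → s X < a := fun hs hY =>
    (le_of_isGreatest hG hs hY X).trans_lt (hX _)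
  -- The set is cut off to a bounded one; it still contains all the parameters in question.
  set U : Set ℝ := {t | F.JLt Y t c} ∩ Set.Ioo (-1) (P.length + 1)
  have hXU : ∀ t ∈ U, F.JLt X.1 t a := fun t ht => by
    rcases lt_or_ge t 0 with h0 | h0
    · refine ⟨t - 1, 0, by linarith, h0, ?_⟩
      rwa [P.cut_eq_zero_of_nonpos (by linarith) le_rfl, norm_zero]
    rcases lt_or_ge P.length t with h1 | h1
    · refine ⟨P.length, t + 1, h1, by linarith, ?_⟩
      rwa [P.cut_eq_zero_of_ge le_rfl (by linarith), norm_zero]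
    obtain ⟨N, rfl⟩ := P.exists_param_eq t ⟨h0, h1⟩
    exact (P.j_lt_iff N X ha).1 (hlt (.inl rfl) ((P.j_lt_iff N Y hc).2 ht.1))
  obtain ⟨Z, hZ, hZa, hJ, hR, hL⟩ := exists_norm_le_agreeing (P.mem_alg_iff.1 X.2) ha.le
    ((isOpen_jLt Y.1 c).inter isOpen_Ioo) (bddBelow_Ioo.mono Set.inter_subset_right)
    (bddAbove_Ioo.mono Set.inter_subset_right) hXU
  set T : 𝒩.alg := X - ⟨Z, P.mem_alg_iff.2 hZ⟩
  have hTZ : T.1 = X.1 - Z := rfl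
  have hU : ∀ N, P.param N ∈ Set.Ioo (-1) (P.length + 1) := fun N =>
    ⟨by linarith [(P.param_mem_Icc N).1], by linarith [(P.param_mem_Icc N).2]⟩
  -- If the seminorms of `Y` are less than `c` to the right of `N`, then `N` lies in `U` or is the
  -- left endpoint of a component of `U`.
  have hright : ∀ N m, P.param N < m → (∀ r ∈ Set.Ioo (P.param N) m, F.JLt Y r c) →
      F.JZero T.1 (P.param N) ∨ F.AgreesRight X Z (P.param N) a := fun N m hm h => by
    by_cases hN : P.param N ∈ U
    · exact .inl (hJ _ hN)
    · refine .inr (hR _ (min m (P.length + 1)) hN (lt_min hm (hU N).2) fun r hr => ⟨?_, ?_, ?_⟩)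
      · exact h r ⟨hr.1, hr.2.trans_le (min_le_left _ _)⟩
      · exact (hU N).1.trans hr.1
      · exact hr.2.trans_le (min_le_right _ _)
  have hleft : ∀ N m, -P.param N < m →
      (∀ r ∈ Set.Ioo (-P.param N) m, F.dual.JLt (star Y.1) r c) →
      F.JZero T.1 (P.param N) ∨ F.dual.AgreesRight (star X.1) (star Z) (-P.param N) a :=
    fun N m hm h => by
    by_cases hN : P.param N ∈ U
    · exact .inl (hJ _ hN)
    · refine .inr (hL (max (-m) (-1)) _ hN (max_lt (by linarith) (hU N).1)
        fun r hr => ⟨?_, ?_, ?_⟩)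
      · refine jLt_dual_star.1 (h (-r) ⟨neg_lt_neg hr.2, ?_⟩)
        linarith [(le_max_left (-m) (-1)).trans_lt hr.1]
      · exact (le_max_right _ _).trans_lt hr.1
      · exact hr.2.trans (hU N).2
  have hTstar : star T.1 = star X.1 - star Z := star_sub _ _
  have hiP : ∀ N, iPlus N Y < c → iPlus N T = 0 := fun N h => by
    refine le_antisymm (le_of_forall_gt_imp_ge_of_dense fun ε hε => ?_) (iPlus_nonneg N T)
    obtain ⟨m, hm, hmY⟩ := ((P.iPlus_lt_iff N Y hc).1 h).exists_jLt
    have hXa := (P.iPlus_lt_iff N X ha).1 (hlt (isDiagonalSeminormAt_iPlus N) h)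
    exact ((P.iPlus_lt_iff N T hε).2
      ((hright N m hm hmY).elim (fun h => h.iZero) (fun h => h.1 hXa) ε hε)).le
  have heP : ∀ N, ePlus N Y < c → ePlus N T = 0 := fun N h => by
    refine le_antisymm (le_of_forall_gt_imp_ge_of_dense fun ε hε => ?_) (ePlus_nonneg N T)
    obtain ⟨m, hm, hmY⟩ := ((P.ePlus_lt_iff N Y hc).1 h).exists_jLt
    have hXa := (P.ePlus_lt_iff N X ha).1 (hlt (isDiagonalSeminormAt_ePlus N) h)
    exact ((P.ePlus_lt_iff N T hε).2
      ((hright N m hm hmY).elim (fun h => h.iZero.eZero) (fun h => h.2 hXa) ε hε)).le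
  have hiM : ∀ N, iMinus N Y < c → iMinus N T = 0 := fun N h => by
    refine le_antisymm (le_of_forall_gt_imp_ge_of_dense fun ε hε => ?_) (iMinus_nonneg N T)
    obtain ⟨m, hm, hmY⟩ := ((P.iMinus_lt_iff N Y hc).1 h).exists_jLt
    have hXa := (P.iMinus_lt_iff N X ha).1 (hlt (isDiagonalSeminormAt_iMinus N) h)
    exact ((P.iMinus_lt_iff N T hε).2
      ((hleft N m hm hmY).elim (fun h => h.dual_star.iZero) (fun h => hTstar ▸ h.1 hXa) ε hε)).le
  have heM : ∀ N, eMinus N Y < c → eMinus N T = 0 := fun N h => by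
    refine le_antisymm (le_of_forall_gt_imp_ge_of_dense fun ε hε => ?_) (eMinus_nonneg N T)
    obtain ⟨m, hm, hmY⟩ := ((P.eMinus_lt_iff N Y hc).1 h).exists_jLt
    have hXa := (P.eMinus_lt_iff N X ha).1 (hlt (isDiagonalSeminormAt_eMinus N) h)
    exact ((P.eMinus_lt_iff N T hε).2
      ((hleft N m hm hmY).elim (fun h => h.dual_star.iZero.eZero) (fun h => hTstar ▸ h.2 hXa)
        ε hε)).le
  refine ⟨T, by rwa [hTZ, sub_sub_cancel], fun N => ?_⟩
  have hNY := hG.1.2 N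
  obtain h | ⟨s, hs, s', hs', h⟩ := hG.1.1 N
  · rw [h] at hNY ⊢
    refine le_antisymm (le_of_forall_gt_imp_ge_of_dense fun ε hε => ?_) (j_nonneg N T)
    exact ((P.j_lt_iff N T hε).2 (hJ _ ⟨(P.j_lt_iff N Y hc).1 hNY, hU N⟩ ε hε)).le
  · rw [h, Pi.sup_apply, sup_lt_iff] at hNY
    have h1 : s T = 0 := by
      obtain rfl | rfl | rfl := hs
      exacts [rfl, heP N hNY.1, hiP N hNY.1]
    have h2 : s' T = 0 := by
      obtain rfl | rfl | rfl := hs'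
      exacts [rfl, heM N hNY.2, hiM N hNY.2]
    rw [h, Pi.sup_apply, h1, h2, sup_idem]

end ContinuousNest

theorem mainTheorem7 {H : Type*} [NormedAddCommGroup H] [InnerProductSpace ℂ H] [CompleteSpace H]
    [TopologicalSpace.SeparableSpace H] (𝒩 : ContinuousNest H)
    (ν : 𝒩.carrier → 𝒩.alg → ℝ)
    (hν : ContinuousNest.IsGreatestDiagonalSeminormFunction ν)
    (X : 𝒩.alg) (a : ℝ) (hX : ∀ N, ν N X < a) :
    ∃ T : 𝒩.alg, ‖(X : H →L[ℂ] H) - T‖ ≤ a ∧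
      ((∃ b < a, ∀ N, ν N X ≤ b) → ‖(X : H →L[ℂ] H) - T‖ < a) ∧
      ∀ N, ν N T = 0 := by
  by_cases hb : ∃ b < a, ∀ N, ν N X ≤ b
  · obtain ⟨b, hba, hb⟩ := hb
    obtain ⟨b', hb1, hb2⟩ := exists_between hba
    obtain ⟨T, hT, hT0⟩ :=
      ContinuousNest.exists_diagonal_perturbation hν X fun N => (hb N).trans_lt hb1
    exact ⟨T, hT.trans hb2.le, fun _ => hT.trans_lt hb2, hT0⟩
  · obtain ⟨T, hT, hT0⟩ := ContinuousNest.exists_diagonal_perturbation hν X hX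
    exact ⟨T, hT, fun h => absurd h hb, hT0⟩
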